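/- **Problem.** Let $p,q,m$ be natural numbers, let $\mathcal X\subset\mathbb R^p$ and $\mathcal Y^i\subset\mathbb R^q$ ($i=1,\dots,m$) be closed and convex, and suppose $\|y-y'\|\le D_y$ for all $y,y'\in\mathcal Y^i$, where $D_y>0$. Let $f$ and $g_i$ be real-valued and continuous on $\mathcal X$ and on $\mathcal X\times\mathcal Y^i$, let $f$ be convex, and let $g_i$ be convex in $x\in\mathcal X$ and concave in $y\in\mathcal Y^i$ (no strong convexity or concavity: $\mu_f=\mu_y=0$). Put $g_i^*(x)=\max_{y\in\mathcal Y^i}g_i(x,y)$ and $g^*=(g_1^*,\dots,g_m^*)$, and consider $\min\{f(x):x\in\mathcal X,\ g_i(x,y)\le0\ \forall y\in\mathcal Y^i,\ i=1,\dots,m\}$. Let $x^*$ be an optimal solution and $\lambda^*\in\mathbb R^m_+$ a vector of multipliers for it: $x^*\in\arg\min_{x\in\mathcal X}[f(x)+\lambda^{*\top}g^*(x)]$ and $\lambda_i^*g_i^*(x^*)=0$ for all $i$. Put $\Lambda=\|\lambda^*\|_1+1$. **Regularity.** Let $\nabla f$, $\nabla_xg_i$ be subgradients of $f$ and of $g_i$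 in $x$, and $\nabla_yg_i$ a supergradient of $g_i$ in $y$ (relative to the domains). There are constants $L_f,L_g^{xx},L_g^{yx},L_g^{yy},H_f,H_g^x,H_g^y,M_g^x,M_g^y\ge0$ such that for all $x,x'\in\mathcal X$, all $i$ and all $y,y'\in\mathcal Y^i$: (a) $f(x)\le f(x')+\nabla f(x')^\top(x-x')+\frac{L_f}2\|x-x'\|^2+H_f\|x-x'\|$; (b) $g_i(x,y)-g_i(x',y)-\nabla_xg_i(x',y)^\top(x-x')\le\frac{L_g^{xx}}2\|x-x'\|^2+H_g^x\|x-x'\|$; (c) $\|\nabla_yg_i(x,y)-\nabla_yg_i(x',y')\|\le L_g^{yx}\|x-x'\|+L_g^{yy}\|y-y'\|+H_g^y$; (d) $|g_i(x,y)-g_i(x',y')|\le M_g^x\|x-x'\|+M_g^y\|y-y'\|$ and $\|\nabla_xg_i(x,y)\|\le M_g^x$. **Oracles.** Let $\nabla F(x,\xi)$, $G_i(x,y,\xi)$, $\nabla_xG_i(x,y,\xi)$, $\nabla_yG_i(x,y,\xi)$ be jointly measurable and, for $x\in\mathcal X$ and $y\in\mathcal Y^i$, unbiased estimators of $\nabla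 f(x)$, $g_i(x,y)$, $\nabla_xg_i(x,y)$, $\nabla_yg_i(x,y)$ with variances (expected squared Euclidean distances from the mean) at most $\sigma_{f'}^2$, $\sigma_g^2$, $\sigma_{g'}^2$, $\sigma_{g'}^2$, where $\sigma_{f'},\sigma_g,\sigma_{g'}\ge0$. If $\sigma_{g'}=0$, suppose $\sigma_g=0$, and read $\sigma_g^2/\sigma_{g'}$ as $0$ in that case. **Method (SGSIP).** Write $\ell_{G_i}(x,\xi;x',y)=G_i(x',y,\xi)+\nabla_xG_i(x',y,\xi)^\top(x-x')$ and $\ell_G=(\ell_{G_1},\dots,\ell_{G_m})$. Let $K\ge1$, $x_{-2}=x_{-1}=x_0\in\mathcal X$, $y_{-1}^i=y_0^i\in\mathcal Y^i$ and $\lambda_0=0$ be deterministic, and let $\xi_k^1,\dots,\xi_k^6$, $k\ge0$, be independent samples of $\xi$. For $k=0,\dots,K-1$ let $$u_k^i=\nabla_yG_i(x_k,y_k^i,\xi_k^1)+\theta_k[\nabla_yG_i(x_k,y_k^i,\xi_k^1)-\nabla_yG_i(x_{k-1},y_{k-1}^i,\xi_k^2)],$$ $$y_{k+1}^i=\arg\min_{y\in\mathcal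 Y^i}-\langle u_k^i,y\rangle+\tfrac{\sigma_k}2\|y-y_k^i\|^2,\qquad i=1,\dots,m,$$ $$v_k=\ell_G(x_k,\xi_k^3;x_{k-1},y_{k+1})+\theta_k[\ell_G(x_k,\xi_k^4;x_{k-1},y_k)-\ell_G(x_{k-1},\xi_k^5;x_{k-2},y_k)],$$ $$\lambda_{k+1}=\arg\min_{\lambda\ge0}-\langle v_k,\lambda\rangle+\tfrac{\gamma_k}2\|\lambda-\lambda_k\|^2,$$ $$x_{k+1}=\arg\min_{x\in\mathcal X}\Big\langle\nabla F(x_k,\xi_k^6)+\sum_{i=1}^m\lambda_{k+1,i}\nabla_xG_i(x_k,y_{k+1}^i,\xi_k^6),x\Big\rangle+\tfrac{\tau_k}2\|x-x_k\|^2,$$ and let $\bar x_K=\sum_{k=0}^{K-1}t_kx_{k+1}/\sum_{k=0}^{K-1}t_k$. The parameters are $t_k=\theta_k=1$, $$\tau_k=\max\{\tau',\tau\sqrt K\},\qquad \sigma_k=\max\Big\{\sqrt{56}L_g^{yy},\,14L_g^{yx},\,\tfrac{\sqrt{(H_g^y)^2+\sigma_{g'}^2}}{D_y}\sqrt K\Big\},$$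 $$\gamma_k=60m(M_g^x)^2+\frac{60m\sigma_{g'}(2K-k)}{\sqrt K},$$ where $\sigma_k>0$ and $\gamma_k>0$ for all $k<K$, $\tau'\ge\max\{4(L_f+1+\sigma_{g'}),\,8(L_g^{yx}+L_g^{xx})\Lambda\}$ and $\tau\ge\sqrt{(H_g^x)^2\Lambda^2+H_f^2+\sigma_{g'}^2\Lambda+\sigma_{f'}^2}$. **Conclusion.** The two expectations below exist and, with $R=\|x^*-x_0\|$, $$\mathbb E[f(\bar x_K)-f(x^*)]\le B_1(K):=\frac{\tau'R^2}{2K}+\frac{\tau R^2}{2\sqrt K}+\frac{4H_f}{\sqrt K}+\frac{2\sigma_{f'}}{\sqrt K}+\frac{\sigma_g^2}{2\sigma_{g'}\sqrt K}$$ and $$\begin{aligned}\mathbb E\|[g^*(\bar x_K)]_+\|_\infty\le B_2(K):={}&\frac{\tau'R^2}{2K}+\frac{\tau R^2}{2\sqrt K}+\frac{60m(M_g^x)^2\Lambda^2}{K}+\frac{120m\sigma_{g'}\Lambda^2}{\sqrt K}\\&+\frac{\max\{\sqrt{56}L_g^{yy},14L_g^{yx}\}D_y^2\Lambda}{K}+\frac{8\sqrt{(H_g^y)^2+\sigma_{g'}^2}\,D_y\Lambda}{\sqrt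 K}+\frac{4\sqrt{(H_g^x)^2\Lambda^2+H_f^2}}{\sqrt K}\\&+\frac{\sqrt{10m}\,\sigma_{g'}D_y\Lambda}{\sqrt K}+\frac{4\sqrt{\sigma_{f'}^2+\sigma_{g'}^2\Lambda^2}}{\sqrt K}+\frac{15m\Lambda\sigma_{g'}D_y}{\sqrt K}+\frac{\sigma_g^2}{2\sigma_{g'}\sqrt K}.\end{aligned}$$ Both bounds are $O(1/K+1/\sqrt K)$, and the iteration complexity is $O(\varepsilon^{-2})$: with $C=\max\{B_1(1),B_2(1)\}^2$, which depends neither on $K$ nor on $\varepsilon$, for every $\varepsilon>0$ and every $K\ge C/\varepsilon^2$ both expectations are at most $\varepsilon$. -/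

import Mathlib

open MeasureTheory ProbabilityTheory
open scoped BigOperators

namespace SGSIP

/-- Euclidean space of dimension `n`. -/
abbrev Vec (n : ℕ) := EuclideanSpace ℝ (Fin n)

/-- The data of the semi-infinite program
`min f x` over `x ∈ X` subject to `g i x y ≤ 0` for all `y ∈ Y i` and all `i`. -/
structure Problem (p q m : ℕ) where
  X : Set (Vec p)
  Y : Fin m → Set (Vec q)
  f : Vec p → ℝ
  g : Fin m → Vec p → Vec q → ℝ

/-- A choice of the (sub)gradients of `f`, of `g i` in `x`, and of `g i` in `y`. -/
structure Gradients (p q m : ℕ) where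
  gradf : Vec p → Vec p
  gradxg : Fin m → Vec p → Vec q → Vec p
  gradyg : Fin m → Vec p → Vec q → Vec q

/-- Stochastic oracles for the gradient of `f`, for `g i`, and for its two partial gradients;
the last argument is the random sample. -/
structure Oracle (p q m : ℕ) (Ξ : Type*) where
  gradF : Vec p → Ξ → Vec p
  G : Fin m → Vec p → Vec q → Ξ → ℝ
  gradxG : Fin m → Vec p → Vec q → Ξ → Vec p
  gradyG : Fin m → Vec p → Vec q → Ξ → Vec q

/-- The constants of the standing assumptions: the diameter bound, the smoothness and Lipschitz
constants, and the standard deviations `sigF` (oracle of the gradient of `f`), `sigG`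
(oracle of the values of `g`) and `sigDG` (oracles of the gradients of `g`). -/
structure Consts where
  Dy : ℝ
  Lf : ℝ
  Lxx : ℝ
  Lyx : ℝ
  Lyy : ℝ
  Hf : ℝ
  Hx : ℝ
  Hy : ℝ
  Mx : ℝ
  My : ℝ
  sigF : ℝ
  sigG : ℝ
  sigDG : ℝ

/-- All constants other than the diameter bound are non-negative. -/
structure Consts.Nonneg (c : Consts) : Prop where
  Lf : 0 ≤ c.Lf
  Lxx : 0 ≤ c.Lxx
  Lyx : 0 ≤ c.Lyx
  Lyy : 0 ≤ c.Lyy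
  Hf : 0 ≤ c.Hf
  Hx : 0 ≤ c.Hx
  Hy : 0 ≤ c.Hy
  Mx : 0 ≤ c.Mx
  My : 0 ≤ c.My
  sigF : 0 ≤ c.sigF
  sigG : 0 ≤ c.sigG
  sigDG : 0 ≤ c.sigDG

namespace Problem

variable {p q m : ℕ}

/-- `gStar i x` is the maximum of `g i x y` over `y ∈ Y i`. -/
noncomputable def gStar (P : Problem p q m) (i : Fin m) (x : Vec p) : ℝ :=
  sSup ((fun y => P.g i x y) '' P.Y i)

/-- The sup norm of the positive part of `(gStar 1 x, …, gStar m x)`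
(the norm on `Fin m → ℝ` is the sup norm). -/
noncomputable def violation (P : Problem p q m) (x : Vec p) : ℝ :=
  ‖(fun i => max (P.gStar i x) 0 : Fin m → ℝ)‖

def Feasible (P : Problem p q m) (x : Vec p) : Prop :=
  x ∈ P.X ∧ ∀ i, ∀ y ∈ P.Y i, P.g i x y ≤ 0

def IsOptimal (P : Problem p q m) (x : Vec p) : Prop :=
  P.Feasible x ∧ ∀ x', P.Feasible x' → P.f x ≤ P.f x'

/-- `l` is a vector of optimal Lagrange multipliers belonging to the optimal solution `x`. -/
structure IsMultiplier (P : Problem p q m) (x : Vec p) (l : Fin m → ℝ) : Prop where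
  nonneg : ∀ i, 0 ≤ l i
  minimizes : IsMinOn (fun z => P.f z + ∑ i, l i * P.gStar i z) P.X x
  complementary : ∀ i, l i * P.gStar i x = 0

/-- Convexity and compactness: the sets are convex and closed, the `Y i` have diameter at most
`Dy`, `f` and `g i` are continuous, `f` is convex, `g i` is convex in `x` and concave in `y`
(no strong convexity or concavity is required). -/
structure ConvexCompact (P : Problem p q m) (Dy : ℝ) : Prop where
  convex_X : Convex ℝ P.X
  closed_X : IsClosed P.X
  convex_Y : ∀ i, Convex ℝ (P.Y i)
  closed_Y : ∀ i, IsClosed (P.Y i)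
  diam_Y : ∀ i, ∀ y ∈ P.Y i, ∀ y' ∈ P.Y i, ‖y - y'‖ ≤ Dy
  continuous_f : ContinuousOn P.f P.X
  continuous_g : ∀ i, ContinuousOn (fun z : Vec p × Vec q => P.g i z.1 z.2) (P.X ×ˢ P.Y i)
  convex_f : ConvexOn ℝ P.X P.f
  convex_g : ∀ i, ∀ y ∈ P.Y i, ConvexOn ℝ P.X (fun x => P.g i x y)
  concave_g : ∀ i, ∀ x ∈ P.X, ConcaveOn ℝ (P.Y i) (fun y => P.g i x y)

end Problem

section Assumptions

variable {p q m : ℕ}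

/-- `D` consists of subgradients of `f` and of `g i` in `x`, and of supergradients of
`g i` in `y`, at all points of the domain. -/
structure Gradients.IsSubgradient (D : Gradients p q m) (P : Problem p q m) : Prop where
  f : ∀ x ∈ P.X, ∀ x' ∈ P.X, P.f x' + inner ℝ (D.gradf x') (x - x') ≤ P.f x
  gx : ∀ i, ∀ y ∈ P.Y i, ∀ x ∈ P.X, ∀ x' ∈ P.X,
    P.g i x' y + inner ℝ (D.gradxg i x' y) (x - x') ≤ P.g i x y
  gy : ∀ i, ∀ x ∈ P.X, ∀ y ∈ P.Y i, ∀ y' ∈ P.Y i,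
    P.g i x y ≤ P.g i x y' + inner ℝ (D.gradyg i x y') (y - y')

/-- Smoothness and Lipschitz continuity; `bound_gradx` says that the chosen subgradients
in `x` respect the Lipschitz constant `Mx`. -/
structure SmoothLipschitz (P : Problem p q m) (D : Gradients p q m) (c : Consts) : Prop where
  f_upper : ∀ x ∈ P.X, ∀ x' ∈ P.X,
    P.f x ≤ P.f x' + inner ℝ (D.gradf x') (x - x') + c.Lf / 2 * ‖x - x'‖ ^ 2 + c.Hf * ‖x - x'‖
  g_upper : ∀ i, ∀ y ∈ P.Y i, ∀ x ∈ P.X, ∀ x' ∈ P.X,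
    P.g i x y - P.g i x' y - inner ℝ (D.gradxg i x' y) (x - x')
      ≤ c.Lxx / 2 * ‖x - x'‖ ^ 2 + c.Hx * ‖x - x'‖
  grady_lip : ∀ i, ∀ x ∈ P.X, ∀ x' ∈ P.X, ∀ y ∈ P.Y i, ∀ y' ∈ P.Y i,
    ‖D.gradyg i x y - D.gradyg i x' y'‖ ≤ c.Lyx * ‖x - x'‖ + c.Lyy * ‖y - y'‖ + c.Hy
  g_lip : ∀ i, ∀ x ∈ P.X, ∀ x' ∈ P.X, ∀ y ∈ P.Y i, ∀ y' ∈ P.Y i,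
    |P.g i x y - P.g i x' y'| ≤ c.Mx * ‖x - x'‖ + c.My * ‖y - y'‖
  bound_gradx : ∀ i, ∀ x ∈ P.X, ∀ y ∈ P.Y i, ‖D.gradxg i x y‖ ≤ c.Mx

/-- `Z` is an unbiased estimator of `z` under the law `ν` with variance at most `s ^ 2`. -/
structure UnbiasedWithVariance {E Ξ : Type*} [NormedAddCommGroup E] [NormedSpace ℝ E]
    [MeasurableSpace Ξ] (ν : Measure Ξ) (Z : Ξ → E) (z : E) (s : ℝ) : Prop where
  integrable : Integrable Z ν
  mean : ∫ e, Z e ∂ν = z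
  integrable_sq : Integrable (fun e => ‖Z e - z‖ ^ 2) ν
  variance : ∫ e, ‖Z e - z‖ ^ 2 ∂ν ≤ s ^ 2

/-- The oracles are measurable, unbiased and of bounded variance when the random sample
has law `ν`. -/
structure Oracle.IsStochasticOracle {Ξ : Type*} [MeasurableSpace Ξ] (O : Oracle p q m Ξ)
    (ν : Measure Ξ) (P : Problem p q m) (D : Gradients p q m) (c : Consts) : Prop where
  measurable_gradF : Measurable (fun z : Vec p × Ξ => O.gradF z.1 z.2)
  measurable_G : ∀ i, Measurable (fun z : Vec p × Vec q × Ξ => O.G i z.1 z.2.1 z.2.2)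
  measurable_gradxG : ∀ i, Measurable (fun z : Vec p × Vec q × Ξ => O.gradxG i z.1 z.2.1 z.2.2)
  measurable_gradyG : ∀ i, Measurable (fun z : Vec p × Vec q × Ξ => O.gradyG i z.1 z.2.1 z.2.2)
  gradF : ∀ x ∈ P.X, UnbiasedWithVariance ν (O.gradF x) (D.gradf x) c.sigF
  G : ∀ i, ∀ x ∈ P.X, ∀ y ∈ P.Y i, UnbiasedWithVariance ν (O.G i x y) (P.g i x y) c.sigG
  gradxG : ∀ i, ∀ x ∈ P.X, ∀ y ∈ P.Y i,
    UnbiasedWithVariance ν (O.gradxG i x y) (D.gradxg i x y) c.sigDG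
  gradyG : ∀ i, ∀ x ∈ P.X, ∀ y ∈ P.Y i,
    UnbiasedWithVariance ν (O.gradyG i x y) (D.gradyg i x y) c.sigDG

/-- The samples `ξ k j` (`j = 0, …, 5`, six in every iteration `k`) are independent
with common law `ν`. -/
structure IsIIDSample {Ω Ξ : Type*} [MeasurableSpace Ω] [MeasurableSpace Ξ]
    (ξ : ℕ → Fin 6 → Ω → Ξ) (ν : Measure Ξ) (μ : Measure Ω) : Prop where
  measurable : ∀ k j, Measurable (ξ k j)
  law : ∀ k j, μ.map (ξ k j) = ν
  indep : iIndepFun (fun a : ℕ × Fin 6 => ξ a.1 a.2) μ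

end Assumptions

section Algorithm

variable {p q m : ℕ} {Ω Ξ : Type*}

/-- The `i`-th component of the stochastic linearization at `(x', y)`, evaluated at `x`. -/
noncomputable def Oracle.lin (O : Oracle p q m Ξ) (i : Fin m) (x : Vec p) (e : Ξ)
    (x' : Vec p) (y : Vec q) : ℝ :=
  O.G i x' y e + inner ℝ (O.gradxG i x' y e) (x - x')

/-- `(x, y, lam)` are the iterates of `K` iterations of the stochastic primal-dual method with
momentum weights `θ` and step-size parameters `τ`, `σ`, `γ`, started at `(x0, y0, l0)` and driven
by the samples `ξ`. The subtractions `k - 1` and `k - 2` are truncated at `0`, which is the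
convention that the iterates with index `-1` and `-2` are the initial ones. -/
structure IsRun (P : Problem p q m) (O : Oracle p q m Ξ) (θ τ σ γ : ℕ → ℝ) (K : ℕ)
    (x0 : Vec p) (y0 : Fin m → Vec q) (l0 : Vec m) (ξ : ℕ → Fin 6 → Ω → Ξ)
    (x : ℕ → Ω → Vec p) (y : ℕ → Ω → Fin m → Vec q) (lam : ℕ → Ω → Vec m) : Prop where
  x_zero : ∀ ω, x 0 ω = x0
  y_zero : ∀ ω, y 0 ω = y0
  lam_zero : ∀ ω, lam 0 ω = l0
  y_mem : ∀ k < K, ∀ ω i, y (k + 1) ω i ∈ P.Y i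
  y_step : ∀ k < K, ∀ ω i,
    IsMinOn (fun w : Vec q =>
      - inner ℝ
          (O.gradyG i (x k ω) (y k ω i) (ξ k 0 ω)
            + θ k • (O.gradyG i (x k ω) (y k ω i) (ξ k 0 ω)
              - O.gradyG i (x (k - 1) ω) (y (k - 1) ω i) (ξ k 1 ω))) w
        + σ k / 2 * ‖w - y k ω i‖ ^ 2)
      (P.Y i) (y (k + 1) ω i)
  lam_mem : ∀ k < K, ∀ ω i, 0 ≤ lam (k + 1) ω i
  lam_step : ∀ k < K, ∀ ω,
    IsMinOn (fun l : Vec m =>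
      - (∑ i,
          (O.lin i (x k ω) (ξ k 2 ω) (x (k - 1) ω) (y (k + 1) ω i)
            + θ k * (O.lin i (x k ω) (ξ k 3 ω) (x (k - 1) ω) (y k ω i)
              - O.lin i (x (k - 1) ω) (ξ k 4 ω) (x (k - 2) ω) (y k ω i))) * l i)
        + γ k / 2 * ‖l - lam k ω‖ ^ 2)
      {l : Vec m | ∀ i, 0 ≤ l i} (lam (k + 1) ω)
  x_mem : ∀ k < K, ∀ ω, x (k + 1) ω ∈ P.X
  x_step : ∀ k < K, ∀ ω,
    IsMinOn (fun w : Vec p =>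
      inner ℝ
          (O.gradF (x k ω) (ξ k 5 ω)
            + ∑ i, lam (k + 1) ω i • O.gradxG i (x k ω) (y (k + 1) ω i) (ξ k 5 ω)) w
        + τ k / 2 * ‖w - x k ω‖ ^ 2)
      P.X (x (k + 1) ω)

/-- The output: the average of `x 1, …, x K` with weights `t 0, …, t (K - 1)`. -/
noncomputable def average (t : ℕ → ℝ) (K : ℕ) (x : ℕ → Ω → Vec p) (ω : Ω) : Vec p :=
  (∑ k ∈ Finset.range K, t k)⁻¹ • ∑ k ∈ Finset.range K, t k • x (k + 1) ω

end Algorithm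

section Schedule

/-- The parameter `τ_k = max {τ', τ √K}` (written with `a` for `τ'` and `b` for `τ`). -/
noncomputable def tauStep (a b : ℝ) (K : ℕ) : ℝ := max a (b * √(K : ℝ))

/-- The parameter `σ_k`. -/
noncomputable def sigmaStep (c : Consts) (K : ℕ) : ℝ :=
  max (max (√56 * c.Lyy) (14 * c.Lyx)) (√(c.Hy ^ 2 + c.sigDG ^ 2) / c.Dy * √(K : ℝ))

/-- The parameter `γ_k`. -/
noncomputable def gammaStep (c : Consts) (m K k : ℕ) : ℝ :=
  60 * m * c.Mx ^ 2 + 60 * m * c.sigDG * (2 * (K : ℝ) - k) / √(K : ℝ)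

/-- The bound on the expected objective gap; `R` is the distance of `x0` to the optimal solution,
`a` and `b` are the parameters of `tauStep`. -/
noncomputable def objBound (c : Consts) (R a b : ℝ) (K : ℕ) : ℝ :=
  a * R ^ 2 / (2 * K) + b * R ^ 2 / (2 * √(K : ℝ)) + 4 * c.Hf / √(K : ℝ)
    + 2 * c.sigF / √(K : ℝ) + c.sigG ^ 2 / (2 * c.sigDG * √(K : ℝ))

/-- The bound on the expected constraint violation; `Λ` is the `ℓ¹`-norm of the optimal
multipliers plus one. -/
noncomputable def conBound (c : Consts) (m : ℕ) (R Λ a b : ℝ) (K : ℕ) : ℝ :=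
  a * R ^ 2 / (2 * K) + b * R ^ 2 / (2 * √(K : ℝ))
    + 60 * m * c.Mx ^ 2 * Λ ^ 2 / K
    + 120 * m * c.sigDG * Λ ^ 2 / √(K : ℝ)
    + max (√56 * c.Lyy) (14 * c.Lyx) * c.Dy ^ 2 * Λ / K
    + 8 * √(c.Hy ^ 2 + c.sigDG ^ 2) * c.Dy * Λ / √(K : ℝ)
    + 4 * √(c.Hx ^ 2 * Λ ^ 2 + c.Hf ^ 2) / √(K : ℝ)
    + √(10 * m) * c.sigDG * c.Dy * Λ / √(K : ℝ)
    + 4 * √(c.sigF ^ 2 + c.sigDG ^ 2 * Λ ^ 2) / √(K : ℝ)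
    + 15 * m * Λ * c.sigDG * c.Dy / √(K : ℝ)
    + c.sigG ^ 2 / (2 * c.sigDG * √(K : ℝ))

end Schedule

end SGSIP

/-! The method seeks a saddle point of f(x) + Σ l_i g_i(x, y_i), minimised over x in X and maximised
over l ≥ 0 and y_i in Y_i. For comparison points l and ŷ, the gap f(x_{k+1}) - f(x*) + Σ l_i
g_i(x_{k+1}, ŷ_i) splits into a y-part (concavity), a λ-part (linearisation of g) and an x-part
(convexity and feasibility of x*), each controlled by the three-point inequality of one proximal
step. The extrapolation turns the use of old information into a telescoping correction plus products
of increments, and the negative squares ‖z_{k+1} - z_k‖² of the proximal steps absorb these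
products. The outcome is `NoisyPath.gap_sum`, a deterministic estimate along each sample path.

The noise remains. For the constraint violation, l and ŷ depend on the sample path, so noise paired
with them is not centred. Each pairing is therefore split: noise against the current iterate has
mean zero, while noise against the comparison point is bounded by Young's inequality through the
squared norm of the summed noise, whose expectation grows only linearly in K by orthogonality of
martingale differences. Hence `SampledRun.gap_le` bounds all gaps at once by a constant plus one
integrable random variable free of l and ŷ, and no measurability in the comparison points is needed.

Two noises scale with unbounded iterates: that of the x-step with λ_{k+1}, that of the λ-step with
x_k - x_{k-1}. They are absorbed before anything is summed in expectation. The linear decrease of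
γ_k leaves a negative multiple of Σ ‖l - λ_{k+1}‖², and the size of τ' leaves -σ_{g'}/2 Σ ‖x_{k+1} -
x_k‖². These integrals are finite because square integrability of the iterates passes from step to
step (`SampledRun.state`).

Jensen's inequality passes to the averaged point. The choice l = 0 gives the objective bound. The
choices l = λ* + e_j give the violation bound, since the Lagrangian at λ* is minimal at x* and so
contributes a nonnegative amount (`violation_average_le`). What is left is arithmetic with the step
sizes. -/

namespace SGSIP

/-! ### Proximal steps and optimistic telescoping -/

section Prox

variable {E : Type*} [NormedAddCommGroup E] [InnerProductSpace ℝ E]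

/-- First-order optimality along the segment from z to c: divide the increment of the objective by t
and let t tend to 0 from above. -/
theorem prox_variational {C : Set E} (hC : Convex ℝ C) {h a z : E} {s : ℝ} (hz : z ∈ C)
    (hmin : IsMinOn (fun w => inner ℝ h w + s / 2 * ‖w - a‖ ^ 2) C z) {c : E} (hc : c ∈ C) :
    0 ≤ inner ℝ (h + s • (z - a)) (c - z) := by
  set B := inner ℝ (h + s • (z - a)) (c - z) with hB
  have key : ∀ t ∈ Set.Ioo (0 : ℝ) 1, 0 ≤ B + t * (s / 2 * ‖c - z‖ ^ 2) := by
    intro t ht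
    have hmem : z + t • (c - z) ∈ C := hC.add_smul_sub_mem hz hc ⟨ht.1.le, ht.2.le⟩
    have h1 := hmin hmem
    simp only [Set.mem_ofPred_eq] at h1
    have h2 : z + t • (c - z) - a = (z - a) + t • (c - z) := by abel
    rw [h2, norm_add_sq_real, inner_add_right, inner_smul_right, inner_smul_right, norm_smul,
      Real.norm_of_nonneg ht.1.le] at h1
    have h3 : B = inner ℝ h (c - z) + s * inner ℝ (z - a) (c - z) := by
      rw [hB, inner_add_left, inner_smul_left]; simp
    have h4 : 0 ≤ t * (B + t * (s / 2 * ‖c - z‖ ^ 2)) := by rw [h3]; nlinarith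
    exact nonneg_of_mul_nonneg_right h4 ht.1
  have hlim : Filter.Tendsto (fun t : ℝ => B + t * (s / 2 * ‖c - z‖ ^ 2))
      (nhdsWithin 0 (Set.Ioi 0)) (nhds (B + 0 * (s / 2 * ‖c - z‖ ^ 2))) := by
    apply Filter.Tendsto.mono_left _ nhdsWithin_le_nhds
    exact (by fun_prop : Continuous fun t : ℝ => B + t * (s / 2 * ‖c - z‖ ^ 2)).tendsto 0
  have := ge_of_tendsto hlim (Filter.eventually_of_mem (Ioo_mem_nhdsGT one_pos) key)
  simpa using this

/-- The three-point inequality of a proximal step. -/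
theorem prox_three_point {C : Set E} (hC : Convex ℝ C) {h a z : E} {s : ℝ} (hz : z ∈ C)
    (hmin : IsMinOn (fun w => inner ℝ h w + s / 2 * ‖w - a‖ ^ 2) C z) {c : E} (hc : c ∈ C) :
    inner ℝ h (z - c) ≤ s / 2 * (‖c - a‖ ^ 2 - ‖c - z‖ ^ 2 - ‖z - a‖ ^ 2) := by
  have h1 := prox_variational hC hz hmin hc
  have h2 : c - a = (c - z) + (z - a) := by abel
  rw [h2, norm_add_sq_real]
  have h3 : inner ℝ h (z - c) = - inner ℝ h (c - z) := by
    rw [← inner_neg_right, neg_sub]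
  rw [inner_add_left, inner_smul_left] at h1
  simp only [conj_trivial] at h1
  rw [h3, real_inner_comm (z - a) (c - z)]
  linarith

/-- The metric projection onto a closed convex set, as a non-expansive map. -/
theorem exists_lipschitz_projection [CompleteSpace E] {C : Set E} (hne : C.Nonempty)
    (hcl : IsClosed C) (hC : Convex ℝ C) :
    ∃ g : E → E, LipschitzWith 1 g ∧
      ∀ w, ∀ z ∈ C, (∀ c ∈ C, inner ℝ (w - z) (c - z) ≤ 0) → z = g w := by
  have hex : ∀ w : E, ∃ z ∈ C, ∀ c ∈ C, inner ℝ (w - z) (c - z) ≤ 0 := by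
    intro w
    obtain ⟨z, hz, h⟩ := exists_norm_eq_iInf_of_complete_convex hne hcl.isComplete hC w
    exact ⟨z, hz, (norm_eq_iInf_iff_real_inner_le_zero hC hz).1 h⟩
  choose g hg hgi using hex
  have key : ∀ w w' z z', z ∈ C → z' ∈ C → (∀ c ∈ C, inner ℝ (w - z) (c - z) ≤ 0) →
      (∀ c ∈ C, inner ℝ (w' - z') (c - z') ≤ 0) → ‖z - z'‖ ≤ ‖w - w'‖ := by
    intro w w' z z' hz hz' h h'
    have h1 := h z' hz'
    have h2 := h' z hz
    have h3 : ‖z - z'‖ ^ 2 ≤ inner ℝ (w - w') (z - z') := by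
      have e1 : inner ℝ (w - z) (z' - z) = - inner ℝ (w - z) (z - z') := by
        rw [← inner_neg_right, neg_sub]
      have e2 : inner ℝ (w - w') (z - z') - ‖z - z'‖ ^ 2
          = inner ℝ (w - z) (z - z') - inner ℝ (w' - z') (z - z') := by
        rw [← real_inner_self_eq_norm_sq, ← inner_sub_left, ← inner_sub_left]
        congr 1; abel
      linarith
    have h4 := real_inner_le_norm (w - w') (z - z')
    by_contra hlt
    push Not at hlt
    nlinarith [norm_nonneg (w - w'), norm_nonneg (z - z')]
  refine ⟨g, LipschitzWith.of_dist_le_mul fun w w' => ?_, fun w z hz h => ?_⟩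
  · simpa [dist_eq_norm] using key w w' _ _ (hg w) (hg w') (hgi w) (hgi w')
  · have := key w w z (g w) hz (hg w) h (hgi w)
    simpa [sub_eq_zero] using this

/-- The minimiser is the projection of a - s⁻¹ h, a Lipschitz function of the data, so it is
measurable for any sigma-algebra that makes h and a measurable. This is what makes the iterates
adapted. -/
theorem measurable_prox [CompleteSpace E] [MeasurableSpace E] [BorelSpace E]
    [SecondCountableTopology E] {Ω : Type*} {mΩ : MeasurableSpace Ω} {C : Set E}
    (hcl : IsClosed C) (hC : Convex ℝ C) {h a z : Ω → E} {s : ℝ} (hs : 0 < s)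
    (hh : Measurable h) (ha : Measurable a) (hz : ∀ ω, z ω ∈ C)
    (hmin : ∀ ω, IsMinOn (fun w => inner ℝ (h ω) w + s / 2 * ‖w - a ω‖ ^ 2) C (z ω)) :
    Measurable z := by
  rcases isEmpty_or_nonempty Ω with hΩ | ⟨⟨ω₀⟩⟩
  · exact measurable_of_empty z
  obtain ⟨g, hg, hgz⟩ := exists_lipschitz_projection ⟨z ω₀, hz ω₀⟩ hcl hC
  have : z = fun ω => g (a ω - s⁻¹ • h ω) := by
    funext ω
    refine hgz _ _ (hz ω) fun c hc => ?_
    have h1 := prox_variational hC (hz ω) (hmin ω) hc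
    have h2 : a ω - s⁻¹ • h ω - z ω = - (s⁻¹ • (h ω + s • (z ω - a ω))) := by
      rw [smul_add, smul_smul, inv_mul_cancel₀ hs.ne', one_smul]; abel
    rw [h2, inner_neg_left, inner_smul_left]
    simp only [conj_trivial, Left.neg_nonpos_iff]
    positivity
  rw [this]
  exact hg.continuous.measurable.comp (ha.sub (hh.const_smul _))

/-- Summation of the inequalities of an optimistic (extrapolated) proximal method. -/
theorem sum_inner_le_of_optimistic (z G u q n : ℕ → E) (c : E) (s : ℕ → ℝ) (K : ℕ)
    (hprox : ∀ k < K, inner ℝ (u k) (c - z (k + 1))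
      ≤ s k / 2 * (‖c - z k‖ ^ 2 - ‖c - z (k + 1)‖ ^ 2 - ‖z (k + 1) - z k‖ ^ 2))
    (hG : ∀ k < K, G (k + 1) = u k + q (k + 1) - q k - n k) (hq : q 0 = 0) :
    ∑ k ∈ Finset.range K, inner ℝ (G (k + 1)) (c - z (k + 1))
      ≤ (∑ k ∈ Finset.range K,
          s k / 2 * (‖c - z k‖ ^ 2 - ‖c - z (k + 1)‖ ^ 2 - ‖z (k + 1) - z k‖ ^ 2))
        + inner ℝ (q K) (c - z K)
        + ∑ k ∈ Finset.range K,
          (inner ℝ (q k) (z (k + 1) - z k) + inner ℝ (n k) (z (k + 1) - c)) := by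
  induction K with
  | zero => simp [hq]
  | succ K ih =>
    have ih' := ih (fun k hk => hprox k (by omega)) (fun k hk => hG k (by omega))
    rw [Finset.sum_range_succ, Finset.sum_range_succ, Finset.sum_range_succ, hG K (by omega)]
    have h1 := hprox K (by omega)
    -- Splitting c - z (K + 1) as (c - z K) - (z (K + 1) - z K) in the pairing with q K produces the
    -- boundary term that cancels the one of the induction hypothesis, and one product of
    -- increments.
    have h2 : inner ℝ (u K + q (K + 1) - q K - n K) (c - z (K + 1))
        = inner ℝ (u K) (c - z (K + 1)) + inner ℝ (q (K + 1)) (c - z (K + 1))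
          - inner ℝ (q K) (c - z K) + inner ℝ (q K) (z (K + 1) - z K)
          + inner ℝ (n K) (z (K + 1) - c) := by
      simp only [inner_add_left, inner_sub_left, inner_sub_right]; ring
    rw [h2]
    linarith

/-- Young's inequality, weighted so that with step parameter s it uses half of the s / 2 available
in a proximal step. -/
theorem real_inner_le_of_pos {s : ℝ} (hs : 0 < s) (a b : E) :
    inner ℝ a b ≤ ‖a‖ ^ 2 / s + s / 4 * ‖b‖ ^ 2 := by
  have h1 := real_inner_le_norm a b
  have h2 : ‖a‖ * ‖b‖ ≤ ‖a‖ ^ 2 / s + s / 4 * ‖b‖ ^ 2 := by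
    rw [div_add' _ _ _ hs.ne', le_div_iff₀ hs]
    nlinarith [sq_nonneg (‖a‖ - s / 2 * ‖b‖)]
  linarith

end Prox

theorem mul_le_of_pos {s : ℝ} (hs : 0 < s) (a b : ℝ) : a * b ≤ a ^ 2 / s + s / 4 * b ^ 2 := by
  rw [div_add' _ _ _ hs.ne', le_div_iff₀ hs]
  nlinarith [sq_nonneg (a - s / 2 * b)]

/-! ### Summed inequalities for the y-steps and the λ-steps -/

section Sums

variable {E : Type*} [NormedAddCommGroup E] [InnerProductSpace ℝ E]

/-- Serves the y-steps, with e k the length of the preceding x-move. All corrections are charged to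
s / 2 times the squared increments of y: A costs s / 28, the two halves of B cost s / 7, H costs s /
14 (Young with weight 2s / 7) and the noise s / 4. The constants 14 and 7 make these add up to
exactly s / 2. -/
theorem optimistic_sum_le_of_const_step (y G n : ℕ → E) (e : ℕ → ℝ) (c : E) {A B H s : ℝ} (K : ℕ)
    (hA : 0 ≤ A) (hB : 0 ≤ B) (hs : 0 < s) (hAs : 14 * A ≤ s) (hBs : 7 * B ≤ s)
    (hprox : ∀ k < K, inner ℝ (G k + (G k - G (k - 1)) + n k) (c - y (k + 1))
      ≤ s / 2 * (‖c - y k‖ ^ 2 - ‖c - y (k + 1)‖ ^ 2 - ‖y (k + 1) - y k‖ ^ 2))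
    (hlip : ∀ k ≤ K, ‖G k - G (k - 1)‖ ≤ A * e k + B * ‖y k - y (k - 1)‖ + H) :
    ∑ k ∈ Finset.range K, inner ℝ (G (k + 1)) (c - y (k + 1))
      ≤ s / 2 * ‖c - y 0‖ ^ 2
        + ∑ k ∈ Finset.range K, (inner ℝ (n k) (y k - c) + ‖n k‖ ^ 2 / s)
        + A / 2 * ∑ k ∈ Finset.range (K + 1), e k ^ 2 + (K + 1) * (7 / 2 * (H ^ 2 / s)) := by
  have h := sum_inner_le_of_optimistic y G (fun k => G k + (G k - G (k - 1)) + n k)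
    (fun k => G k - G (k - 1)) n c (fun _ => s) K hprox
    -- The correction vanishes at k = 0 because 0 - 1 is truncated to 0.
    (fun k _ => by simp only [Nat.add_sub_cancel]; abel) (by simp)
  have tel : ∑ k ∈ Finset.range K,
      s / 2 * (‖c - y k‖ ^ 2 - ‖c - y (k + 1)‖ ^ 2 - ‖y (k + 1) - y k‖ ^ 2)
      = s / 2 * (‖c - y 0‖ ^ 2 - ‖c - y K‖ ^ 2)
        - s / 2 * ∑ k ∈ Finset.range K, ‖y (k + 1) - y k‖ ^ 2 := by
    rw [← Finset.sum_range_sub' (fun k => ‖c - y k‖ ^ 2), Finset.mul_sum, Finset.mul_sum,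
      ← Finset.sum_sub_distrib]
    exact Finset.sum_congr rfl fun k _ => by ring
  have hq : ∀ k ≤ K, ∀ v : E, inner ℝ (G k - G (k - 1)) v
      ≤ A / 2 * e k ^ 2 + B / 2 * ‖y k - y (k - 1)‖ ^ 2 + 7 / 2 * (H ^ 2 / s)
        + (A / 2 + B / 2 + s / 14) * ‖v‖ ^ 2 := by
    intro k hk v
    have h1 := real_inner_le_norm (G k - G (k - 1)) v
    have h2 := mul_le_mul_of_nonneg_right (hlip k hk) (norm_nonneg v)
    have h3 := mul_le_of_pos (show 0 < 2 / 7 * s by positivity) H ‖v‖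
    have h4 : H ^ 2 / (2 / 7 * s) = 7 / 2 * (H ^ 2 / s) := by field_simp
    rw [h4] at h3
    nlinarith [mul_nonneg hA (sq_nonneg (e k - ‖v‖)),
      mul_nonneg hB (sq_nonneg (‖y k - y (k - 1)‖ - ‖v‖))]
  have hn : ∀ k, inner ℝ (n k) (y (k + 1) - c)
      ≤ inner ℝ (n k) (y k - c) + ‖n k‖ ^ 2 / s + s / 4 * ‖y (k + 1) - y k‖ ^ 2 := by
    intro k
    have h1 := real_inner_le_of_pos hs (n k) (y (k + 1) - y k)
    have h2 : y (k + 1) - c = (y k - c) + (y (k + 1) - y k) := by abel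
    rw [h2, inner_add_right]; linarith
  have hsum : ∑ k ∈ Finset.range K,
        (inner ℝ (G k - G (k - 1)) (y (k + 1) - y k) + inner ℝ (n k) (y (k + 1) - c))
      ≤ ∑ k ∈ Finset.range K, (inner ℝ (n k) (y k - c) + ‖n k‖ ^ 2 / s)
        + A / 2 * ∑ k ∈ Finset.range K, e k ^ 2
        + B / 2 * ∑ k ∈ Finset.range K, ‖y k - y (k - 1)‖ ^ 2
        + K * (7 / 2 * (H ^ 2 / s))
        + (A / 2 + B / 2 + s / 14 + s / 4) * ∑ k ∈ Finset.range K, ‖y (k + 1) - y k‖ ^ 2 := by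
    have hK : (K : ℝ) * (7 / 2 * (H ^ 2 / s)) = ∑ k ∈ Finset.range K, 7 / 2 * (H ^ 2 / s) := by
      simp
    rw [hK, Finset.mul_sum, Finset.mul_sum, Finset.mul_sum, ← Finset.sum_add_distrib,
      ← Finset.sum_add_distrib, ← Finset.sum_add_distrib, ← Finset.sum_add_distrib]
    refine Finset.sum_le_sum fun k hk => ?_
    have h1 := hq k (Finset.mem_range.1 hk).le (y (k + 1) - y k)
    have h2 := hn k
    linarith
  have hlast := hq K le_rfl (c - y K)
  -- The increment of index 0 is zero, and the last one comes from the boundary pairing at K;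
  -- together they form the full shifted sum.
  have hshift : ∑ k ∈ Finset.range K, ‖y k - y (k - 1)‖ ^ 2 + ‖y K - y (K - 1)‖ ^ 2
      = ∑ k ∈ Finset.range K, ‖y (k + 1) - y k‖ ^ 2 := by
    rw [← Finset.sum_range_succ (fun k => ‖y k - y (k - 1)‖ ^ 2), Finset.sum_range_succ']
    simp
  rw [Finset.sum_range_succ (fun k => e k ^ 2)]
  have hδ : 0 ≤ ∑ k ∈ Finset.range K, ‖y (k + 1) - y k‖ ^ 2 :=
    Finset.sum_nonneg fun _ _ => by positivity
  have hc : (A / 2 + B / 2 + s / 14 + s / 4 + B / 2)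
      * ∑ k ∈ Finset.range K, ‖y (k + 1) - y k‖ ^ 2
      ≤ s / 2 * ∑ k ∈ Finset.range K, ‖y (k + 1) - y k‖ ^ 2 :=
    mul_le_mul_of_nonneg_right (by linarith) hδ
  have hc' : (A / 2 + B / 2 + s / 14) * ‖c - y K‖ ^ 2 ≤ s / 2 * ‖c - y K‖ ^ 2 :=
    mul_le_mul_of_nonneg_right (by linarith) (by positivity)
  rw [← hshift] at hc
  nlinarith [hsum, hlast, h, tel, hshift]

/-- Serves the λ-steps. Summation by parts turns the decrease κ of the steps into the negative sum
of ‖c - z (k + 1)‖², which later absorbs x-step noise of variance proportional to ‖λ‖². Since γ is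
antitone, every division by γ k is relaxed to one by γ K, so a single constant governs all the noise
terms. -/
theorem optimistic_sum_le_of_decreasing_step (z G u q n : ℕ → E) (c : E) (γ Q : ℕ → ℝ) {κ : ℝ}
    (K : ℕ) (hκ : 0 ≤ κ) (hstep : ∀ k, γ k = γ (k + 1) + κ) (hγ : 0 < γ K)
    (hprox : ∀ k < K, inner ℝ (u k) (c - z (k + 1))
      ≤ γ k / 2 * (‖c - z k‖ ^ 2 - ‖c - z (k + 1)‖ ^ 2 - ‖z (k + 1) - z k‖ ^ 2))
    (hG : ∀ k < K, G (k + 1) = u k + q (k + 1) - q k - n k) (hq : q 0 = 0)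
    (hqQ : ∀ k ≤ K, ‖q k‖ ^ 2 ≤ Q k * γ K) :
    ∑ k ∈ Finset.range K, inner ℝ (G (k + 1)) (c - z (k + 1))
      ≤ γ 0 / 2 * ‖c - z 0‖ ^ 2 - κ / 2 * ∑ k ∈ Finset.range K, ‖c - z (k + 1)‖ ^ 2
        + ∑ k ∈ Finset.range K, (inner ℝ (n k) (z k - c) + ‖n k‖ ^ 2 / γ K)
        + ∑ k ∈ Finset.range (K + 1), Q k := by
  have h := sum_inner_le_of_optimistic z G u q n c γ K hprox hG hq
  have hanti : Antitone γ := antitone_nat_of_succ_le fun k => by rw [hstep k]; linarith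
  have tel : ∑ k ∈ Finset.range K,
      γ k / 2 * (‖c - z k‖ ^ 2 - ‖c - z (k + 1)‖ ^ 2 - ‖z (k + 1) - z k‖ ^ 2)
      = γ 0 / 2 * ‖c - z 0‖ ^ 2 - γ K / 2 * ‖c - z K‖ ^ 2
        - κ / 2 * ∑ k ∈ Finset.range K, ‖c - z (k + 1)‖ ^ 2
        - ∑ k ∈ Finset.range K, γ k / 2 * ‖z (k + 1) - z k‖ ^ 2 := by
    rw [← Finset.sum_range_sub' (fun k => γ k / 2 * ‖c - z k‖ ^ 2), Finset.mul_sum,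
      ← Finset.sum_sub_distrib, ← Finset.sum_sub_distrib]
    exact Finset.sum_congr rfl fun k _ => by rw [hstep k]; ring
  have hpos : ∀ k ≤ K, 0 < γ k := fun k hk => hγ.trans_le (hanti hk)
  have hdiv : ∀ (v : E) k, k ≤ K → ‖v‖ ^ 2 / γ k ≤ ‖v‖ ^ 2 / γ K := fun v k hk =>
    div_le_div_of_nonneg_left (by positivity) hγ (hanti hk)
  have hqd : ∀ k ≤ K, ‖q k‖ ^ 2 / γ K ≤ Q k := fun k hk => (div_le_iff₀ hγ).2 (hqQ k hk)
  have hsum : ∑ k ∈ Finset.range K,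
        (inner ℝ (q k) (z (k + 1) - z k) + inner ℝ (n k) (z (k + 1) - c))
      ≤ ∑ k ∈ Finset.range K, (inner ℝ (n k) (z k - c) + ‖n k‖ ^ 2 / γ K)
        + ∑ k ∈ Finset.range K, Q k
        + ∑ k ∈ Finset.range K, γ k / 2 * ‖z (k + 1) - z k‖ ^ 2 := by
    rw [← Finset.sum_add_distrib, ← Finset.sum_add_distrib]
    refine Finset.sum_le_sum fun k hk => ?_
    have hk' := (Finset.mem_range.1 hk).le
    have h1 := real_inner_le_of_pos (hpos k hk') (q k) (z (k + 1) - z k)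
    have h2 := real_inner_le_of_pos (hpos k hk') (n k) (z (k + 1) - z k)
    have h3 : z (k + 1) - c = (z k - c) + (z (k + 1) - z k) := by abel
    rw [h3, inner_add_right]
    linarith [hdiv (q k) k hk', hdiv (n k) k hk', hqd k hk']
  have hlast := real_inner_le_of_pos hγ (q K) (c - z K)
  rw [Finset.sum_range_succ Q]
  have h5 : γ K / 4 * ‖c - z K‖ ^ 2 ≤ γ K / 2 * ‖c - z K‖ ^ 2 :=
    mul_le_mul_of_nonneg_right (by linarith) (by positivity)
  linarith [hqd K le_rfl]

end Sums

/-! ### Deterministic gap estimate along a sample path -/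

section Path

variable {p q m : ℕ}

/-- The exact linearization of `g i` in `x` at `(x', y)`, evaluated at `x`. -/
noncomputable def Problem.lin (P : Problem p q m) (D : Gradients p q m) (i : Fin m) (x x' : Vec p)
    (y : Vec q) : ℝ :=
  P.g i x' y + inner ℝ (D.gradxg i x' y) (x - x')

/-- A sample path of the method: exact first-order information perturbed by the
noise terms `nF`, `nZ`, `nl`, `ny`. -/
structure NoisyPath (P : Problem p q m) (D : Gradients p q m) (t s : ℝ) (γ : ℕ → ℝ) (K : ℕ)
    (x : ℕ → Vec p) (y : ℕ → Fin m → Vec q) (lam : ℕ → Vec m) (nF nZ : ℕ → Vec p)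
    (nl : ℕ → Vec m) (ny : ℕ → Fin m → Vec q) : Prop where
  x_mem : ∀ k ≤ K, x k ∈ P.X
  y_mem : ∀ k ≤ K, ∀ i, y k i ∈ P.Y i
  lam_zero : lam 0 = 0
  lam_nonneg : ∀ k ≤ K, ∀ i, 0 ≤ lam k i
  y_step : ∀ k < K, ∀ i, ∀ c ∈ P.Y i,
    inner ℝ (D.gradyg i (x k) (y k i)
        + (D.gradyg i (x k) (y k i) - D.gradyg i (x (k - 1)) (y (k - 1) i)) + ny k i)
      (c - y (k + 1) i)
      ≤ s / 2 * (‖c - y k i‖ ^ 2 - ‖c - y (k + 1) i‖ ^ 2 - ‖y (k + 1) i - y k i‖ ^ 2)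
  lam_step : ∀ k < K, ∀ l : Vec m, (∀ i, 0 ≤ l i) →
    inner ℝ (WithLp.toLp 2 (fun i => P.lin D i (x k) (x (k - 1)) (y (k + 1) i)
        + (P.lin D i (x k) (x (k - 1)) (y k i) - P.lin D i (x (k - 1)) (x (k - 2)) (y k i)))
        + nl k) (l - lam (k + 1))
      ≤ γ k / 2 * (‖l - lam k‖ ^ 2 - ‖l - lam (k + 1)‖ ^ 2 - ‖lam (k + 1) - lam k‖ ^ 2)
  x_step : ∀ k < K, ∀ c ∈ P.X,
    inner ℝ (D.gradf (x k) + ∑ i, lam (k + 1) i • D.gradxg i (x k) (y (k + 1) i) + nF k + nZ k)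
      (x (k + 1) - c)
      ≤ t / 2 * (‖c - x k‖ ^ 2 - ‖c - x (k + 1)‖ ^ 2 - ‖x (k + 1) - x k‖ ^ 2)

variable {P : Problem p q m} {D : Gradients p q m} {c : Consts} {t s : ℝ} {γ : ℕ → ℝ} {K : ℕ}
  {x : ℕ → Vec p} {y : ℕ → Fin m → Vec q} {lam : ℕ → Vec m} {nF nZ : ℕ → Vec p}
  {nl : ℕ → Vec m} {ny : ℕ → Fin m → Vec q}

theorem inner_vec (v w : Vec m) : inner ℝ v w = ∑ i, v i * w i := by
  rw [PiLp.inner_apply]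
  exact Finset.sum_congr rfl fun i _ => by simp [mul_comm]

theorem abs_g_sub_le (hsm : SmoothLipschitz P D c) {i : Fin m} {x x' : Vec p} {y : Vec q}
    (hx : x ∈ P.X) (hx' : x' ∈ P.X) (hy : y ∈ P.Y i) :
    |P.g i x y - P.g i x' y| ≤ c.Mx * ‖x - x'‖ := by
  simpa using hsm.g_lip i x hx x' hx' y hy y hy

theorem abs_inner_gradxg_le (hsm : SmoothLipschitz P D c) {i : Fin m} {x : Vec p} {y : Vec q}
    (hx : x ∈ P.X) (hy : y ∈ P.Y i) (v : Vec p) :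
    |inner ℝ (D.gradxg i x y) v| ≤ c.Mx * ‖v‖ :=
  (abs_real_inner_le_norm _ _).trans
    (mul_le_mul_of_nonneg_right (hsm.bound_gradx i x hx y hy) (norm_nonneg v))

theorem abs_lin_sub_lin_le (hsm : SmoothLipschitz P D c) {i : Fin m} {x x' x'' : Vec p} {y : Vec q}
    (hx' : x' ∈ P.X) (hx'' : x'' ∈ P.X) (hy : y ∈ P.Y i) :
    |P.lin D i x x' y - P.lin D i x' x'' y| ≤ c.Mx * (‖x - x'‖ + 2 * ‖x' - x''‖) := by
  have h1 := abs_g_sub_le hsm hx' hx'' hy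
  have h2 := abs_inner_gradxg_le hsm hx' hy (x - x')
  have h3 := abs_inner_gradxg_le hsm hx'' hy (x' - x'')
  unfold Problem.lin
  rw [abs_le] at *
  constructor <;> linarith

/-- The noise is correlated with x (k + 1), so its pairing is moved to x k and the increment is paid
for by Young. Of the t / 2 available, the errors nF, nZ and the nonsmooth terms take t / 8, t / 16
and t / 8, which leaves 3t / 16. The constant A is a reserve for the nonsmooth part of g. -/
theorem NoisyPath.x_part (h : NoisyPath P D t s γ K x y lam nF nZ nl ny)
    (hsm : SmoothLipschitz P D c) (hgrad : D.IsSubgradient P) {xs : Vec p} (hxs : xs ∈ P.X)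
    (ht : 0 < t) (A : ℝ) {k : ℕ} (hk : k < K) :
    P.f (x (k + 1)) - P.f xs
      + inner ℝ (∑ i, lam (k + 1) i • D.gradxg i (x k) (y (k + 1) i)) (x (k + 1) - xs)
      + A * ‖x (k + 1) - x k‖
    ≤ t / 2 * (‖xs - x k‖ ^ 2 - ‖xs - x (k + 1)‖ ^ 2) + inner ℝ (nF k + nZ k) (xs - x k)
      + 2 * (‖nF k‖ ^ 2 / t) + 4 * (‖nZ k‖ ^ 2 / t) + 2 * ((c.Hf + A) ^ 2 / t)
      + (c.Lf / 2 - 3 * t / 16) * ‖x (k + 1) - x k‖ ^ 2 := by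
  have h1 := h.x_step k hk xs hxs
  have h2 := hsm.f_upper _ (h.x_mem (k + 1) hk) _ (h.x_mem k hk.le)
  have h3 := hgrad.f xs hxs _ (h.x_mem k hk.le)
  have h4 : inner ℝ (D.gradf (x k)) (x (k + 1) - xs)
      = inner ℝ (D.gradf (x k)) (x (k + 1) - x k) - inner ℝ (D.gradf (x k)) (xs - x k) := by
    rw [← inner_sub_right]; congr 1; abel
  have h5 : inner ℝ (nF k + nZ k) (xs - x k) = - inner ℝ (nF k) (x (k + 1) - xs)
      - inner ℝ (nZ k) (x (k + 1) - xs) + inner ℝ (nF k) (x (k + 1) - x k)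
      + inner ℝ (nZ k) (x (k + 1) - x k) := by
    rw [inner_add_left]
    have e : xs - x k = (x (k + 1) - x k) - (x (k + 1) - xs) := by abel
    rw [e]; simp only [inner_sub_right]; ring
  have h6 := real_inner_le_of_pos (show 0 < t / 2 by linarith) (nF k) (x k - x (k + 1))
  have h7 := real_inner_le_of_pos (show 0 < t / 4 by linarith) (nZ k) (x k - x (k + 1))
  have h8 := mul_le_of_pos (show 0 < t / 2 by linarith) (c.Hf + A) ‖x (k + 1) - x k‖
  have e1 : ∀ r : ℝ, r / (t / 2) = 2 * (r / t) := fun r => by field_simp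
  have e2 : ∀ r : ℝ, r / (t / 4) = 4 * (r / t) := fun r => by field_simp
  have e3 : ∀ v : Vec p, inner ℝ v (x k - x (k + 1)) = - inner ℝ v (x (k + 1) - x k) := fun v => by
    rw [← inner_neg_right, neg_sub]
  rw [e1, norm_sub_rev (x k), e3] at h6
  rw [e2, norm_sub_rev (x k), e3] at h7
  rw [e1] at h8
  simp only [inner_add_left] at h1
  rw [h5]
  linarith

/-- Concavity replaces ŷ by y (k + 1), and the upper model of g in x replaces the value at x (k + 1)
by the linearisation at x k. Exchanging l for lam (k + 1) leaves the λ-part and a sum weighted by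
lam (k + 1), which the x-step controls. -/
theorem NoisyPath.gap_step (h : NoisyPath P D t s γ K x y lam nF nZ nl ny)
    (hsm : SmoothLipschitz P D c) (hgrad : D.IsSubgradient P) {xs : Vec p} (hxs : P.Feasible xs)
    (ht : 0 < t) {l : Vec m} (hl : ∀ i, 0 ≤ l i) {yh : Fin m → Vec q} (hyh : ∀ i, yh i ∈ P.Y i)
    {k : ℕ} (hk : k < K) :
    P.f (x (k + 1)) - P.f xs + ∑ i, l i * P.g i (x (k + 1)) (yh i)
    ≤ ∑ i, l i * inner ℝ (D.gradyg i (x (k + 1)) (y (k + 1) i)) (yh i - y (k + 1) i)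
      + inner ℝ (WithLp.toLp 2 fun i => P.lin D i (x (k + 1)) (x k) (y (k + 1) i))
          (l - lam (k + 1))
      + t / 2 * (‖xs - x k‖ ^ 2 - ‖xs - x (k + 1)‖ ^ 2) + inner ℝ (nF k + nZ k) (xs - x k)
      + 2 * (‖nF k‖ ^ 2 / t) + 4 * (‖nZ k‖ ^ 2 / t) + 2 * ((c.Hf + (∑ i, l i) * c.Hx) ^ 2 / t)
      + (c.Lf / 2 + (∑ i, l i) * c.Lxx / 2 - 3 * t / 16) * ‖x (k + 1) - x k‖ ^ 2 := by
  have hxk := h.x_mem k hk.le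
  have hxk' := h.x_mem (k + 1) hk
  have h1 : ∑ i, l i * P.g i (x (k + 1)) (yh i)
      ≤ ∑ i, l i * inner ℝ (D.gradyg i (x (k + 1)) (y (k + 1) i)) (yh i - y (k + 1) i)
        + ∑ i, l i * P.lin D i (x (k + 1)) (x k) (y (k + 1) i)
        + (∑ i, l i) * (c.Lxx / 2 * ‖x (k + 1) - x k‖ ^ 2 + c.Hx * ‖x (k + 1) - x k‖) := by
    rw [Finset.sum_mul, ← Finset.sum_add_distrib, ← Finset.sum_add_distrib]
    refine Finset.sum_le_sum fun i _ => ?_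
    rw [← mul_add, ← mul_add]
    refine mul_le_mul_of_nonneg_left ?_ (hl i)
    have a1 := hgrad.gy i _ hxk' _ (hyh i) _ (h.y_mem (k + 1) hk i)
    have a2 := hsm.g_upper i _ (h.y_mem (k + 1) hk i) _ hxk' _ hxk
    unfold Problem.lin
    linarith
  have h2 : inner ℝ (WithLp.toLp 2 fun i => P.lin D i (x (k + 1)) (x k) (y (k + 1) i))
          (l - lam (k + 1))
      = ∑ i, l i * P.lin D i (x (k + 1)) (x k) (y (k + 1) i)
        - ∑ i, lam (k + 1) i * P.lin D i (x (k + 1)) (x k) (y (k + 1) i) := by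
    rw [inner_vec, ← Finset.sum_sub_distrib]
    exact Finset.sum_congr rfl fun i _ => by simp; ring
  -- The linearisation at x k, evaluated at the feasible point xs, lies below g and hence is
  -- nonpositive; only the slope times x (k + 1) - xs survives.
  have h3 : ∑ i, lam (k + 1) i * P.lin D i (x (k + 1)) (x k) (y (k + 1) i)
      ≤ inner ℝ (∑ i, lam (k + 1) i • D.gradxg i (x k) (y (k + 1) i)) (x (k + 1) - xs) := by
    rw [sum_inner]
    refine Finset.sum_le_sum fun i _ => ?_
    rw [inner_smul_left]
    refine mul_le_mul_of_nonneg_left ?_ (h.lam_nonneg (k + 1) hk i)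
    have a1 := hgrad.gx i _ (h.y_mem (k + 1) hk i) xs hxs.1 _ hxk
    have a2 := hxs.2 i _ (h.y_mem (k + 1) hk i)
    have a3 : x (k + 1) - x k = (x (k + 1) - xs) + (xs - x k) := by abel
    unfold Problem.lin
    rw [a3, inner_add_right]
    linarith
  have h4 := h.x_part hsm hgrad hxs.1 ht ((∑ i, l i) * c.Hx) hk
  nlinarith [h1, h2, h3, h4]

/-- The primal-dual gap along a sample path, for arbitrary comparison points `l` and `yh`. -/
theorem NoisyPath.gap_sum (h : NoisyPath P D t s γ K x y lam nF nZ nl ny) (hc : c.Nonneg)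
    (hsm : SmoothLipschitz P D c) (hgrad : D.IsSubgradient P) {xs : Vec p} (hxs : P.Feasible xs)
    {l : Vec m} (hl : ∀ i, 0 ≤ l i) {yh : Fin m → Vec q} (hyh : ∀ i, yh i ∈ P.Y i)
    (hdiam : ∀ i, ∀ v ∈ P.Y i, ∀ w ∈ P.Y i, ‖v - w‖ ≤ c.Dy)
    (ht1 : 4 * (c.Lf + 1 + c.sigDG) ≤ t) (ht2 : 8 * (c.Lyx + c.Lxx) * (∑ i, l i) ≤ t)
    (hs : 0 < s) (hs1 : 14 * c.Lyx ≤ s) (hs2 : 7 * c.Lyy ≤ s)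
    {κ : ℝ} (hκ : 0 ≤ κ) (hstep : ∀ k, γ k = γ (k + 1) + κ) (hγ : 0 < γ K)
    (hγM : 60 * m * c.Mx ^ 2 ≤ γ K) :
    ∑ k ∈ Finset.range K, (P.f (x (k + 1)) - P.f xs + ∑ i, l i * P.g i (x (k + 1)) (yh i))
    ≤ t / 2 * ‖xs - x 0‖ ^ 2 + γ 0 / 2 * ‖l‖ ^ 2 + s / 2 * c.Dy ^ 2 * (∑ i, l i)
      + K * (2 * ((c.Hf + (∑ i, l i) * c.Hx) ^ 2 / t))
      + (∑ i, l i) * ((K + 1) * (7 / 2 * (c.Hy ^ 2 / s)))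
      + ∑ k ∈ Finset.range K, (inner ℝ (nF k + nZ k) (xs - x k)
          + 2 * (‖nF k‖ ^ 2 / t) + 4 * (‖nZ k‖ ^ 2 / t))
      + ∑ k ∈ Finset.range K, (inner ℝ (nl k) (lam k - l) + ‖nl k‖ ^ 2 / γ K)
      - κ / 2 * ∑ k ∈ Finset.range K, ‖l - lam (k + 1)‖ ^ 2
      - c.sigDG / 2 * ∑ k ∈ Finset.range K, ‖x (k + 1) - x k‖ ^ 2
      + ∑ i, l i * ∑ k ∈ Finset.range K,
          (inner ℝ (ny k i) (y k i - yh i) + ‖ny k i‖ ^ 2 / s) := by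
  have ht : 0 < t := by linarith [hc.Lf, hc.sigDG]
  set L := ∑ i, l i with hL
  have hL0 : 0 ≤ L := Finset.sum_nonneg fun i _ => hl i
  set S := ∑ k ∈ Finset.range K, ‖x (k + 1) - x k‖ ^ 2 with hS
  have hS0 : 0 ≤ S := Finset.sum_nonneg fun _ _ => by positivity
  have hsub : ∀ {k j : ℕ}, k ≤ K → x (k - j) ∈ P.X := fun hk => h.x_mem _ (by omega)
  -- Truncated indices make the increments at the start vanish, so the shifted sums cost no extra
  -- term.
  have hSe : ∑ k ∈ Finset.range (K + 1), ‖x k - x (k - 1)‖ ^ 2 = S := by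
    rw [Finset.sum_range_succ']; simp [hS]
  have hSe' : ∑ k ∈ Finset.range (K + 1), ‖x (k - 1) - x (k - 2)‖ ^ 2 ≤ S := by
    have e : ∑ k ∈ Finset.range (K + 1), ‖x (k - 1) - x (k - 2)‖ ^ 2
        = ∑ k ∈ Finset.range K, ‖x k - x (k - 1)‖ ^ 2 := by
      rw [Finset.sum_range_succ']; simp
    rw [e, ← hSe, Finset.sum_range_succ _ K]
    linarith [sq_nonneg ‖x K - x (K - 1)‖]
  have hyp : ∀ i, ∑ k ∈ Finset.range K,
        inner ℝ (D.gradyg i (x (k + 1)) (y (k + 1) i)) (yh i - y (k + 1) i)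
      ≤ s / 2 * c.Dy ^ 2
        + ∑ k ∈ Finset.range K, (inner ℝ (ny k i) (y k i - yh i) + ‖ny k i‖ ^ 2 / s)
        + c.Lyx / 2 * S + (K + 1) * (7 / 2 * (c.Hy ^ 2 / s)) := by
    intro i
    have h1 := optimistic_sum_le_of_const_step (fun k => y k i)
      (fun k => D.gradyg i (x k) (y k i)) (fun k => ny k i) (fun k => ‖x k - x (k - 1)‖) (yh i) K
      hc.Lyx hc.Lyy hs hs1 hs2 (fun k hk => h.y_step k hk i _ (hyh i))
      (fun k hk => hsm.grady_lip i _ (h.x_mem k hk) _ (hsub hk) _ (h.y_mem k hk i) _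
        (h.y_mem (k - 1) (by omega) i))
    rw [hSe] at h1
    have h2 : ‖yh i - y 0 i‖ ^ 2 ≤ c.Dy ^ 2 :=
      pow_le_pow_left₀ (norm_nonneg _) (hdiam i _ (hyh i) _ (h.y_mem 0 (by omega) i)) 2
    have h3 := mul_le_mul_of_nonneg_left h2 (by linarith : 0 ≤ s / 2)
    linarith
  have hlp := optimistic_sum_le_of_decreasing_step lam
    (fun k => WithLp.toLp 2 fun i => P.lin D i (x k) (x (k - 1)) (y k i))
    (fun k => WithLp.toLp 2 (fun i => P.lin D i (x k) (x (k - 1)) (y (k + 1) i)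
        + (P.lin D i (x k) (x (k - 1)) (y k i) - P.lin D i (x (k - 1)) (x (k - 2)) (y k i)))
        + nl k)
    (fun k => WithLp.toLp 2 fun i =>
      P.lin D i (x k) (x (k - 1)) (y k i) - P.lin D i (x (k - 1)) (x (k - 2)) (y k i))
    nl l γ (fun k => (3 * ‖x k - x (k - 1)‖ ^ 2 + 6 * ‖x (k - 1) - x (k - 2)‖ ^ 2) / 60) K hκ hstep
    hγ (fun k hk => h.lam_step k hk l hl)
    (fun k _ => by
      ext i
      simp only [PiLp.add_apply, PiLp.sub_apply, Nat.add_sub_cancel,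
        show k + 1 - 2 = k - 1 by omega]
      ring)
    (by ext i; simp)
    (fun k hk => by
      rw [EuclideanSpace.real_norm_sq_eq]
      have h1 : ∀ i ∈ (Finset.univ : Finset (Fin m)),
          (P.lin D i (x k) (x (k - 1)) (y k i) - P.lin D i (x (k - 1)) (x (k - 2)) (y k i)) ^ 2
          ≤ (c.Mx * (‖x k - x (k - 1)‖ + 2 * ‖x (k - 1) - x (k - 2)‖)) ^ 2 := fun i _ => by
        have h2 := abs_lin_sub_lin_le (x := x k) hsm (hsub (j := 1) hk) (hsub (j := 2) hk)
          (h.y_mem k hk i)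
        rw [← sq_abs]
        exact pow_le_pow_left₀ (abs_nonneg _) h2 2
      refine (Finset.sum_le_sum h1).trans ?_
      rw [Finset.sum_const, Finset.card_univ, Fintype.card_fin, nsmul_eq_mul]
      have h2 : (‖x k - x (k - 1)‖ + 2 * ‖x (k - 1) - x (k - 2)‖) ^ 2
          ≤ 3 * ‖x k - x (k - 1)‖ ^ 2 + 6 * ‖x (k - 1) - x (k - 2)‖ ^ 2 := by
        nlinarith [sq_nonneg (‖x k - x (k - 1)‖ - ‖x (k - 1) - x (k - 2)‖)]
      calc (m : ℝ) * (c.Mx * (‖x k - x (k - 1)‖ + 2 * ‖x (k - 1) - x (k - 2)‖)) ^ 2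
          = m * c.Mx ^ 2 * (‖x k - x (k - 1)‖ + 2 * ‖x (k - 1) - x (k - 2)‖) ^ 2 := by ring
        -- Here the constant 60 of the λ-steps enters: the squared Lipschitz factor of all m
        -- constraints is at most γ K / 60.
        _ ≤ (γ K / 60) * (3 * ‖x k - x (k - 1)‖ ^ 2 + 6 * ‖x (k - 1) - x (k - 2)‖ ^ 2) := by
            refine mul_le_mul (by linarith) h2 (by positivity) (by positivity)
        _ = _ := by ring)
  have hQ : ∑ k ∈ Finset.range (K + 1),
      (3 * ‖x k - x (k - 1)‖ ^ 2 + 6 * ‖x (k - 1) - x (k - 2)‖ ^ 2) / 60 ≤ 9 / 60 * S := by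
    rw [← Finset.sum_div, Finset.sum_add_distrib, ← Finset.mul_sum, ← Finset.mul_sum, hSe]
    linarith
  simp only [Nat.add_sub_cancel] at hlp
  rw [h.lam_zero, sub_zero] at hlp
  have hsteps := Finset.sum_le_sum fun k (hk : k ∈ Finset.range K) =>
    h.gap_step hsm hgrad hxs ht hl hyh (Finset.mem_range.1 hk)
  refine hsteps.trans ?_
  have hyl : ∑ k ∈ Finset.range K,
      ∑ i, l i * inner ℝ (D.gradyg i (x (k + 1)) (y (k + 1) i)) (yh i - y (k + 1) i)
      ≤ L * (s / 2 * c.Dy ^ 2 + c.Lyx / 2 * S + (K + 1) * (7 / 2 * (c.Hy ^ 2 / s)))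
        + ∑ i, l i * ∑ k ∈ Finset.range K,
          (inner ℝ (ny k i) (y k i - yh i) + ‖ny k i‖ ^ 2 / s) := by
    rw [Finset.sum_comm, hL, Finset.sum_mul, ← Finset.sum_add_distrib]
    refine Finset.sum_le_sum fun i _ => ?_
    rw [← Finset.mul_sum, ← mul_add]
    refine mul_le_mul_of_nonneg_left ?_ (hl i)
    linarith [hyp i]
  have htel : ∑ k ∈ Finset.range K, t / 2 * (‖xs - x k‖ ^ 2 - ‖xs - x (k + 1)‖ ^ 2)
      ≤ t / 2 * ‖xs - x 0‖ ^ 2 := by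
    rw [← Finset.mul_sum, Finset.sum_range_sub' (fun k => ‖xs - x k‖ ^ 2)]
    exact mul_le_mul_of_nonneg_left (by linarith [sq_nonneg ‖xs - x K‖]) (by linarith)
  -- One part t / 8 covers Lf / 2 + 1 / 2 + sigDG / 2, the other t / 16 covers L (Lyx + Lxx) / 2,
  -- and 1 / 2 exceeds the 9 / 60 from the λ-corrections. The remaining -sigDG / 2 is kept for the
  -- noise of the linearisations.
  have hcoef : (c.Lf / 2 + L * c.Lxx / 2 - 3 * t / 16 + L * c.Lyx / 2 + 9 / 60) * S
      ≤ - (c.sigDG / 2) * S :=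
    mul_le_mul_of_nonneg_right (by linarith) hS0
  simp only [Finset.sum_add_distrib, ← Finset.mul_sum, Finset.sum_const, Finset.card_range,
    nsmul_eq_mul] at hyl hlp htel hQ ⊢
  rw [← hS]
  linarith

end Path

set_option linter.unusedSectionVars false

/-! ### Integrating out an independent sample -/

section Freeze

variable {Ω Ξ E : Type*} {mΩ : MeasurableSpace Ω} {mΞ : MeasurableSpace Ξ} {mE : MeasurableSpace E}
  {μ : Measure Ω} [IsProbabilityMeasure μ] {ν : Measure Ξ} {W : Ω → E} {ζ : Ω → Ξ}

/-- Independence makes the joint law a product, so Tonelli integrates over ζ with W frozen. This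
nonnegative version supplies the integrability that the signed one presupposes. -/
theorem lintegral_freeze (hW : Measurable W) (hζ : Measurable ζ) (hind : IndepFun W ζ μ)
    (hlaw : μ.map ζ = ν) {Ψ : E × Ξ → ENNReal} (hΨ : Measurable Ψ) :
    ∫⁻ ω, Ψ (W ω, ζ ω) ∂μ = ∫⁻ ω, ∫⁻ e, Ψ (W ω, e) ∂ν ∂μ := by
  have hp : IsProbabilityMeasure ν := hlaw ▸ Measure.isProbabilityMeasure_map hζ.aemeasurable
  have h := (indepFun_iff_map_prod_eq_prod_map_map hW.aemeasurable hζ.aemeasurable).1 hind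
  rw [← lintegral_map hΨ (hW.prodMk hζ), h, hlaw, lintegral_prod _ hΨ.aemeasurable,
    lintegral_map hΨ.lintegral_prod_right' hW]

theorem integral_freeze (hW : Measurable W) (hζ : Measurable ζ) (hind : IndepFun W ζ μ)
    (hlaw : μ.map ζ = ν) {Ψ : E × Ξ → ℝ} (hΨ : Measurable Ψ)
    (hint : Integrable (fun ω => Ψ (W ω, ζ ω)) μ) :
    ∫ ω, Ψ (W ω, ζ ω) ∂μ = ∫ ω, ∫ e, Ψ (W ω, e) ∂ν ∂μ := by
  have hp : IsProbabilityMeasure ν := hlaw ▸ Measure.isProbabilityMeasure_map hζ.aemeasurable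
  have hp' := Measure.isProbabilityMeasure_map (μ := μ) hW.aemeasurable
  have h := (indepFun_iff_map_prod_eq_prod_map_map hW.aemeasurable hζ.aemeasurable).1 hind
  have hWζ := hW.prodMk hζ
  have h1 : Integrable Ψ (μ.map fun ω => (W ω, ζ ω)) :=
    (integrable_map_measure hΨ.aestronglyMeasurable hWζ.aemeasurable).2 hint
  rw [← integral_map hWζ.aemeasurable hΨ.aestronglyMeasurable, h, hlaw] at *
  rw [integral_prod _ h1, integral_map hW.aemeasurable]
  exact (hΨ.stronglyMeasurable.integral_prod_right').aestronglyMeasurable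

end Freeze

/-! ### Calculus of centred noise -/

section Noise

variable {Ω : Type*} {m1 m2 m3 mΩ : MeasurableSpace Ω} {μ : Measure Ω}
variable {F : Type*} [NormedAddCommGroup F] [InnerProductSpace ℝ F]

theorem integrable_inner_of_memLp {Z M : Ω → F} (hZ : MemLp Z 2 μ) (hM : MemLp M 2 μ) :
    Integrable (fun ω => inner ℝ (Z ω) (M ω)) μ := by
  have h := MemLp.integrable_mul hZ.norm hM.norm
  refine h.mono (hZ.1.inner hM.1) (Filter.Eventually.of_forall fun ω => ?_)
  simpa using abs_real_inner_le_norm (Z ω) (M ω)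

theorem integrable_norm_sq {Z : Ω → F} (hZ : MemLp Z 2 μ) : Integrable (fun ω => ‖Z ω‖ ^ 2) μ :=
  (memLp_two_iff_integrable_sq_norm hZ.1).1 hZ

variable [MeasurableSpace F] [BorelSpace F] [SecondCountableTopology F]

/-- `Z` is a square-integrable, `m2`-measurable random vector orthogonal to all square-integrable
`m1`-measurable ones, with second moment at most `v`. -/
structure CenteredNoise (μ : Measure Ω) (m1 m2 : MeasurableSpace Ω) (Z : Ω → F) (v : ℝ) : Prop where
  meas : Measurable[m2] Z
  memLp : MemLp Z 2 μ
  orth : ∀ M : Ω → F, Measurable[m1] M → MemLp M 2 μ → ∫ ω, inner ℝ (Z ω) (M ω) ∂μ = 0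
  sq_le : ∫ ω, ‖Z ω‖ ^ 2 ∂μ ≤ v

variable {Z Z' : Ω → F} {v v' : ℝ}

theorem CenteredNoise.mono (h : CenteredNoise μ m2 m3 Z v) {m m' : MeasurableSpace Ω} (hm : m ≤ m2)
    (hm' : m3 ≤ m') (hv : v ≤ v') : CenteredNoise μ m m' Z v' where
  meas := h.meas.mono hm' le_rfl
  memLp := h.memLp
  orth M hM hM' := h.orth M (hM.mono hm le_rfl) hM'
  sq_le := h.sq_le.trans hv

/-- The first summand belongs to the past of the second, so the cross term vanishes and second
moments add. Iteration gives variance linear in the number of steps. -/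
theorem CenteredNoise.add (h : CenteredNoise μ m1 m2 Z v) (h' : CenteredNoise μ m2 m3 Z' v')
    (h12 : m1 ≤ m2) (h23 : m2 ≤ m3) :
    CenteredNoise μ m1 m3 (fun ω => Z ω + Z' ω) (v + v') where
  meas := (h.meas.mono h23 le_rfl).add h'.meas
  memLp := h.memLp.add h'.memLp
  orth M hM hM' := by
    simp only [inner_add_left]
    rw [integral_add (integrable_inner_of_memLp h.memLp hM')
      (integrable_inner_of_memLp h'.memLp hM'), h.orth M hM hM',
      h'.orth M (hM.mono h12 le_rfl) hM', add_zero]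
  sq_le := by
    have h1 : ∀ ω, ‖Z ω + Z' ω‖ ^ 2 = ‖Z ω‖ ^ 2 + 2 * inner ℝ (Z' ω) (Z ω) + ‖Z' ω‖ ^ 2 :=
      fun ω => by rw [norm_add_sq_real, real_inner_comm]
    simp only [h1]
    have i1 := integrable_norm_sq h.memLp
    have i2 := integrable_norm_sq h'.memLp
    have i3 := (integrable_inner_of_memLp h'.memLp h.memLp).const_mul 2
    rw [integral_add (show Integrable (fun ω => ‖Z ω‖ ^ 2 + 2 * inner ℝ (Z' ω) (Z ω)) μ from i1.add i3)
      i2, integral_add i1 i3, integral_const_mul,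
      h'.orth Z h.meas h.memLp]
    linarith [h.sq_le, h'.sq_le]

theorem CenteredNoise.const_smul (h : CenteredNoise μ m1 m2 Z v) (a : ℝ) :
    CenteredNoise μ m1 m2 (fun ω => a • Z ω) (a ^ 2 * v) where
  meas := h.meas.const_smul a
  memLp := h.memLp.const_smul a
  orth M hM hM' := by
    simp only [inner_smul_left, conj_trivial]
    rw [integral_const_mul, h.orth M hM hM', mul_zero]
  sq_le := by
    simp only [norm_smul, mul_pow, Real.norm_eq_abs, sq_abs]
    rw [integral_const_mul]
    exact mul_le_mul_of_nonneg_left h.sq_le (sq_nonneg a)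

theorem CenteredNoise.sum {m : ℕ → MeasurableSpace Ω} (hm : Monotone m) {Z : ℕ → Ω → F}
    {v : ℕ → ℝ} (K : ℕ) (h : ∀ k < K, CenteredNoise μ (m k) (m (k + 1)) (Z k) (v k)) :
    CenteredNoise μ (m 0) (m K) (fun ω => ∑ k ∈ Finset.range K, Z k ω)
      (∑ k ∈ Finset.range K, v k) := by
  induction K with
  | zero =>
    simp only [Finset.range_zero, Finset.sum_empty]
    exact ⟨measurable_const, MemLp.zero, by simp, by simp⟩
  | succ K ih =>
    simp only [Finset.sum_range_succ]
    exact (ih fun k hk => h k (by omega)).add (h K (by omega)) (hm (Nat.zero_le K))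
      (hm (Nat.le_succ K))

/-- A past factor can be moved into the test vector. Its boundedness keeps that vector
square-integrable, and it is available because the sets Y i have finite diameter. -/
theorem CenteredNoise.inner_bounded (h : CenteredNoise μ m1 m2 Z v) (h12 : m1 ≤ m2) (h2 : m2 ≤ mΩ)
    {B : Ω → F} (hB : Measurable[m1] B) {d : ℝ} (hd : ∀ ω, ‖B ω‖ ≤ d) :
    CenteredNoise μ m1 m2 (fun ω => inner ℝ (Z ω) (B ω)) (d ^ 2 * v) := by
  have hmeas : Measurable[m2] (fun ω => inner ℝ (Z ω) (B ω)) :=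
    h.meas.inner (hB.mono h12 le_rfl)
  have hle : ∀ ω, ‖inner ℝ (Z ω) (B ω)‖ ^ 2 ≤ d ^ 2 * ‖Z ω‖ ^ 2 := fun ω => by
    rw [← mul_pow]
    refine pow_le_pow_left₀ (norm_nonneg _) ?_ 2
    rw [Real.norm_eq_abs, mul_comm]
    exact (abs_real_inner_le_norm _ _).trans
      (mul_le_mul_of_nonneg_left (hd ω) (norm_nonneg _))
  have hlp : MemLp (fun ω => inner ℝ (Z ω) (B ω)) 2 μ := by
    have hm := (hmeas.mono h2 le_rfl).aestronglyMeasurable (μ := μ)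
    rw [memLp_two_iff_integrable_sq_norm hm]
    refine ((integrable_norm_sq h.memLp).const_mul (d ^ 2)).mono' (hm.norm.pow 2)
      (Filter.Eventually.of_forall fun ω => ?_)
    rw [Real.norm_of_nonneg (by positivity)]
    exact hle ω
  refine ⟨hmeas, hlp, fun M hM hM' => ?_, ?_⟩
  · have e : ∀ ω, inner ℝ (inner ℝ (Z ω) (B ω)) (M ω) = inner ℝ (Z ω) (M ω • B ω) := fun ω => by
      simp [inner_smul_right]
    simp only [e]
    refine h.orth _ (hM.smul hB) ?_
    have hm : AEStronglyMeasurable (fun ω => M ω • B ω) μ :=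
      (Measurable.mono (hM.smul hB : Measurable[m1] fun ω => M ω • B ω) (h12.trans h2)
        le_rfl).aestronglyMeasurable
    rw [memLp_two_iff_integrable_sq_norm hm]
    refine ((integrable_norm_sq hM').const_mul (d ^ 2)).mono' (hm.norm.pow 2)
      (Filter.Eventually.of_forall fun ω => ?_)
    rw [Real.norm_of_nonneg (by positivity), norm_smul, mul_pow, mul_comm]
    exact mul_le_mul_of_nonneg_right (pow_le_pow_left₀ (norm_nonneg _) (hd ω) 2) (by positivity)
  · refine (integral_mono (integrable_norm_sq hlp)
      ((integrable_norm_sq h.memLp).const_mul (d ^ 2)) hle).trans ?_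
    rw [integral_const_mul]
    exact mul_le_mul_of_nonneg_left h.sq_le (sq_nonneg d)

theorem memLp_vec {n : ℕ} {Z : Ω → Vec n} (h : ∀ i, MemLp (fun ω => Z ω i) 2 μ) :
    MemLp Z 2 μ := by
  have hm : AEStronglyMeasurable Z μ := by
    have h1 : AEMeasurable (fun ω => WithLp.ofLp (Z ω)) μ :=
      aemeasurable_pi_iff.2 fun i => (h i).1.aemeasurable
    exact ((WithLp.measurable_toLp 2 (Fin n → ℝ)).comp_aemeasurable h1).aestronglyMeasurable
  rw [memLp_two_iff_integrable_sq_norm hm]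
  simp only [EuclideanSpace.real_norm_sq_eq]
  exact integrable_finsetSum _ fun i _ => (h i).integrable_sq

theorem measurable_vec {m : MeasurableSpace Ω} {n : ℕ} {Z : Ω → Vec n}
    (h : ∀ i, Measurable fun ω => Z ω i) : Measurable Z :=
  (WithLp.measurable_toLp 2 (Fin n → ℝ)).comp (measurable_pi_iff.2 h)

theorem measurable_coord {m : MeasurableSpace Ω} {n : ℕ} {Z : Ω → Vec n} (h : Measurable Z)
    (i : Fin n) : Measurable fun ω => Z ω i :=
  (measurable_pi_apply i).comp ((WithLp.measurable_ofLp 2 (Fin n → ℝ)).comp h)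

theorem memLp_coord {n : ℕ} {Z : Ω → Vec n} (h : MemLp Z 2 μ) (i : Fin n) :
    MemLp (fun ω => Z ω i) 2 μ :=
  h.mono ((by fun_prop : Continuous fun v : Vec n => v i).comp_aestronglyMeasurable h.1)
    (Filter.Eventually.of_forall fun ω => PiLp.norm_apply_le (Z ω) i)

/-- Orthogonality is checked coordinate by coordinate, so nothing is asked about the dependence
between coordinates. -/
theorem CenteredNoise.vec {n : ℕ} {Z : Ω → Vec n} {v : Fin n → ℝ}
    (h : ∀ i, CenteredNoise μ m1 m2 (fun ω => Z ω i) (v i)) :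
    CenteredNoise μ m1 m2 Z (∑ i, v i) where
  meas := measurable_vec fun i => (h i).meas
  memLp := memLp_vec fun i => (h i).memLp
  orth M hM hM' := by
    have h1 : ∀ ω, inner ℝ (Z ω) (M ω) = ∑ i, inner ℝ (Z ω i) (M ω i) := fun ω => by
      rw [PiLp.inner_apply]
    simp only [h1]
    have hMi := fun i => memLp_coord hM' i
    rw [integral_finsetSum _ fun i _ => integrable_inner_of_memLp (h i).memLp (hMi i)]
    exact Finset.sum_eq_zero fun i _ => (h i).orth _ (measurable_coord hM i) (hMi i)
  sq_le := by
    simp only [EuclideanSpace.real_norm_sq_eq]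
    rw [integral_finsetSum _ fun i _ => (h i).memLp.integrable_sq]
    refine Finset.sum_le_sum fun i _ => ?_
    simpa using (h i).sq_le

variable [CompleteSpace F]

/-- Sampling an unbiased estimator with fresh randomness produces centered noise. -/
theorem CenteredNoise.of_indep {Ξ : Type*} {mΞ : MeasurableSpace Ξ} [IsProbabilityMeasure μ]
    {ν : Measure Ξ} {ζ : Ω → Ξ} (h1 : m1 ≤ mΩ) (hζ : Measurable ζ) (hlaw : μ.map ζ = ν)
    (hind : Indep m1 (mΞ.comap ζ) μ) (h12 : m1 ≤ m2) (hζ2 : Measurable[m2] ζ)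
    {N : Ω → Ξ → F} (hN : Measurable[m1.prod mΞ] (fun z : Ω × Ξ => N z.1 z.2)) {V : Ω → ℝ}
    (hV : Integrable V μ) (hNi : ∀ ω, Integrable (N ω) ν) (hN0 : ∀ ω, ∫ e, N ω e ∂ν = 0)
    (hNs : ∀ ω, Integrable (fun e => ‖N ω e‖ ^ 2) ν) (hNV : ∀ ω, ∫ e, ‖N ω e‖ ^ 2 ∂ν ≤ V ω) :
    CenteredNoise μ m1 m2 (fun ω => N ω (ζ ω)) (∫ ω, V ω ∂μ) := by
  have hid : @Measurable Ω Ω mΩ m1 id := fun s hs => h1 s hs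
  -- The frozen variable is the identity, viewed as a map into Ω with the smaller sigma-algebra m1;
  -- everything known at that time is then frozen at once.
  have hind' : @IndepFun Ω Ω Ξ mΩ m1 mΞ id ζ μ :=
    (IndepFun_iff_Indep (mβ := m1) id ζ μ).2 (by rw [MeasurableSpace.comap_id]; exact hind)
  have hmeas : Measurable[m2] (fun ω => N ω (ζ ω)) := by
    have hp : @Measurable Ω (Ω × Ξ) m2 (m1.prod mΞ) (fun ω => (ω, ζ ω)) :=
      Measurable.prodMk (fun s hs => h12 s hs) hζ2
    exact hN.comp hp
  have hmeas' : Measurable (fun ω => N ω (ζ ω)) := by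
    have hp : @Measurable Ω (Ω × Ξ) mΩ (m1.prod mΞ) (fun ω => (ω, ζ ω)) :=
      Measurable.prodMk hid hζ
    exact hN.comp hp
  have hV0 : ∀ ω, 0 ≤ V ω := fun ω =>
    (integral_nonneg fun e => by positivity).trans (hNV ω)
  have hsqm : Measurable[m1.prod mΞ] (fun z : Ω × Ξ => ‖N z.1 z.2‖ ^ 2) :=
    (measurable_norm.comp hN).pow_const 2
  have hfr := lintegral_freeze (mE := m1) hid hζ hind' hlaw hsqm.ennreal_ofReal
  simp only [id] at hfr
  -- The bound is first shown for the lower integral, where finiteness is not presupposed; square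
  -- integrability follows from it.
  have hle : ∫⁻ ω, ENNReal.ofReal (‖N ω (ζ ω)‖ ^ 2) ∂μ ≤ ENNReal.ofReal (∫ ω, V ω ∂μ) := by
    rw [hfr, ofReal_integral_eq_lintegral_ofReal hV (Filter.Eventually.of_forall hV0)]
    refine lintegral_mono fun ω => ?_
    rw [← ofReal_integral_eq_lintegral_ofReal (hNs ω)
      (Filter.Eventually.of_forall fun e => by positivity)]
    exact ENNReal.ofReal_le_ofReal (hNV ω)
  have hint : Integrable (fun ω => ‖N ω (ζ ω)‖ ^ 2) μ := by
    refine ⟨(hmeas'.norm.pow_const 2).aestronglyMeasurable, ?_⟩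
    rw [hasFiniteIntegral_iff_ofReal (Filter.Eventually.of_forall fun ω => by positivity)]
    exact hle.trans_lt ENNReal.ofReal_lt_top
  have hlp : MemLp (fun ω => N ω (ζ ω)) 2 μ :=
    (memLp_two_iff_integrable_sq_norm hmeas'.aestronglyMeasurable).2 hint
  refine ⟨hmeas, hlp, fun M hM hM' => ?_, ?_⟩
  · have hΨ : Measurable[m1.prod mΞ] (fun z : Ω × Ξ => inner ℝ (N z.1 z.2) (M z.1)) := by
      have hf : @Measurable (Ω × Ξ) Ω (m1.prod mΞ) m1 Prod.fst := measurable_fst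
      exact hN.inner (hM.comp hf)
    have h3 := integral_freeze (mE := m1) hid hζ hind' hlaw hΨ
      (integrable_inner_of_memLp hlp hM')
    simp only [id] at h3
    rw [h3]
    refine integral_eq_zero_of_ae (Filter.Eventually.of_forall fun ω => ?_)
    have h4 : ∀ e, inner ℝ (N ω e) (M ω) = inner ℝ (M ω) (N ω e) := fun e => real_inner_comm _ _
    simp only [h4, Pi.zero_apply]
    rw [integral_inner (hNi ω), hN0 ω, inner_zero_right]
  · rw [← ENNReal.ofReal_le_ofReal_iff (integral_nonneg hV0),
      ofReal_integral_eq_lintegral_ofReal hint (Filter.Eventually.of_forall fun ω => by positivity)]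
    exact hle

end Noise

/-! ### The filtration of the samples and fresh oracle calls -/

section History

variable {Ω Ξ : Type*} {m1 m2 : MeasurableSpace Ω} [mΩ : MeasurableSpace Ω] [mΞ : MeasurableSpace Ξ] {ξ : ℕ → Fin 6 → Ω → Ξ}
  {ν : Measure Ξ} {μ : Measure Ω}

/-- The information contained in the first `n` samples, in the order `ξ 0 0, …, ξ 0 5, ξ 1 0, …`. -/
@[reducible] def hist (ξ : ℕ → Fin 6 → Ω → Ξ) (n : ℕ) : MeasurableSpace Ω :=
  ⨆ a ∈ {a : ℕ × Fin 6 | 6 * a.1 + a.2 < n}, mΞ.comap (ξ a.1 a.2)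

theorem hist_mono : Monotone (hist ξ) := fun _ _ hn =>
  biSup_mono fun _ ha => lt_of_lt_of_le ha hn

theorem hist_le (hξ : IsIIDSample ξ ν μ) (n : ℕ) : hist ξ n ≤ mΩ :=
  iSup₂_le fun a _ => (hξ.measurable a.1 a.2).comap_le

theorem measurable_hist (k : ℕ) (j : Fin 6) {n : ℕ} (hn : 6 * k + j < n) :
    Measurable[hist ξ n] (ξ k j) := by
  rw [measurable_iff_comap_le]
  exact le_iSup₂_of_le (k, j) hn le_rfl

theorem indep_hist (hξ : IsIIDSample ξ ν μ) (k : ℕ) (j : Fin 6) {n : ℕ} (hn : n ≤ 6 * k + j) :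
    Indep (hist ξ n) (mΞ.comap (ξ k j)) μ := by
  have hi : iIndep (fun a : ℕ × Fin 6 => mΞ.comap (ξ a.1 a.2)) μ :=
    (iIndepFun_iff_iIndep _ _ _).1 hξ.indep
  have h := indep_iSup_of_disjoint (fun a => (hξ.measurable a.1 a.2).comap_le) hi
    (S := {a : ℕ × Fin 6 | 6 * a.1 + a.2 < n}) (T := {(k, j)})
    (Set.disjoint_singleton_right.2 fun h => by simp only [Set.mem_ofPred_eq] at h; omega)
  simpa [hist] using h

/-- The sample `ζ` with law `ν` is independent of `m1` and known to `m2`. -/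
structure FreshSample (μ : Measure Ω) (ν : Measure Ξ) (m1 m2 : MeasurableSpace Ω) (ζ : Ω → Ξ) :
    Prop where
  le_base : m1 ≤ mΩ
  measurable : Measurable[mΩ] ζ
  law : @Measure.map Ω Ξ mΩ mΞ ζ μ = ν
  indep : Indep m1 (mΞ.comap ζ) μ
  le : m1 ≤ m2
  adapted : Measurable[m2] ζ

theorem IsIIDSample.fresh (hξ : IsIIDSample ξ ν μ) (k : ℕ) (j : Fin 6) :
    FreshSample μ ν (hist ξ (6 * k + j)) (hist ξ (6 * k + j + 1)) (ξ k j) where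
  le_base := hist_le hξ _
  measurable := hξ.measurable k j
  law := hξ.law k j
  indep := indep_hist hξ k j le_rfl
  le := hist_mono (Nat.le_succ _)
  adapted := measurable_hist k j (Nat.lt_succ_self _)

/-- The chosen subgradients are not assumed measurable in the iterate. Measurability of the mean z
comes from its being the integral of a jointly measurable oracle. -/
theorem CenteredNoise.of_unbiased {F : Type*} [NormedAddCommGroup F] [InnerProductSpace ℝ F]
    [MeasurableSpace F] [BorelSpace F] [SecondCountableTopology F] [CompleteSpace F]
    [IsProbabilityMeasure μ] [IsProbabilityMeasure ν] {ζ : Ω → Ξ}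
    (hf : FreshSample μ ν m1 m2 ζ) {Z : Ω → Ξ → F} {z : Ω → F} {V : Ω → ℝ}
    (hZ : Measurable[m1.prod mΞ] (fun w : Ω × Ξ => Z w.1 w.2)) (hZi : ∀ ω, Integrable (Z ω) ν)
    (hz : ∀ ω, ∫ e, Z ω e ∂ν = z ω) (hZs : ∀ ω, Integrable (fun e => ‖Z ω e - z ω‖ ^ 2) ν)
    (hZV : ∀ ω, ∫ e, ‖Z ω e - z ω‖ ^ 2 ∂ν ≤ V ω) (hV : Integrable V μ) :
    CenteredNoise μ m1 m2 (fun ω => Z ω (ζ ω) - z ω) (∫ ω, V ω ∂μ) := by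
  have hzm : Measurable[m1] z := by
    have h1 : StronglyMeasurable[m1.prod mΞ] (fun w : Ω × Ξ => Z w.1 w.2) :=
      hZ.stronglyMeasurable
    have h2 := (@StronglyMeasurable.integral_prod_right' Ω Ξ F m1 mΞ ν _ _ _ _ h1).measurable
    have h3 : z = fun ω => ∫ e, Z ω e ∂ν := funext fun ω => (hz ω).symm
    rw [h3]; exact h2
  have hfst : @Measurable (Ω × Ξ) Ω (m1.prod mΞ) m1 Prod.fst := measurable_fst
  refine CenteredNoise.of_indep hf.le_base hf.measurable hf.law hf.indep hf.le hf.adapted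
    (N := fun ω e => Z ω e - z ω) (hZ.sub (hzm.comp hfst)) hV
    (fun ω => (hZi ω).sub (integrable_const _)) (fun ω => ?_) hZs hZV
  rw [integral_sub (hZi ω) (integrable_const _), hz ω]; simp

theorem UnbiasedWithVariance.smul {F : Type*} [NormedAddCommGroup F] [NormedSpace ℝ F]
    {Z : Ξ → F} {z : F} {r : ℝ} (h : UnbiasedWithVariance ν Z z r) (a : ℝ) :
    UnbiasedWithVariance ν (fun e => a • Z e) (a • z) (a * r) where
  integrable := h.integrable.smul a
  mean := by rw [integral_smul, h.mean]
  integrable_sq := by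
    simp only [← smul_sub, norm_smul, mul_pow]
    exact h.integrable_sq.const_mul _
  variance := by
    simp only [← smul_sub, norm_smul, mul_pow, Real.norm_eq_abs, sq_abs]
    rw [integral_const_mul]
    exact mul_le_mul_of_nonneg_left h.variance (sq_nonneg a)

/-- Value and gradient come from the same sample and may be correlated, so the variance is bounded
through (a + b)² ≤ 2a² + 2b². -/
theorem UnbiasedWithVariance.add_inner {F : Type*} [NormedAddCommGroup F] [InnerProductSpace ℝ F]
    [CompleteSpace F] [IsProbabilityMeasure ν]
    {Z : Ξ → ℝ} {z : ℝ} {r : ℝ} (h : UnbiasedWithVariance ν Z z r)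
    {Z' : Ξ → F} {z' : F} {r' : ℝ} (h' : UnbiasedWithVariance ν Z' z' r') (v : F) :
    UnbiasedWithVariance ν (fun e => Z e + inner ℝ (Z' e) v) (z + inner ℝ z' v)
      √(2 * r ^ 2 + 2 * r' ^ 2 * ‖v‖ ^ 2) := by
  have hsq : ∀ e, ‖Z e + inner ℝ (Z' e) v - (z + inner ℝ z' v)‖ ^ 2
      ≤ 2 * ‖Z e - z‖ ^ 2 + 2 * ‖v‖ ^ 2 * ‖Z' e - z'‖ ^ 2 := fun e => by
    have h1 : Z e + inner ℝ (Z' e) v - (z + inner ℝ z' v)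
        = (Z e - z) + inner ℝ (Z' e - z') v := by rw [inner_sub_left]; ring
    have h2 : (inner ℝ (Z' e - z') v) ^ 2 ≤ ‖v‖ ^ 2 * ‖Z' e - z'‖ ^ 2 := by
      rw [← sq_abs, ← mul_pow, mul_comm]
      exact pow_le_pow_left₀ (abs_nonneg _) (abs_real_inner_le_norm _ _) 2
    rw [h1, Real.norm_eq_abs, Real.norm_eq_abs, sq_abs, sq_abs]
    nlinarith [sq_nonneg ((Z e - z) - inner ℝ (Z' e - z') v)]
  have hdom := (h.integrable_sq.const_mul 2).add (h'.integrable_sq.const_mul (2 * ‖v‖ ^ 2))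
  have hin : Integrable (fun e => inner ℝ (Z' e) v) ν := h'.integrable.inner_const v
  have hint : Integrable (fun e => Z e + inner ℝ (Z' e) v) ν := h.integrable.add hin
  have hsqi : Integrable (fun e => ‖Z e + inner ℝ (Z' e) v - (z + inner ℝ z' v)‖ ^ 2) ν := by
    refine hdom.mono' ((hint.1.sub aestronglyMeasurable_const).norm.pow 2)
      (Filter.Eventually.of_forall fun e => ?_)
    rw [Real.norm_of_nonneg (by positivity)]
    exact hsq e
  refine ⟨hint, ?_, hsqi, ?_⟩
  · rw [integral_add h.integrable hin, h.mean]
    congr 1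
    have h4 : ∀ e, inner ℝ (Z' e) v = inner ℝ v (Z' e) := fun e => real_inner_comm _ _
    simp only [h4]
    rw [integral_inner h'.integrable, h'.mean, real_inner_comm]
  · rw [Real.sq_sqrt (by positivity)]
    refine (integral_mono hsqi hdom hsq).trans ?_
    simp only [Pi.add_apply]
    rw [integral_add (h.integrable_sq.const_mul 2) (h'.integrable_sq.const_mul (2 * ‖v‖ ^ 2)),
      integral_const_mul, integral_const_mul]
    nlinarith [h.variance, h'.variance, mul_le_mul_of_nonneg_left h'.variance (sq_nonneg ‖v‖)]

end History

/-! ### The noise terms, and a run as a perturbed exact path -/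

section Run

variable {p q m : ℕ} {Ω Ξ : Type*} [MeasurableSpace Ω] [mΞ : MeasurableSpace Ξ]

/-- A run of the method with constant step sizes in `x` and `y` under the standing assumptions. -/
structure SampledRun (μ : Measure Ω) (ν : Measure Ξ) (P : Problem p q m) (D : Gradients p q m)
    (O : Oracle p q m Ξ) (c : Consts) (t s : ℝ) (γ : ℕ → ℝ) (K : ℕ) (x0 : Vec p)
    (y0 : Fin m → Vec q) (ξ : ℕ → Fin 6 → Ω → Ξ) (x : ℕ → Ω → Vec p) (y : ℕ → Ω → Fin m → Vec q)
    (lam : ℕ → Ω → Vec m) : Prop where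
  nonneg : c.Nonneg
  conv : P.ConvexCompact c.Dy
  grad : D.IsSubgradient P
  smooth : SmoothLipschitz P D c
  oracle : O.IsStochasticOracle ν P D c
  iid : IsIIDSample ξ ν μ
  run : IsRun P O (fun _ => 1) (fun _ => t) (fun _ => s) γ K x0 y0 0 ξ x y lam
  x0_mem : x0 ∈ P.X
  y0_mem : ∀ i, y0 i ∈ P.Y i
  t_ge : 4 * (c.Lf + 1) ≤ t
  s_pos : 0 < s
  γ_pos : ∀ k < K, 0 < γ k

/-- The error of the oracle of `f` in step `k`. -/
noncomputable def noiseF (D : Gradients p q m) (O : Oracle p q m Ξ) (ξ : ℕ → Fin 6 → Ω → Ξ)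
    (x : ℕ → Ω → Vec p) (k : ℕ) (ω : Ω) : Vec p :=
  O.gradF (x k ω) (ξ k 5 ω) - D.gradf (x k ω)

/-- The error of the oracle of `g i` in the `x`-step `k`, weighted by the multiplier. -/
noncomputable def noiseZ (D : Gradients p q m) (O : Oracle p q m Ξ) (ξ : ℕ → Fin 6 → Ω → Ξ)
    (x : ℕ → Ω → Vec p) (y : ℕ → Ω → Fin m → Vec q) (lam : ℕ → Ω → Vec m) (i : Fin m) (k : ℕ)
    (ω : Ω) : Vec p :=
  lam (k + 1) ω i • O.gradxG i (x k ω) (y (k + 1) ω i) (ξ k 5 ω)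
    - lam (k + 1) ω i • D.gradxg i (x k ω) (y (k + 1) ω i)

/-- The error of the stochastic linearization of `g i`. -/
noncomputable def linNoise (P : Problem p q m) (D : Gradients p q m) (O : Oracle p q m Ξ)
    (i : Fin m) (x x' : Vec p) (y : Vec q) (e : Ξ) : ℝ :=
  O.lin i x e x' y - P.lin D i x x' y

/-- The error of the extrapolated values in the `λ`-step `k`. -/
noncomputable def noiseL (P : Problem p q m) (D : Gradients p q m) (O : Oracle p q m Ξ)
    (ξ : ℕ → Fin 6 → Ω → Ξ) (x : ℕ → Ω → Vec p) (y : ℕ → Ω → Fin m → Vec q) (k : ℕ)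
    (ω : Ω) : Vec m :=
  WithLp.toLp 2 fun i =>
    linNoise P D O i (x k ω) (x (k - 1) ω) (y (k + 1) ω i) (ξ k 2 ω)
      + linNoise P D O i (x k ω) (x (k - 1) ω) (y k ω i) (ξ k 3 ω)
      + (-1 : ℝ) • linNoise P D O i (x (k - 1) ω) (x (k - 2) ω) (y k ω i) (ξ k 4 ω)

/-- The error of the extrapolated gradient in the `y`-step `k`. -/
noncomputable def noiseY (D : Gradients p q m) (O : Oracle p q m Ξ) (ξ : ℕ → Fin 6 → Ω → Ξ)
    (x : ℕ → Ω → Vec p) (y : ℕ → Ω → Fin m → Vec q) (i : Fin m) (k : ℕ) (ω : Ω) : Vec q :=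
  (2 : ℝ) • (O.gradyG i (x k ω) (y k ω i) (ξ k 0 ω) - D.gradyg i (x k ω) (y k ω i))
    + (-1 : ℝ) • (O.gradyG i (x (k - 1) ω) (y (k - 1) ω i) (ξ k 1 ω)
      - D.gradyg i (x (k - 1) ω) (y (k - 1) ω i))

variable {μ : Measure Ω} {ν : Measure Ξ} {P : Problem p q m} {D : Gradients p q m}
  {O : Oracle p q m Ξ} {c : Consts} {t s : ℝ} {γ : ℕ → ℝ} {K : ℕ} {x0 : Vec p}
  {y0 : Fin m → Vec q} {ξ : ℕ → Fin 6 → Ω → Ξ} {x : ℕ → Ω → Vec p} {y : ℕ → Ω → Fin m → Vec q}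
  {lam : ℕ → Ω → Vec m}

theorem SampledRun.x_mem (h : SampledRun μ ν P D O c t s γ K x0 y0 ξ x y lam) {k : ℕ}
    (hk : k ≤ K) (ω : Ω) : x k ω ∈ P.X := by
  cases k with
  | zero => rw [h.run.x_zero]; exact h.x0_mem
  | succ k => exact h.run.x_mem k hk ω

theorem SampledRun.y_mem (h : SampledRun μ ν P D O c t s γ K x0 y0 ξ x y lam) {k : ℕ}
    (hk : k ≤ K) (ω : Ω) (i : Fin m) : y k ω i ∈ P.Y i := by
  cases k with
  | zero => rw [h.run.y_zero]; exact h.y0_mem i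
  | succ k => exact h.run.y_mem k hk ω i

theorem convex_nonneg : Convex ℝ {l : Vec m | ∀ i, 0 ≤ l i} := by
  intro a ha b hb u v hu hv _ i
  have := ha i
  have := hb i
  simp only [PiLp.add_apply, PiLp.smul_apply, smul_eq_mul]
  positivity

theorem isClosed_nonneg : IsClosed {l : Vec m | ∀ i, 0 ≤ l i} := by
  have : {l : Vec m | ∀ i, 0 ≤ l i} = ⋂ i, {l : Vec m | 0 ≤ l i} := by ext; simp
  rw [this]
  exact isClosed_iInter fun i => isClosed_le continuous_const (by fun_prop)

theorem neg_sum_eq_inner (v : Fin m → ℝ) (l : Vec m) :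
    - ∑ i, v i * l i = inner ℝ (-(WithLp.toLp 2 v)) l := by
  rw [inner_neg_left, inner_vec]

/-- Separates optimisation from probability: each oracle answer is the exact quantity plus noise,
and the three-point inequality of each step holds for every ω. -/
theorem SampledRun.path (h : SampledRun μ ν P D O c t s γ K x0 y0 ξ x y lam) (ω : Ω) :
    NoisyPath P D t s γ K (fun k => x k ω) (fun k => y k ω) (fun k => lam k ω)
      (fun k => noiseF D O ξ x k ω) (fun k => ∑ i, noiseZ D O ξ x y lam i k ω)
      (fun k => noiseL P D O ξ x y k ω) (fun k i => noiseY D O ξ x y i k ω) where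
  x_mem k hk := h.x_mem hk ω
  y_mem k hk := h.y_mem hk ω
  lam_zero := h.run.lam_zero ω
  lam_nonneg k hk i := by
    cases k with
    | zero => simp [h.run.lam_zero ω]
    | succ k => exact h.run.lam_mem k hk ω i
  y_step k hk i d hd := by
    have h1 := h.run.y_step k hk ω i
    simp only [← inner_neg_left] at h1
    have h2 := prox_three_point (h.conv.convex_Y i) (h.run.y_mem k hk ω i) h1 hd
    rw [inner_neg_left, ← inner_neg_right, neg_sub] at h2
    convert h2 using 2
    simp only [noiseY]
    module
  lam_step k hk l hl := by
    have h1 := h.run.lam_step k hk ω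
    simp only [neg_sum_eq_inner] at h1
    have h2 := prox_three_point convex_nonneg (h.run.lam_mem k hk ω) h1 hl
    rw [inner_neg_left, ← inner_neg_right, neg_sub] at h2
    convert h2 using 2
    ext i
    simp only [noiseL, linNoise, PiLp.add_apply, smul_eq_mul]
    ring
  x_step k hk d hd := by
    have h2 := prox_three_point h.conv.convex_X (h.run.x_mem k hk ω) (h.run.x_step k hk ω) hd
    convert h2 using 2
    simp only [noiseF, noiseZ, Finset.sum_sub_distrib]
    abel

end Run

/-! ### Centred noise from the individual oracles -/

section OracleNoise

variable {p q m : ℕ} {Ω Ξ : Type*} {m1 m2 : MeasurableSpace Ω} [mΩ : MeasurableSpace Ω]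
  [mΞ : MeasurableSpace Ξ] {μ : Measure Ω} {ν : Measure Ξ} [IsProbabilityMeasure μ]
  [IsProbabilityMeasure ν] {P : Problem p q m} {D : Gradients p q m} {O : Oracle p q m Ξ}
  {c : Consts} {ζ : Ω → Ξ} {u w : Ω → Vec p} {z : Ω → Vec q}

theorem measurable_frozen_fst (hw : Measurable[m1] w) :
    Measurable[m1.prod mΞ] (fun a : Ω × Ξ => w a.1) :=
  hw.comp (measurable_fst : @Measurable (Ω × Ξ) Ω (m1.prod mΞ) m1 Prod.fst)

theorem measurable_frozen_pair (hw : Measurable[m1] w) :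
    Measurable[m1.prod mΞ] (fun a : Ω × Ξ => (w a.1, a.2)) :=
  (measurable_frozen_fst hw).prodMk
    (measurable_snd : @Measurable (Ω × Ξ) Ξ (m1.prod mΞ) mΞ Prod.snd)

theorem measurable_frozen_triple (hw : Measurable[m1] w) (hz : Measurable[m1] z) :
    Measurable[m1.prod mΞ] (fun a : Ω × Ξ => (w a.1, z a.1, a.2)) :=
  (measurable_frozen_fst hw).prodMk (measurable_frozen_pair hz)

theorem CenteredNoise.gradF (hf : FreshSample μ ν m1 m2 ζ) (hO : O.IsStochasticOracle ν P D c)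
    (hw : Measurable[m1] w) (hwX : ∀ ω, w ω ∈ P.X) :
    CenteredNoise μ m1 m2 (fun ω => O.gradF (w ω) (ζ ω) - D.gradf (w ω)) (c.sigF ^ 2) := by
  have h := CenteredNoise.of_unbiased hf (Z := fun ω => O.gradF (w ω)) (z := fun ω => D.gradf (w ω))
    (V := fun _ => c.sigF ^ 2) (hO.measurable_gradF.comp (measurable_frozen_pair hw))
    (fun ω => (hO.gradF _ (hwX ω)).integrable) (fun ω => (hO.gradF _ (hwX ω)).mean)
    (fun ω => (hO.gradF _ (hwX ω)).integrable_sq) (fun ω => (hO.gradF _ (hwX ω)).variance)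
    (integrable_const _)
  simpa using h

theorem CenteredNoise.gradyG (hf : FreshSample μ ν m1 m2 ζ) (hO : O.IsStochasticOracle ν P D c)
    {i : Fin m} (hw : Measurable[m1] w) (hz : Measurable[m1] z) (hwX : ∀ ω, w ω ∈ P.X)
    (hzY : ∀ ω, z ω ∈ P.Y i) :
    CenteredNoise μ m1 m2 (fun ω => O.gradyG i (w ω) (z ω) (ζ ω) - D.gradyg i (w ω) (z ω))
      (c.sigDG ^ 2) := by
  have hu := fun ω => hO.gradyG i _ (hwX ω) _ (hzY ω)
  have h := CenteredNoise.of_unbiased hf (Z := fun ω => O.gradyG i (w ω) (z ω))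
    (z := fun ω => D.gradyg i (w ω) (z ω)) (V := fun _ => c.sigDG ^ 2)
    ((hO.measurable_gradyG i).comp (measurable_frozen_triple hw hz))
    (fun ω => (hu ω).integrable) (fun ω => (hu ω).mean) (fun ω => (hu ω).integrable_sq)
    (fun ω => (hu ω).variance) (integrable_const _)
  simpa using h

/-- The weight A stands for a multiplier that is fixed before the sample is drawn. It need not be
bounded, so its second moment appears in the variance. -/
theorem CenteredNoise.smul_gradxG (hf : FreshSample μ ν m1 m2 ζ)
    (hO : O.IsStochasticOracle ν P D c) {i : Fin m} (hw : Measurable[m1] w)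
    (hz : Measurable[m1] z) (hwX : ∀ ω, w ω ∈ P.X) (hzY : ∀ ω, z ω ∈ P.Y i) {A : Ω → ℝ}
    (hA : Measurable[m1] A) (hA2 : MemLp A 2 μ) :
    CenteredNoise μ m1 m2
      (fun ω => A ω • O.gradxG i (w ω) (z ω) (ζ ω) - A ω • D.gradxg i (w ω) (z ω))
      (c.sigDG ^ 2 * ∫ ω, A ω ^ 2 ∂μ) := by
  have hu := fun ω => (hO.gradxG i _ (hwX ω) _ (hzY ω)).smul (A ω)
  have hAm : Measurable[m1.prod mΞ] (fun a : Ω × Ξ => A a.1) :=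
    hA.comp (measurable_fst : @Measurable (Ω × Ξ) Ω (m1.prod mΞ) m1 Prod.fst)
  have h := CenteredNoise.of_unbiased hf (Z := fun ω e => A ω • O.gradxG i (w ω) (z ω) e)
    (z := fun ω => A ω • D.gradxg i (w ω) (z ω)) (V := fun ω => c.sigDG ^ 2 * A ω ^ 2)
    (hAm.smul ((hO.measurable_gradxG i).comp (measurable_frozen_triple hw hz)))
    (fun ω => (hu ω).integrable) (fun ω => (hu ω).mean) (fun ω => (hu ω).integrable_sq)
    (fun ω => (hu ω).variance.trans_eq (by ring)) (hA2.integrable_sq.const_mul _)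
  rwa [integral_const_mul] at h

theorem CenteredNoise.lin (hf : FreshSample μ ν m1 m2 ζ) (hO : O.IsStochasticOracle ν P D c)
    {i : Fin m} (hu : Measurable[m1] u) (hw : Measurable[m1] w) (hz : Measurable[m1] z)
    (hwX : ∀ ω, w ω ∈ P.X) (hzY : ∀ ω, z ω ∈ P.Y i) (hu2 : MemLp u 2 μ) (hw2 : MemLp w 2 μ) :
    CenteredNoise μ m1 m2 (fun ω => linNoise P D O i (u ω) (w ω) (z ω) (ζ ω))
      (2 * c.sigG ^ 2 + 2 * c.sigDG ^ 2 * ∫ ω, ‖u ω - w ω‖ ^ 2 ∂μ) := by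
  have hb := fun ω => (hO.G i _ (hwX ω) _ (hzY ω)).add_inner (hO.gradxG i _ (hwX ω) _ (hzY ω))
    (u ω - w ω)
  have hi : Integrable (fun ω => 2 * c.sigDG ^ 2 * ‖u ω - w ω‖ ^ 2) μ :=
    (integrable_norm_sq (hu2.sub hw2)).const_mul _
  have hm : Measurable[m1.prod mΞ] (fun a : Ω × Ξ => O.lin i (u a.1) a.2 (w a.1) (z a.1)) :=
    ((hO.measurable_G i).comp (measurable_frozen_triple hw hz)).add
      (((hO.measurable_gradxG i).comp (measurable_frozen_triple hw hz)).inner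
        ((measurable_frozen_fst hu).sub (measurable_frozen_fst hw)))
  have h := CenteredNoise.of_unbiased hf (Z := fun ω e => O.lin i (u ω) e (w ω) (z ω))
    (z := fun ω => P.lin D i (u ω) (w ω) (z ω))
    (V := fun ω => 2 * c.sigG ^ 2 + 2 * c.sigDG ^ 2 * ‖u ω - w ω‖ ^ 2)
    hm (fun ω => (hb ω).integrable) (fun ω => (hb ω).mean) (fun ω => (hb ω).integrable_sq)
    (fun ω => (hb ω).variance.trans_eq (Real.sq_sqrt (by positivity)))
    ((integrable_const _).add hi)
  rw [integral_add (integrable_const _) hi, integral_const, integral_const_mul] at h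
  simpa [linNoise] using h

end OracleNoise

/-! ### Adaptedness and square integrability of the iterates -/

theorem norm_prox_sub_le {E : Type*} [NormedAddCommGroup E] [InnerProductSpace ℝ E] {C : Set E}
    (hC : Convex ℝ C) {h a z : E} {s : ℝ} (hs : 0 < s) (hz : z ∈ C) (ha : a ∈ C)
    (hmin : IsMinOn (fun w => inner ℝ h w + s / 2 * ‖w - a‖ ^ 2) C z) :
    ‖z - a‖ ≤ s⁻¹ * ‖h‖ := by
  have h1 := prox_three_point hC hz hmin ha
  rw [sub_self, norm_zero, norm_sub_rev a z] at h1
  have h2 := neg_le_of_abs_le (abs_real_inner_le_norm h (z - a))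
  rw [inv_mul_eq_div, le_div_iff₀ hs]
  by_contra hlt
  push Not at hlt
  have hpos : 0 < ‖z - a‖ := by
    by_contra h0
    have : ‖z - a‖ = 0 := le_antisymm (not_lt.1 h0) (norm_nonneg _)
    rw [this] at hlt; linarith [norm_nonneg h]
  nlinarith

section State

variable {p q m : ℕ} {Ω Ξ : Type*} [mΩ : MeasurableSpace Ω] [mΞ : MeasurableSpace Ξ]

/-- The iterates of index `k` are known after `k` iterations and square-integrable. -/
structure RunState (μ : Measure Ω) (ξ : ℕ → Fin 6 → Ω → Ξ) (x : ℕ → Ω → Vec p)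
    (y : ℕ → Ω → Fin m → Vec q) (lam : ℕ → Ω → Vec m) (k : ℕ) : Prop where
  x_meas : Measurable[hist ξ (6 * k)] (x k)
  x_memLp : MemLp (x k) 2 μ
  lam_meas : Measurable[hist ξ (6 * k)] (lam k)
  lam_memLp : MemLp (lam k) 2 μ
  y_meas : ∀ i, Measurable[hist ξ (6 * k)] (fun ω => y k ω i)

variable {μ : Measure Ω} {ν : Measure Ξ} {P : Problem p q m} {D : Gradients p q m}
  {O : Oracle p q m Ξ} {c : Consts} {t s : ℝ} {γ : ℕ → ℝ} {K : ℕ} {x0 : Vec p}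
  {y0 : Fin m → Vec q} {ξ : ℕ → Fin 6 → Ω → Ξ} {x : ℕ → Ω → Vec p} {y : ℕ → Ω → Fin m → Vec q}
  {lam : ℕ → Ω → Vec m}

/-- Only samples 0 and 1 of iteration k enter, hence the index 6k + 2. The multipliers follow at 6k
+ 5 and the x-iterate at 6k + 6. -/
theorem SampledRun.measurable_y_succ (h : SampledRun μ ν P D O c t s γ K x0 y0 ξ x y lam) {k : ℕ}
    (hk : k < K) (hS : ∀ j ≤ k, RunState μ ξ x y lam j) (i : Fin m) :
    Measurable[hist ξ (6 * k + 2)] (fun ω => y (k + 1) ω i) := by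
  have mono : ∀ j ≤ k, hist ξ (6 * j) ≤ hist ξ (6 * k + 2) := fun j hj => hist_mono (by omega)
  have hx : ∀ j ≤ k, Measurable[hist ξ (6 * k + 2)] (x j) := fun j hj =>
    (hS j hj).x_meas.mono (mono j hj) le_rfl
  have hy : ∀ j ≤ k, Measurable[hist ξ (6 * k + 2)] (fun ω => y j ω i) := fun j hj =>
    ((hS j hj).y_meas i).mono (mono j hj) le_rfl
  have hG : ∀ j ≤ k, ∀ a : Fin 6, (a : ℕ) < 2 → Measurable[hist ξ (6 * k + 2)]
      (fun ω => O.gradyG i (x j ω) (y j ω i) (ξ k a ω)) := fun j hj a ha =>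
    (h.oracle.measurable_gradyG i).comp
      ((hx j hj).prodMk ((hy j hj).prodMk (measurable_hist k a (by omega))))
  have h1 := h.run.y_step k hk
  simp only [← inner_neg_left] at h1
  refine measurable_prox (h.conv.closed_Y i) (h.conv.convex_Y i) h.s_pos ?_ (hy k le_rfl)
    (fun ω => h.run.y_mem k hk ω i) (fun ω => h1 ω i)
  have g0 := hG k le_rfl 0 (by decide)
  have g1 := hG (k - 1) (by omega) 1 (by decide)
  exact (g0.add ((g0.sub g1).const_smul (1 : ℝ))).neg

variable [IsProbabilityMeasure μ] [IsProbabilityMeasure ν]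

/-- A bound on the second moment of one component of the noise in the `λ`-step. -/
noncomputable def noiseLBound (μ : Measure Ω) (c : Consts) (x : ℕ → Ω → Vec p) (k : ℕ) : ℝ :=
  6 * c.sigG ^ 2 + 4 * c.sigDG ^ 2 * (∫ ω, ‖x k ω - x (k - 1) ω‖ ^ 2 ∂μ)
    + 2 * c.sigDG ^ 2 * ∫ ω, ‖x (k - 1) ω - x (k - 2) ω‖ ^ 2 ∂μ

/-- Samples 2, 3 and 4 are drawn one after another once y (k + 1) is known, so the three variances
add. Two linearisations involve the current x-increment and one the previous, which gives the
weights 4 and 2. -/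
theorem SampledRun.centered_noiseL (h : SampledRun μ ν P D O c t s γ K x0 y0 ξ x y lam) {k : ℕ}
    (hk : k < K) (hS : ∀ j ≤ k, RunState μ ξ x y lam j) :
    CenteredNoise μ (hist ξ (6 * k + 2)) (hist ξ (6 * k + 5)) (noiseL P D O ξ x y k)
      (m * noiseLBound μ c x k) := by
  have hx : ∀ j ≤ k, ∀ a, Measurable[hist ξ (6 * k + a)] (x j) := fun j hj a =>
    (hS j hj).x_meas.mono (hist_mono (by omega)) le_rfl
  have hy : ∀ i a, Measurable[hist ξ (6 * k + a)] (fun ω => y k ω i) := fun i a =>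
    ((hS k le_rfl).y_meas i).mono (hist_mono (by omega)) le_rfl
  have hX : ∀ j ≤ k, ∀ ω, x j ω ∈ P.X := fun j hj => h.x_mem (by omega)
  have key : ∀ i, CenteredNoise μ (hist ξ (6 * k + 2)) (hist ξ (6 * k + 5))
      (fun ω => noiseL P D O ξ x y k ω i) (noiseLBound μ c x k) := by
    intro i
    have n2 := CenteredNoise.lin (h.iid.fresh k 2) h.oracle (hx k le_rfl _)
      (hx (k - 1) (by omega) _) (h.measurable_y_succ hk hS i) (hX _ (by omega))
      (fun ω => h.y_mem (k := k + 1) hk ω i) (hS k le_rfl).x_memLp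
      (hS (k - 1) (by omega)).x_memLp
    have n3 := CenteredNoise.lin (h.iid.fresh k 3) h.oracle (hx k le_rfl _)
      (hx (k - 1) (by omega) _) (hy i _) (hX _ (by omega))
      (fun ω => h.y_mem hk.le ω i) (hS k le_rfl).x_memLp (hS (k - 1) (by omega)).x_memLp
    have n4 := CenteredNoise.lin (h.iid.fresh k 4) h.oracle (hx (k - 1) (by omega) _)
      (hx (k - 2) (by omega) _) (hy i _) (hX _ (by omega))
      (fun ω => h.y_mem hk.le ω i) (hS (k - 1) (by omega)).x_memLp
      (hS (k - 2) (by omega)).x_memLp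
    have n := ((n2.add n3 (hist_mono (by simp)) (hist_mono (by simp))).add (n4.const_smul (-1))
      (hist_mono (by simp)) (hist_mono (by simp)))
    refine n.mono le_rfl le_rfl (le_of_eq ?_)
    simp only [noiseLBound]
    ring
  have hv := CenteredNoise.vec (Z := noiseL P D O ξ x y k) key
  simpa using hv

theorem measurable_oracle_lin (hO : O.IsStochasticOracle ν P D c) {m1 : MeasurableSpace Ω}
    {i : Fin m} {u w : Ω → Vec p} {z : Ω → Vec q} {ζ : Ω → Ξ} (hu : Measurable[m1] u)
    (hw : Measurable[m1] w) (hz : Measurable[m1] z) (hζ : Measurable[m1] ζ) :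
    Measurable[m1] (fun ω => O.lin i (u ω) (ζ ω) (w ω) (z ω)) := by
  have ht : Measurable[m1] (fun ω => (w ω, z ω, ζ ω)) := hw.prodMk (hz.prodMk hζ)
  exact ((hO.measurable_G i).comp ht).add
    (((hO.measurable_gradxG i).comp ht).inner (hu.sub hw))

theorem SampledRun.measurable_lam_succ (h : SampledRun μ ν P D O c t s γ K x0 y0 ξ x y lam) {k : ℕ}
    (hk : k < K) (hS : ∀ j ≤ k, RunState μ ξ x y lam j) :
    Measurable[hist ξ (6 * k + 5)] (lam (k + 1)) := by
  have hx : ∀ j ≤ k, Measurable[hist ξ (6 * k + 5)] (x j) := fun j hj =>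
    (hS j hj).x_meas.mono (hist_mono (by omega)) le_rfl
  have hy : ∀ i, Measurable[hist ξ (6 * k + 5)] (fun ω => y k ω i) := fun i =>
    ((hS k le_rfl).y_meas i).mono (hist_mono (by omega)) le_rfl
  have hy' : ∀ i, Measurable[hist ξ (6 * k + 5)] (fun ω => y (k + 1) ω i) := fun i =>
    (h.measurable_y_succ hk hS i).mono (hist_mono (by omega)) le_rfl
  have hξ : ∀ a : Fin 6, (a : ℕ) < 5 → Measurable[hist ξ (6 * k + 5)] (ξ k a) := fun a ha =>
    measurable_hist k a (by omega)
  have h1 := h.run.lam_step k hk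
  simp only [neg_sum_eq_inner] at h1
  refine measurable_prox isClosed_nonneg convex_nonneg (h.γ_pos k hk) (Measurable.neg ?_)
    ((hS k le_rfl).lam_meas.mono (hist_mono (by omega)) le_rfl) (h.run.lam_mem k hk) h1
  refine measurable_vec fun i => ?_
  have a2 := measurable_oracle_lin (i := i) h.oracle (hx k le_rfl) (hx (k - 1) (by omega)) (hy' i)
    (hξ 2 (by decide))
  have a3 := measurable_oracle_lin (i := i) h.oracle (hx k le_rfl) (hx (k - 1) (by omega)) (hy i)
    (hξ 3 (by decide))
  have a4 := measurable_oracle_lin (i := i) h.oracle (hx (k - 1) (by omega)) (hx (k - 2) (by omega))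
    (hy i) (hξ 4 (by decide))
  exact a2.add ((a3.sub a4).const_mul 1)

theorem norm_le_sum_abs (v : Vec m) : ‖v‖ ≤ ∑ j, |v j| := by
  refine (abs_le_of_sq_le_sq' ?_ (Finset.sum_nonneg fun _ _ => abs_nonneg _)).2
  rw [EuclideanSpace.real_norm_sq_eq]
  simp only [← sq_abs (v _)]
  exact Finset.sum_sq_le_sq_sum_of_nonneg fun j _ => abs_nonneg _

/-- A bound on the linearization of `g i` at `(w, z)`, evaluated at `u`. -/
noncomputable def linBound (P : Problem p q m) (c : Consts) (x0 : Vec p) (y0 : Fin m → Vec q)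
    (i : Fin m) (u w : Vec p) : ℝ :=
  |P.g i x0 (y0 i)| + c.Mx * ‖w - x0‖ + c.My * c.Dy + c.Mx * ‖u - w‖

theorem SampledRun.abs_lin_le (h : SampledRun μ ν P D O c t s γ K x0 y0 ξ x y lam) {i : Fin m}
    {u w : Vec p} {z : Vec q} (hw : w ∈ P.X) (hz : z ∈ P.Y i) :
    |P.lin D i u w z| ≤ linBound P c x0 y0 i u w := by
  have h1 := h.smooth.g_lip i w hw x0 h.x0_mem z hz (y0 i) (h.y0_mem i)
  have h2 := abs_inner_gradxg_le h.smooth hw hz (u - w)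
  have h3 := mul_le_mul_of_nonneg_left (h.conv.diam_Y i z hz (y0 i) (h.y0_mem i)) h.nonneg.My
  unfold Problem.lin linBound
  have h4 := abs_add_le (P.g i w z) (inner ℝ (D.gradxg i w z) (u - w))
  have h5 := abs_sub_abs_le_abs_sub (P.g i w z) (P.g i x0 (y0 i))
  linarith

theorem memLp_linBound {i : Fin m} {u w : Ω → Vec p} (hu : MemLp u 2 μ) (hw : MemLp w 2 μ) :
    MemLp (fun ω => linBound P c x0 y0 i (u ω) (w ω)) 2 μ := by
  have a1 : MemLp (fun _ : Ω => |P.g i x0 (y0 i)|) 2 μ := memLp_const _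
  have a2 : MemLp (fun _ : Ω => c.My * c.Dy) 2 μ := memLp_const _
  have a3 : MemLp (fun ω => ‖w ω - x0‖) 2 μ := (hw.sub (memLp_const x0)).norm
  have a4 : MemLp (fun ω => ‖u ω - w ω‖) 2 μ := (hu.sub hw).norm
  exact ((a1.add (a3.const_mul c.Mx)).add a2).add (a4.const_mul c.Mx)

/-- A proximal step is no longer than its linear term divided by γ k. That term is at most a bound
affine in distances of earlier x-iterates plus the noise, so the second moment of the multipliers
stays finite. -/
theorem SampledRun.norm_lam_succ_le (h : SampledRun μ ν P D O c t s γ K x0 y0 ξ x y lam) {k : ℕ}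
    (hk : k < K) (ω : Ω) :
    ‖lam (k + 1) ω‖ ≤ ‖lam k ω‖ + (γ k)⁻¹ * ∑ j,
      (linBound P c x0 y0 j (x k ω) (x (k - 1) ω) + linBound P c x0 y0 j (x k ω) (x (k - 1) ω)
        + linBound P c x0 y0 j (x (k - 1) ω) (x (k - 2) ω) + |noiseL P D O ξ x y k ω j|) := by
  have h1 := h.run.lam_step k hk ω
  simp only [neg_sum_eq_inner] at h1
  have ha : lam k ω ∈ {l : Vec m | ∀ i, 0 ≤ l i} := (h.path ω).lam_nonneg k hk.le
  have hz : lam (k + 1) ω ∈ {l : Vec m | ∀ i, 0 ≤ l i} := h.run.lam_mem k hk ω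
  have h2 := norm_prox_sub_le convex_nonneg (h.γ_pos k hk) hz ha h1
  have h3 : ‖lam (k + 1) ω‖ ≤ ‖lam k ω‖ + ‖lam (k + 1) ω - lam k ω‖ := by
    linarith [norm_sub_norm_le (lam (k + 1) ω) (lam k ω)]
  refine h3.trans (add_le_add_right (h2.trans
    (mul_le_mul_of_nonneg_left ((norm_le_sum_abs _).trans ?_) (inv_nonneg.2 (h.γ_pos k hk).le))) _)
  refine Finset.sum_le_sum fun j _ => ?_
  simp only [PiLp.neg_apply, abs_neg]
  have hX : ∀ j ≤ k, x j ω ∈ P.X := fun j hj => h.x_mem (by omega) ω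
  have b2 := h.abs_lin_le (u := x k ω) (hX (k - 1) (by omega)) (h.y_mem (k := k + 1) hk ω j)
  have b3 := h.abs_lin_le (u := x k ω) (hX (k - 1) (by omega)) (h.y_mem hk.le ω j)
  have b4 := h.abs_lin_le (u := x (k - 1) ω) (hX (k - 2) (by omega)) (h.y_mem hk.le ω j)
  have e : O.lin j (x k ω) (ξ k 2 ω) (x (k - 1) ω) (y (k + 1) ω j)
      + 1 * (O.lin j (x k ω) (ξ k 3 ω) (x (k - 1) ω) (y k ω j)
        - O.lin j (x (k - 1) ω) (ξ k 4 ω) (x (k - 2) ω) (y k ω j))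
      = P.lin D j (x k ω) (x (k - 1) ω) (y (k + 1) ω j)
        + P.lin D j (x k ω) (x (k - 1) ω) (y k ω j)
        - P.lin D j (x (k - 1) ω) (x (k - 2) ω) (y k ω j) + noiseL P D O ξ x y k ω j := by
    simp only [noiseL, linNoise, smul_eq_mul]; ring
  rw [e]
  refine (abs_add_le _ _).trans (add_le_add_left ?_ _)
  exact (abs_sub _ _).trans (add_le_add ((abs_add_le _ _).trans (add_le_add b2 b3)) b4)

theorem SampledRun.memLp_lam_succ (h : SampledRun μ ν P D O c t s γ K x0 y0 ξ x y lam) {k : ℕ}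
    (hk : k < K) (hS : ∀ j ≤ k, RunState μ ξ x y lam j) : MemLp (lam (k + 1)) 2 μ := by
  have hn := memLp_coord (h.centered_noiseL hk hS).memLp
  have hk0 := (hS k le_rfl).x_memLp
  have hk1 := (hS (k - 1) (by omega)).x_memLp
  have hk2 := (hS (k - 2) (by omega)).x_memLp
  have hb : ∀ (j : Fin m) {u w : Ω → Vec p}, MemLp u 2 μ → MemLp w 2 μ →
      MemLp (fun ω => linBound P c x0 y0 j (u ω) (w ω)) 2 μ := fun j _ _ => memLp_linBound
  have hB := fun j : Fin m =>
    (((hb j hk0 hk1).add (hb j hk0 hk1)).add (hb j hk1 hk2)).add (hn j).norm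
  have hprev := (hS k le_rfl).lam_memLp.norm.add
    ((memLp_finsetSum Finset.univ fun j _ => hB j).const_mul (γ k)⁻¹)
  exact hprev.mono' ((h.measurable_lam_succ hk hS).mono (hist_le h.iid _)
    le_rfl).aestronglyMeasurable (Filter.Eventually.of_forall fun ω => h.norm_lam_succ_le hk ω)

end State

/-- Otherwise each of the three terms on the right would be at most d², contradicting 4d² with d >
0. It makes the growth of an x-step linear in the current distance, as square integrability
requires. -/
theorem le_of_sq_le_linear {d B C r l : ℝ} (hd : 0 ≤ d) (hB : 0 ≤ B) (hC : 0 ≤ C) (hr : 0 ≤ r)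
    (hl : 0 ≤ l) (h : 4 * d ^ 2 ≤ B * d + C * r + l * r ^ 2) : d ≤ B + C + r + (1 + l) * r := by
  by_contra hlt
  push Not at hlt
  have hlr := mul_nonneg hl hr
  have h1 : B * d ≤ d * d := mul_le_mul_of_nonneg_right (by linarith) hd
  have h2 : C * r ≤ d * d := mul_le_mul (by linarith) (by linarith) hr hd
  have h3 : l * r * r ≤ d * d := mul_le_mul (by linarith) (by linarith) hr hd
  have h4 : 0 < d := lt_of_le_of_lt (by positivity) hlt
  nlinarith

section State

variable {p q m : ℕ} {Ω Ξ : Type*} [mΩ : MeasurableSpace Ω] [mΞ : MeasurableSpace Ξ]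
  {μ : Measure Ω} {ν : Measure Ξ} {P : Problem p q m} {D : Gradients p q m}
  {O : Oracle p q m Ξ} {c : Consts} {t s : ℝ} {γ : ℕ → ℝ} {K : ℕ} {x0 : Vec p}
  {y0 : Fin m → Vec q} {ξ : ℕ → Fin 6 → Ω → Ξ} {x : ℕ → Ω → Vec p} {y : ℕ → Ω → Fin m → Vec q}
  {lam : ℕ → Ω → Vec m}

/-- The gradient of f at x k is not bounded directly. Its pairing with the step is bounded below by
values of f through the upper model, and these values are compared with f x0 by the subgradient
inequality and the upper model at x0. -/
theorem SampledRun.norm_x_succ_sub_le (h : SampledRun μ ν P D O c t s γ K x0 y0 ξ x y lam) {k : ℕ}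
    (hk : k < K) (ω : Ω) :
    ‖x (k + 1) ω - x k ω‖ ≤ (c.Hf + ‖D.gradf x0‖ + ‖noiseF D O ξ x k ω‖
        + (∑ i, ‖noiseZ D O ξ x y lam i k ω‖) + c.Mx * ∑ i, |lam (k + 1) ω i|)
      + (2 * ‖D.gradf x0‖ + c.Hf) + ‖x k ω - x0‖ + (1 + c.Lf) * ‖x k ω - x0‖ := by
  have hxk := h.x_mem hk.le ω
  have hxk' := h.x_mem (k := k + 1) hk ω
  have hLf := h.nonneg.Lf
  have hHf := h.nonneg.Hf
  have hMx := h.nonneg.Mx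
  have hlam : 0 ≤ ∑ i, |lam (k + 1) ω i| := Finset.sum_nonneg fun _ _ => abs_nonneg _
  have hZ : 0 ≤ ∑ i, ‖noiseZ D O ξ x y lam i k ω‖ := Finset.sum_nonneg fun _ _ => norm_nonneg _
  have h1 := (h.path ω).x_step k hk _ hxk
  have h2 := h.smooth.f_upper _ hxk' _ hxk
  have h3 := h.smooth.f_upper _ hxk _ h.x0_mem
  have h4 := h.grad.f _ hxk' _ h.x0_mem
  have h5 := abs_real_inner_le_norm (D.gradf x0) (x (k + 1) ω - x0)
  have h6 := abs_real_inner_le_norm (D.gradf x0) (x k ω - x0)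
  have h7 : ‖x (k + 1) ω - x0‖ ≤ ‖x (k + 1) ω - x k ω‖ + ‖x k ω - x0‖ := by
    simpa using norm_add_le (x (k + 1) ω - x k ω) (x k ω - x0)
  have hS : ‖∑ i, lam (k + 1) ω i • D.gradxg i (x k ω) (y (k + 1) ω i)‖
      ≤ c.Mx * ∑ i, |lam (k + 1) ω i| := by
    rw [Finset.mul_sum]
    refine (norm_sum_le _ _).trans (Finset.sum_le_sum fun i _ => ?_)
    rw [norm_smul, Real.norm_eq_abs, mul_comm]
    exact mul_le_mul_of_nonneg_right
      (h.smooth.bound_gradx i _ hxk _ (h.y_mem (k := k + 1) hk ω i)) (abs_nonneg _)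
  simp only [sub_self, norm_zero, norm_sub_rev (x k ω) (x (k + 1) ω), inner_add_left] at h1
  have a1 := abs_real_inner_le_norm (∑ i, lam (k + 1) ω i • D.gradxg i (x k ω) (y (k + 1) ω i))
    (x (k + 1) ω - x k ω)
  have a2 := abs_real_inner_le_norm (noiseF D O ξ x k ω) (x (k + 1) ω - x k ω)
  have a3 := abs_real_inner_le_norm (∑ i, noiseZ D O ξ x y lam i k ω) (x (k + 1) ω - x k ω)
  have a4 := norm_sum_le Finset.univ fun i => noiseZ D O ξ x y lam i k ω
  have ht := h.t_ge
  set d := ‖x (k + 1) ω - x k ω‖ with hd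
  have hd0 : 0 ≤ d := norm_nonneg _
  have a1' := mul_le_mul_of_nonneg_right hS hd0
  have a4' := mul_le_mul_of_nonneg_right a4 hd0
  have h5' := mul_le_mul_of_nonneg_left h7 (norm_nonneg (D.gradf x0))
  -- The margin t ≥ 4 (Lf + 1) leaves 4d² after the curvature Lf / 2 · d² has been paid.
  have htd : 4 * (c.Lf + 1) * d ^ 2 ≤ t * d ^ 2 := mul_le_mul_of_nonneg_right ht (sq_nonneg d)
  rw [abs_le] at a1 a2 a3 h5 h6
  have hd2 := mul_nonneg hLf (sq_nonneg d)
  have hr0 : 0 ≤ ‖x k ω - x0‖ := norm_nonneg _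
  have hF0 : 0 ≤ ‖noiseF D O ξ x k ω‖ := norm_nonneg _
  have hG0 : 0 ≤ ‖D.gradf x0‖ := norm_nonneg _
  have hML := mul_nonneg hMx hlam
  have hr2 := mul_nonneg hLf (sq_nonneg ‖x k ω - x0‖)
  have key : 4 * d ^ 2 ≤ (c.Hf + ‖D.gradf x0‖ + ‖noiseF D O ξ x k ω‖
        + (∑ i, ‖noiseZ D O ξ x y lam i k ω‖) + c.Mx * ∑ i, |lam (k + 1) ω i|) * d
      + (2 * ‖D.gradf x0‖ + c.Hf) * ‖x k ω - x0‖ + c.Lf * ‖x k ω - x0‖ ^ 2 := by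
    linarith [a1.1, a2.1, a3.1, h5.1, h6.2]
  exact le_of_sq_le_linear hd0 (by linarith) (by linarith) hr0 hLf key

variable [IsProbabilityMeasure μ] [IsProbabilityMeasure ν]

/-- The extrapolation weights 2 and -1 fall on independent samples, whence 5 = 2² + 1². -/
theorem SampledRun.centered_noiseY (h : SampledRun μ ν P D O c t s γ K x0 y0 ξ x y lam) {k : ℕ}
    (hk : k < K) (hS : ∀ j ≤ k, RunState μ ξ x y lam j) (i : Fin m) :
    CenteredNoise μ (hist ξ (6 * k)) (hist ξ (6 * k + 2)) (noiseY D O ξ x y i k)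
      (5 * c.sigDG ^ 2) := by
  have n0 := CenteredNoise.gradyG (h.iid.fresh k 0) h.oracle (i := i) (hS k le_rfl).x_meas
    ((hS k le_rfl).y_meas i) (h.x_mem hk.le) (fun ω => h.y_mem hk.le ω i)
  have n1 := CenteredNoise.gradyG (h.iid.fresh k 1) h.oracle (i := i)
    ((hS (k - 1) (by omega)).x_meas.mono (hist_mono (by simp; omega)) le_rfl)
    (((hS (k - 1) (by omega)).y_meas i).mono (hist_mono (by simp; omega)) le_rfl)
    (h.x_mem (by omega)) (fun ω => h.y_mem (by omega) ω i)
  refine ((n0.const_smul 2).add (n1.const_smul (-1)) (hist_mono (by simp))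
    (hist_mono (by simp))).mono le_rfl le_rfl (le_of_eq (by ring))

theorem SampledRun.centered_noiseF (h : SampledRun μ ν P D O c t s γ K x0 y0 ξ x y lam) {k : ℕ}
    (hk : k < K) (hS : ∀ j ≤ k, RunState μ ξ x y lam j) :
    CenteredNoise μ (hist ξ (6 * k + 5)) (hist ξ (6 * k + 6)) (noiseF D O ξ x k) (c.sigF ^ 2) :=
  CenteredNoise.gradF (h.iid.fresh k 5) h.oracle
    ((hS k le_rfl).x_meas.mono (hist_mono (by simp)) le_rfl) (h.x_mem hk.le)

theorem SampledRun.centered_noiseZ (h : SampledRun μ ν P D O c t s γ K x0 y0 ξ x y lam) {k : ℕ}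
    (hk : k < K) (hS : ∀ j ≤ k, RunState μ ξ x y lam j) (i : Fin m) :
    CenteredNoise μ (hist ξ (6 * k + 5)) (hist ξ (6 * k + 6)) (noiseZ D O ξ x y lam i k)
      (c.sigDG ^ 2 * ∫ ω, lam (k + 1) ω i ^ 2 ∂μ) :=
  CenteredNoise.smul_gradxG (h.iid.fresh k 5) h.oracle
    ((hS k le_rfl).x_meas.mono (hist_mono (by simp)) le_rfl)
    ((h.measurable_y_succ hk hS i).mono (hist_mono (by simp)) le_rfl) (h.x_mem hk.le)
    (fun ω => h.y_mem (k := k + 1) hk ω i) (measurable_coord (h.measurable_lam_succ hk hS) i)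
    (memLp_coord (h.memLp_lam_succ hk hS) i)

theorem SampledRun.measurable_x_succ (h : SampledRun μ ν P D O c t s γ K x0 y0 ξ x y lam) {k : ℕ}
    (hk : k < K) (hS : ∀ j ≤ k, RunState μ ξ x y lam j) :
    Measurable[hist ξ (6 * k + 6)] (x (k + 1)) := by
  have hx : Measurable[hist ξ (6 * k + 6)] (x k) :=
    (hS k le_rfl).x_meas.mono (hist_mono (by omega)) le_rfl
  have hξ : Measurable[hist ξ (6 * k + 6)] (ξ k 5) := measurable_hist k 5 (by simp)
  have ht : 0 < t := by linarith [h.t_ge, h.nonneg.Lf]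
  refine measurable_prox h.conv.closed_X h.conv.convex_X ht (Measurable.add ?_ ?_) hx
    (h.run.x_mem k hk) (h.run.x_step k hk)
  · exact h.oracle.measurable_gradF.comp (hx.prodMk hξ)
  · refine Finset.measurable_sum _ fun i _ => Measurable.smul
      ((measurable_coord (h.measurable_lam_succ hk hS) i).mono (hist_mono (by omega)) le_rfl) ?_
    exact (h.oracle.measurable_gradxG i).comp (hx.prodMk
      (((h.measurable_y_succ hk hS i).mono (hist_mono (by omega)) le_rfl).prodMk hξ))

theorem SampledRun.memLp_x_succ (h : SampledRun μ ν P D O c t s γ K x0 y0 ξ x y lam) {k : ℕ}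
    (hk : k < K) (hS : ∀ j ≤ k, RunState μ ξ x y lam j) : MemLp (x (k + 1)) 2 μ := by
  have b1 : MemLp (fun ω => ‖noiseF D O ξ x k ω‖) 2 μ := (h.centered_noiseF hk hS).memLp.norm
  have b2 : MemLp (fun ω => ∑ i, ‖noiseZ D O ξ x y lam i k ω‖) 2 μ :=
    memLp_finsetSum _ fun i _ => (h.centered_noiseZ hk hS i).memLp.norm
  have b3 : MemLp (fun ω => ∑ i, |lam (k + 1) ω i|) 2 μ :=
    memLp_finsetSum _ fun i _ => (memLp_coord (h.memLp_lam_succ hk hS) i).norm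
  have b4 : MemLp (fun ω => ‖x k ω - x0‖) 2 μ := ((hS k le_rfl).x_memLp.sub (memLp_const x0)).norm
  have b5 : MemLp (fun _ : Ω => c.Hf + ‖D.gradf x0‖) 2 μ := memLp_const _
  have b6 : MemLp (fun _ : Ω => 2 * ‖D.gradf x0‖ + c.Hf) 2 μ := memLp_const _
  have hB := ((((((b5.add b1).add b2).add (b3.const_mul c.Mx)).add b6).add b4).add
    (b4.const_mul (1 + c.Lf)))
  have hm := (h.measurable_x_succ hk hS).mono (hist_le h.iid _) le_rfl
  have hd : MemLp (fun ω => x (k + 1) ω - x k ω) 2 μ :=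
    hB.mono' (hm.aestronglyMeasurable.sub (hS k le_rfl).x_memLp.1)
      (Filter.Eventually.of_forall fun ω => h.norm_x_succ_sub_le hk ω)
  have := hd.add (hS k le_rfl).x_memLp
  refine this.ae_eq (Filter.Eventually.of_forall fun ω => ?_)
  simp

/-- Strong induction, because step k also uses the iterates of index k - 1 and k - 2. -/
theorem SampledRun.state (h : SampledRun μ ν P D O c t s γ K x0 y0 ξ x y lam) {k : ℕ}
    (hk : k ≤ K) : RunState μ ξ x y lam k := by
  induction k using Nat.strong_induction_on with
  | _ k ih =>
    cases k with
    | zero =>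
      have e1 : x 0 = fun _ => x0 := funext h.run.x_zero
      have e2 : lam 0 = fun _ => 0 := funext h.run.lam_zero
      refine ⟨?_, ?_, ?_, ?_, fun i => ?_⟩
      · rw [e1]; exact measurable_const
      · rw [e1]; exact memLp_const _
      · rw [e2]; exact measurable_const
      · rw [e2]; exact memLp_const _
      · simp only [h.run.y_zero]; exact measurable_const
    | succ k =>
      have hS : ∀ j ≤ k, RunState μ ξ x y lam j := fun j hj => ih j (by omega) (by omega)
      exact ⟨h.measurable_x_succ hk hS, h.memLp_x_succ hk hS,
        (h.measurable_lam_succ hk hS).mono (hist_mono (by omega)) le_rfl, h.memLp_lam_succ hk hS,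
        fun i => (h.measurable_y_succ hk hS i).mono (hist_mono (by omega)) le_rfl⟩

end State

/-! ### Expected size of the noise contributions -/

section Expectation

variable {p q m : ℕ} {Ω Ξ : Type*} [mΩ : MeasurableSpace Ω] [mΞ : MeasurableSpace Ξ]
  {μ : Measure Ω} {ν : Measure Ξ} {P : Problem p q m} {D : Gradients p q m}
  {O : Oracle p q m Ξ} {c : Consts} {t s : ℝ} {γ : ℕ → ℝ} {K : ℕ} {x0 : Vec p}
  {y0 : Fin m → Vec q} {ξ : ℕ → Fin 6 → Ω → Ξ} {x : ℕ → Ω → Vec p} {y : ℕ → Ω → Fin m → Vec q}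
  {lam : ℕ → Ω → Vec m}

/-- The contribution of the noise of the `x`-steps to the gap. -/
noncomputable def errX (D : Gradients p q m) (O : Oracle p q m Ξ) (ξ : ℕ → Fin 6 → Ω → Ξ)
    (x : ℕ → Ω → Vec p) (y : ℕ → Ω → Fin m → Vec q) (lam : ℕ → Ω → Vec m) (xs : Vec p)
    (t a : ℝ) (k : ℕ) (ω : Ω) : ℝ :=
  inner ℝ (noiseF D O ξ x k ω + ∑ i, noiseZ D O ξ x y lam i k ω) (xs - x k ω)
    + 2 * (‖noiseF D O ξ x k ω‖ ^ 2 / t) + 4 * (‖∑ i, noiseZ D O ξ x y lam i k ω‖ ^ 2 / t)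
    - a * ‖lam (k + 1) ω‖ ^ 2

/-- The contribution of the noise of the `λ`-steps to the gap. -/
noncomputable def errL (P : Problem p q m) (D : Gradients p q m) (O : Oracle p q m Ξ)
    (ξ : ℕ → Fin 6 → Ω → Ξ) (x : ℕ → Ω → Vec p) (y : ℕ → Ω → Fin m → Vec q) (lam : ℕ → Ω → Vec m)
    (r a : ℝ) (K : ℕ) (ω : Ω) : ℝ :=
  (∑ k ∈ Finset.range K,
      (inner ℝ (noiseL P D O ξ x y k ω) (lam k ω) + ‖noiseL P D O ξ x y k ω‖ ^ 2 / r))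
    + ‖∑ k ∈ Finset.range K, noiseL P D O ξ x y k ω‖ ^ 2 / r
    - a * ∑ k ∈ Finset.range K, ‖x (k + 1) ω - x k ω‖ ^ 2

/-- The contribution of the noise of the `y`-steps to the gap. -/
noncomputable def errY (D : Gradients p q m) (O : Oracle p q m Ξ) (ξ : ℕ → Fin 6 → Ω → Ξ)
    (x : ℕ → Ω → Vec p) (y : ℕ → Ω → Fin m → Vec q) (y0 : Fin m → Vec q) (d s : ℝ) (K : ℕ)
    (i : Fin m) (ω : Ω) : ℝ :=
  ‖∑ k ∈ Finset.range K, inner ℝ (noiseY D O ξ x y i k ω) (y k ω i - y0 i)‖ ^ 2 / (s * d ^ 2)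
    + ‖∑ k ∈ Finset.range K, noiseY D O ξ x y i k ω‖ ^ 2 / s
    + ∑ k ∈ Finset.range K, ‖noiseY D O ξ x y i k ω‖ ^ 2 / s

theorem norm_sum_sq_le {E ι : Type*} [SeminormedAddCommGroup E] (S : Finset ι) (v : ι → E) :
    ‖∑ i ∈ S, v i‖ ^ 2 ≤ S.card * ∑ i ∈ S, ‖v i‖ ^ 2 :=
  (pow_le_pow_left₀ (norm_nonneg _) (norm_sum_le _ _) 2).trans sq_sum_le_card_mul_sum_sq

variable [IsProbabilityMeasure μ] [IsProbabilityMeasure ν]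

/-- The iterate x k is known before sample 5, so the pairings have mean zero. The error weighted by
the multipliers has second moment proportional to that of lam (k + 1), and the subtracted multiple
of ‖lam (k + 1)‖² cancels it; only the noise of f remains. -/
theorem SampledRun.integral_errX (h : SampledRun μ ν P D O c t s γ K x0 y0 ξ x y lam) {xs : Vec p}
    {a : ℝ} (ha : 4 * m * c.sigDG ^ 2 / t ≤ a) {k : ℕ} (hk : k < K) :
    Integrable (errX D O ξ x y lam xs t a k) μ ∧
      ∫ ω, errX D O ξ x y lam xs t a k ω ∂μ ≤ 2 * (c.sigF ^ 2 / t) := by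
  have hS : ∀ j ≤ k, RunState μ ξ x y lam j := fun j hj => h.state (by omega)
  have ht : 0 < t := by linarith [h.t_ge, h.nonneg.Lf]
  have nF := h.centered_noiseF hk hS
  have nZ := h.centered_noiseZ hk hS
  have hxm : Measurable[hist ξ (6 * k + 5)] (fun ω => xs - x k ω) :=
    measurable_const.sub ((hS k le_rfl).x_meas.mono (hist_mono (by omega)) le_rfl)
  have hxL : MemLp (fun ω => xs - x k ω) 2 μ := (memLp_const xs).sub (hS k le_rfl).x_memLp
  have hlL := h.memLp_lam_succ hk hS
  have hZL : MemLp (fun ω => ∑ i, noiseZ D O ξ x y lam i k ω) 2 μ :=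
    memLp_finsetSum _ fun i _ => (nZ i).memLp
  have i1 := integrable_inner_of_memLp nF.memLp hxL
  have i2 := integrable_inner_of_memLp hZL hxL
  have i3 : Integrable (fun ω => 2 * (‖noiseF D O ξ x k ω‖ ^ 2 / t)) μ :=
    ((integrable_norm_sq nF.memLp).div_const t).const_mul 2
  have i4 : Integrable (fun ω => 4 * (‖∑ i, noiseZ D O ξ x y lam i k ω‖ ^ 2 / t)) μ :=
    ((integrable_norm_sq hZL).div_const t).const_mul 4
  have i5 : Integrable (fun ω => a * ‖lam (k + 1) ω‖ ^ 2) μ :=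
    (integrable_norm_sq hlL).const_mul a
  have z2 : ∫ ω, inner ℝ (∑ i, noiseZ D O ξ x y lam i k ω) (xs - x k ω) ∂μ = 0 := by
    simp only [sum_inner]
    rw [integral_finsetSum _ fun i _ => integrable_inner_of_memLp (nZ i).memLp hxL]
    exact Finset.sum_eq_zero fun i _ => (nZ i).orth _ hxm hxL
  -- The m errors share one sample, so cross terms need not vanish; Cauchy-Schwarz costs the factor
  -- m.
  have hZ2 : ∫ ω, ‖∑ i, noiseZ D O ξ x y lam i k ω‖ ^ 2 ∂μ
      ≤ m * c.sigDG ^ 2 * ∫ ω, ‖lam (k + 1) ω‖ ^ 2 ∂μ := by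
    have hi := integrable_finsetSum Finset.univ fun i (_ : i ∈ Finset.univ) =>
      integrable_norm_sq (nZ i).memLp
    have h1 : ∀ ω, ‖∑ i, noiseZ D O ξ x y lam i k ω‖ ^ 2
        ≤ m * ∑ i, ‖noiseZ D O ξ x y lam i k ω‖ ^ 2 := fun ω => by
      simpa using norm_sum_sq_le Finset.univ fun i => noiseZ D O ξ x y lam i k ω
    refine (integral_mono (integrable_norm_sq hZL) (hi.const_mul (m : ℝ)) h1).trans ?_
    rw [integral_const_mul, integral_finsetSum _ fun i _ => integrable_norm_sq (nZ i).memLp,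
      mul_assoc]
    refine mul_le_mul_of_nonneg_left ?_ (Nat.cast_nonneg m)
    refine (Finset.sum_le_sum fun i _ => (nZ i).sq_le).trans (le_of_eq ?_)
    rw [← Finset.mul_sum]
    simp only [EuclideanSpace.real_norm_sq_eq]
    rw [integral_finsetSum _ fun i _ => (memLp_coord hlL i).integrable_sq]
  have e : ∀ ω, errX D O ξ x y lam xs t a k ω
      = inner ℝ (noiseF D O ξ x k ω) (xs - x k ω)
        + inner ℝ (∑ i, noiseZ D O ξ x y lam i k ω) (xs - x k ω)
        + 2 * (‖noiseF D O ξ x k ω‖ ^ 2 / t)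
        + 4 * (‖∑ i, noiseZ D O ξ x y lam i k ω‖ ^ 2 / t) - a * ‖lam (k + 1) ω‖ ^ 2 :=
    fun ω => by rw [errX, inner_add_left]
  have i12 : Integrable (fun ω => inner ℝ (noiseF D O ξ x k ω) (xs - x k ω)
      + inner ℝ (∑ i, noiseZ D O ξ x y lam i k ω) (xs - x k ω)) μ := i1.add i2
  have i123 : Integrable (fun ω => inner ℝ (noiseF D O ξ x k ω) (xs - x k ω)
      + inner ℝ (∑ i, noiseZ D O ξ x y lam i k ω) (xs - x k ω)
      + 2 * (‖noiseF D O ξ x k ω‖ ^ 2 / t)) μ := i12.add i3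
  have i1234 : Integrable (fun ω => inner ℝ (noiseF D O ξ x k ω) (xs - x k ω)
      + inner ℝ (∑ i, noiseZ D O ξ x y lam i k ω) (xs - x k ω)
      + 2 * (‖noiseF D O ξ x k ω‖ ^ 2 / t)
      + 4 * (‖∑ i, noiseZ D O ξ x y lam i k ω‖ ^ 2 / t)) μ := i123.add i4
  rw [funext e]
  refine ⟨i1234.sub i5, ?_⟩
  rw [integral_sub i1234 i5, integral_add i123 i4, integral_add i12 i3, integral_add i1 i2,
    nF.orth _ hxm hxL, z2, integral_const_mul, integral_const_mul, integral_const_mul,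
    integral_div, integral_div]
  have hl0 : 0 ≤ ∫ ω, ‖lam (k + 1) ω‖ ^ 2 ∂μ := integral_nonneg fun _ => by positivity
  have b1 := div_le_div_of_nonneg_right nF.sq_le ht.le
  have b2 := div_le_div_of_nonneg_right hZ2 ht.le
  have b3 := mul_le_mul_of_nonneg_right ha hl0
  have b4 : 4 * m * c.sigDG ^ 2 / t * ∫ ω, ‖lam (k + 1) ω‖ ^ 2 ∂μ
      = 4 * ((m * c.sigDG ^ 2 * ∫ ω, ‖lam (k + 1) ω‖ ^ 2 ∂μ) / t) := by ring
  linarith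

theorem SampledRun.sum_noiseLBound_le (h : SampledRun μ ν P D O c t s γ K x0 y0 ξ x y lam) :
    ∑ k ∈ Finset.range K, noiseLBound μ c x k
      ≤ 6 * c.sigG ^ 2 * K + 6 * c.sigDG ^ 2 *
        ∑ k ∈ Finset.range K, ∫ ω, ‖x (k + 1) ω - x k ω‖ ^ 2 ∂μ := by
  set d : ℕ → ℝ := fun k => ∫ ω, ‖x k ω - x (k - 1) ω‖ ^ 2 ∂μ with hd
  have hd0 : ∀ k, 0 ≤ d k := fun k => integral_nonneg fun _ => by positivity
  have s1 : ∑ k ∈ Finset.range (K + 1), d k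
      = ∑ k ∈ Finset.range K, ∫ ω, ‖x (k + 1) ω - x k ω‖ ^ 2 ∂μ := by
    rw [Finset.sum_range_succ']; simp [hd]
  have s2 : ∑ k ∈ Finset.range K, d k ≤ ∑ k ∈ Finset.range (K + 1), d k := by
    rw [Finset.sum_range_succ]; linarith [hd0 K]
  have s3 : ∑ k ∈ Finset.range K, d (k - 1) ≤ ∑ k ∈ Finset.range (K + 1), d k := by
    cases K with
    | zero => simpa using hd0 0
    | succ n =>
      rw [Finset.sum_range_succ', Finset.sum_range_succ, Finset.sum_range_succ]
      have : d 0 = 0 := by simp [hd]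
      simp only [Nat.add_sub_cancel, Nat.zero_sub, this]
      linarith [hd0 n, hd0 (n + 1)]
  have e : ∀ k, noiseLBound μ c x k
      = 6 * c.sigG ^ 2 + 4 * c.sigDG ^ 2 * d k + 2 * c.sigDG ^ 2 * d (k - 1) := fun k => by
    simp only [noiseLBound, hd, Nat.sub_sub]
  simp only [e, Finset.sum_add_distrib, ← Finset.mul_sum, Finset.sum_const, Finset.card_range,
    nsmul_eq_mul]
  rw [← s1]
  have h1 := mul_le_mul_of_nonneg_left s2 (by positivity : 0 ≤ 4 * c.sigDG ^ 2)
  have h2 := mul_le_mul_of_nonneg_left s3 (by positivity : 0 ≤ 2 * c.sigDG ^ 2)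
  linarith

/-- Both the sum of squares and the square of the sum have expectation at most m times the sum of
the component bounds. The part proportional to squared x-increments is cancelled by the subtracted
term, and the value noise remains. -/
theorem SampledRun.integral_errL (h : SampledRun μ ν P D O c t s γ K x0 y0 ξ x y lam)
    {r a : ℝ} (hr : 0 < r) (ha : 12 * m * c.sigDG ^ 2 / r ≤ a) :
    Integrable (errL P D O ξ x y lam r a K) μ ∧
      ∫ ω, errL P D O ξ x y lam r a K ω ∂μ ≤ K * (12 * m * c.sigG ^ 2 / r) := by
  have hS : ∀ k ≤ K, RunState μ ξ x y lam k := fun k hk => h.state hk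
  have nL : ∀ k < K, CenteredNoise μ (hist ξ (6 * k + 2)) (hist ξ (6 * k + 5))
      (noiseL P D O ξ x y k) (m * noiseLBound μ c x k) := fun k hk =>
    h.centered_noiseL hk fun j hj => hS j (by omega)
  -- The noise of step k is known at 6k + 5, before the start 6 (k + 1) + 2 of the next, so these
  -- errors form martingale differences.
  have nS := CenteredNoise.sum (m := fun k => hist ξ (6 * k + 2))
    (fun a b hab => hist_mono (by omega)) K fun k hk =>
    (nL k hk).mono le_rfl (hist_mono (by omega)) le_rfl
  have hd : ∀ k ∈ Finset.range K, Integrable (fun ω => ‖x (k + 1) ω - x k ω‖ ^ 2) μ := fun k hk =>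
    integrable_norm_sq ((hS (k + 1) (Finset.mem_range.1 hk)).x_memLp.sub
      (hS k (Finset.mem_range.1 hk).le).x_memLp)
  have i1 : ∀ k ∈ Finset.range K, Integrable (fun ω =>
      inner ℝ (noiseL P D O ξ x y k ω) (lam k ω) + ‖noiseL P D O ξ x y k ω‖ ^ 2 / r) μ :=
    fun k hk => (integrable_inner_of_memLp (nL k (Finset.mem_range.1 hk)).memLp
      (hS k (Finset.mem_range.1 hk).le).lam_memLp).add
      ((integrable_norm_sq (nL k (Finset.mem_range.1 hk)).memLp).div_const r)
  have i1' := integrable_finsetSum _ i1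
  have i2 := (integrable_norm_sq nS.memLp).div_const r
  have i3 := (integrable_finsetSum _ hd).const_mul a
  have i12 : Integrable (fun ω => (∑ k ∈ Finset.range K,
      (inner ℝ (noiseL P D O ξ x y k ω) (lam k ω) + ‖noiseL P D O ξ x y k ω‖ ^ 2 / r))
      + ‖∑ k ∈ Finset.range K, noiseL P D O ξ x y k ω‖ ^ 2 / r) μ := i1'.add i2
  refine ⟨i12.sub i3, ?_⟩
  simp only [errL]
  rw [integral_sub i12 i3, integral_add i1' i2, integral_finsetSum _ i1, integral_const_mul,
    integral_finsetSum _ hd, integral_div]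
  have b1 : ∀ k ∈ Finset.range K, ∫ ω, (inner ℝ (noiseL P D O ξ x y k ω) (lam k ω)
      + ‖noiseL P D O ξ x y k ω‖ ^ 2 / r) ∂μ ≤ m * noiseLBound μ c x k / r := fun k hk => by
    have hk' := Finset.mem_range.1 hk
    rw [integral_add (integrable_inner_of_memLp (nL k hk').memLp (hS k hk'.le).lam_memLp)
      ((integrable_norm_sq (nL k hk').memLp).div_const r), (nL k hk').orth _
      ((hS k hk'.le).lam_meas.mono (hist_mono (by omega)) le_rfl) (hS k hk'.le).lam_memLp,
      integral_div, zero_add]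
    exact div_le_div_of_nonneg_right (nL k hk').sq_le hr.le
  have b2 := Finset.sum_le_sum b1
  have b3 := div_le_div_of_nonneg_right nS.sq_le hr.le
  rw [← Finset.mul_sum] at b3
  rw [← Finset.sum_div, ← Finset.mul_sum] at b2
  set S := ∑ k ∈ Finset.range K, ∫ ω, ‖x (k + 1) ω - x k ω‖ ^ 2 ∂μ with hSdef
  have hS0 : 0 ≤ S := Finset.sum_nonneg fun k _ => integral_nonneg fun _ => by positivity
  have b4 : m * (∑ k ∈ Finset.range K, noiseLBound μ c x k) / r
      ≤ m * (6 * c.sigG ^ 2 * K + 6 * c.sigDG ^ 2 * S) / r :=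
    div_le_div_of_nonneg_right (mul_le_mul_of_nonneg_left h.sum_noiseLBound_le
      (Nat.cast_nonneg m)) hr.le
  have b5 := mul_le_mul_of_nonneg_right ha hS0
  have b6 : m * (6 * c.sigG ^ 2 * K + 6 * c.sigDG ^ 2 * S) / r
      + m * (6 * c.sigG ^ 2 * K + 6 * c.sigDG ^ 2 * S) / r
      = K * (12 * m * c.sigG ^ 2 / r) + 12 * m * c.sigDG ^ 2 / r * S := by ring
  linarith

/-- Each of the three terms has expectation at most 5 K sigDG² / s, the first after its factor Dy²
cancels. -/
theorem SampledRun.integral_errY (h : SampledRun μ ν P D O c t s γ K x0 y0 ξ x y lam)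
    (hD : 0 < c.Dy) (i : Fin m) :
    Integrable (errY D O ξ x y y0 c.Dy s K i) μ ∧
      ∫ ω, errY D O ξ x y y0 c.Dy s K i ω ∂μ ≤ K * (15 * c.sigDG ^ 2 / s) := by
  have hS : ∀ k ≤ K, RunState μ ξ x y lam k := fun k hk => h.state hk
  have hs := h.s_pos
  have nY : ∀ k < K, CenteredNoise μ (hist ξ (6 * k)) (hist ξ (6 * (k + 1)))
      (noiseY D O ξ x y i k) (5 * c.sigDG ^ 2) := fun k hk =>
    (h.centered_noiseY hk (fun j hj => hS j (by omega)) i).mono le_rfl (hist_mono (by omega)) le_rfl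
  have nB : ∀ k < K, CenteredNoise μ (hist ξ (6 * k)) (hist ξ (6 * (k + 1)))
      (fun ω => inner ℝ (noiseY D O ξ x y i k ω) (y k ω i - y0 i))
      (c.Dy ^ 2 * (5 * c.sigDG ^ 2)) := fun k hk =>
    (nY k hk).inner_bounded (hist_mono (by omega)) (hist_le h.iid _)
      (((hS k hk.le).y_meas i).sub measurable_const)
      fun ω => h.conv.diam_Y i _ (h.y_mem hk.le ω i) _ (h.y0_mem i)
  have hmono : Monotone fun k => hist ξ (6 * k) := fun a b hab => hist_mono (by omega)
  have sY := CenteredNoise.sum hmono K nY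
  have sB := CenteredNoise.sum hmono K nB
  have i1 := (integrable_norm_sq sB.memLp).div_const (s * c.Dy ^ 2)
  have i2 := (integrable_norm_sq sY.memLp).div_const s
  have i3 : ∀ k ∈ Finset.range K, Integrable (fun ω => ‖noiseY D O ξ x y i k ω‖ ^ 2 / s) μ :=
    fun k hk => (integrable_norm_sq (nY k (Finset.mem_range.1 hk)).memLp).div_const s
  have i12 : Integrable (fun ω =>
      ‖∑ k ∈ Finset.range K, inner ℝ (noiseY D O ξ x y i k ω) (y k ω i - y0 i)‖ ^ 2
        / (s * c.Dy ^ 2) + ‖∑ k ∈ Finset.range K, noiseY D O ξ x y i k ω‖ ^ 2 / s) μ := i1.add i2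
  refine ⟨i12.add (integrable_finsetSum _ i3), ?_⟩
  simp only [errY]
  rw [integral_add i12 (integrable_finsetSum _ i3), integral_add i1 i2, integral_finsetSum _ i3,
    integral_div, integral_div]
  have b1 := div_le_div_of_nonneg_right sB.sq_le (by positivity : 0 ≤ s * c.Dy ^ 2)
  have b2 := div_le_div_of_nonneg_right sY.sq_le hs.le
  have b3 : ∑ k ∈ Finset.range K, ∫ ω, ‖noiseY D O ξ x y i k ω‖ ^ 2 / s ∂μ
      ≤ ∑ k ∈ Finset.range K, 5 * c.sigDG ^ 2 / s := Finset.sum_le_sum fun k hk => by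
    rw [integral_div]
    exact div_le_div_of_nonneg_right (nY k (Finset.mem_range.1 hk)).sq_le hs.le
  simp only [Finset.sum_const, Finset.card_range, nsmul_eq_mul] at b1 b2 b3
  have e1 : K * (c.Dy ^ 2 * (5 * c.sigDG ^ 2)) / (s * c.Dy ^ 2) = K * (5 * c.sigDG ^ 2 / s) := by
    field_simp
  have e2 : K * (5 * c.sigDG ^ 2) / s = K * (5 * c.sigDG ^ 2 / s) := by ring
  have e3 : K * (15 * c.sigDG ^ 2 / s) = 3 * (K * (5 * c.sigDG ^ 2 / s)) := by ring
  rw [e1] at b1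
  rw [e2] at b2
  rw [e3]
  linarith

end Expectation

/-! ### The gap bound, uniform in the comparison points -/

section Gap

variable {p q m : ℕ} {Ω Ξ : Type*} [mΩ : MeasurableSpace Ω] [mΞ : MeasurableSpace Ξ]
  {μ : Measure Ω} {ν : Measure Ξ} {P : Problem p q m} {D : Gradients p q m}
  {O : Oracle p q m Ξ} {c : Consts} {t s : ℝ} {γ : ℕ → ℝ} {K : ℕ} {x0 : Vec p}
  {y0 : Fin m → Vec q} {ξ : ℕ → Fin 6 → Ω → Ξ} {x : ℕ → Ω → Vec p} {y : ℕ → Ω → Fin m → Vec q}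
  {lam : ℕ → Ω → Vec m}

/-- The deterministic part of the bound on the cumulated gap. -/
noncomputable def gapConst (c : Consts) (R Λ t s κ : ℝ) (γ : ℕ → ℝ) (K : ℕ) : ℝ :=
  t / 2 * R ^ 2 + γ 0 / 2 * Λ ^ 2 + s * c.Dy ^ 2 * Λ + K * (2 * ((c.Hf + Λ * c.Hx) ^ 2 / t))
    + Λ * ((K + 1) * (7 / 2 * (c.Hy ^ 2 / s))) + 2 * κ / 15 * K * Λ ^ 2 + γ K / 4 * Λ ^ 2

/-- The stochastic part of the bound on the cumulated gap. -/
noncomputable def gapNoise (P : Problem p q m) (D : Gradients p q m) (O : Oracle p q m Ξ)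
    (c : Consts) (ξ : ℕ → Fin 6 → Ω → Ξ) (x : ℕ → Ω → Vec p) (y : ℕ → Ω → Fin m → Vec q)
    (lam : ℕ → Ω → Vec m) (xs : Vec p) (y0 : Fin m → Vec q) (Λ t s κ r : ℝ) (K : ℕ) (ω : Ω) : ℝ :=
  (∑ k ∈ Finset.range K, errX D O ξ x y lam xs t (κ / 15) k ω)
    + errL P D O ξ x y lam r (c.sigDG / 2) K ω + Λ * ∑ i, errY D O ξ x y y0 c.Dy s K i ω

theorem errY_nonneg {d : ℝ} (hs : 0 < s) (i : Fin m) (ω : Ω) :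
    0 ≤ errY D O ξ x y y0 d s K i ω := by
  have : 0 ≤ ∑ k ∈ Finset.range K, ‖noiseY D O ξ x y i k ω‖ ^ 2 / s :=
    Finset.sum_nonneg fun k _ => by positivity
  unfold errY
  positivity

/-- The point v may depend on ω, so the pairing is anchored at the deterministic y0: against y k -
y0 the noise is a martingale, and y0 - v is detached by Young. The martingale too is bounded by its
square, since it will be multiplied by a random l i; each of the two splits costs s Dy² / 4. -/
theorem SampledRun.sum_noiseY_le (h : SampledRun μ ν P D O c t s γ K x0 y0 ξ x y lam)
    (hD : 0 < c.Dy) (i : Fin m) (ω : Ω) {v : Vec q} (hv : v ∈ P.Y i) :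
    ∑ k ∈ Finset.range K,
        (inner ℝ (noiseY D O ξ x y i k ω) (y k ω i - v) + ‖noiseY D O ξ x y i k ω‖ ^ 2 / s)
      ≤ errY D O ξ x y y0 c.Dy s K i ω + s * c.Dy ^ 2 / 2 := by
  have hs := h.s_pos
  have e : ∑ k ∈ Finset.range K, inner ℝ (noiseY D O ξ x y i k ω) (y k ω i - v)
      = (∑ k ∈ Finset.range K, inner ℝ (noiseY D O ξ x y i k ω) (y k ω i - y0 i))
        + inner ℝ (∑ k ∈ Finset.range K, noiseY D O ξ x y i k ω) (y0 i - v) := by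
    rw [sum_inner, ← Finset.sum_add_distrib]
    refine Finset.sum_congr rfl fun k _ => ?_
    rw [← inner_add_right]; congr 1; abel
  have h1 := real_inner_le_of_pos hs (∑ k ∈ Finset.range K, noiseY D O ξ x y i k ω) (y0 i - v)
  have h2 := mul_le_of_pos (show 0 < s * c.Dy ^ 2 by positivity)
    (∑ k ∈ Finset.range K, inner ℝ (noiseY D O ξ x y i k ω) (y k ω i - y0 i)) 1
  have h3 : ‖y0 i - v‖ ^ 2 ≤ c.Dy ^ 2 :=
    pow_le_pow_left₀ (norm_nonneg _) (h.conv.diam_Y i _ (h.y0_mem i) _ hv) 2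
  have h4 := mul_le_mul_of_nonneg_left h3 (by positivity : 0 ≤ s / 4)
  rw [Finset.sum_add_distrib, e]
  unfold errY
  rw [Real.norm_eq_abs, sq_abs]
  linarith

/-- Removes l and yh from the right side of the path estimate. Only the bound Λ on the sum of the
multipliers and the diameter Dy survive, so the estimate may be applied with comparison points
chosen after the path. -/
theorem SampledRun.gap_le (h : SampledRun μ ν P D O c t s γ K x0 y0 ξ x y lam) {xs : Vec p}
    (hxs : P.Feasible xs) (hD : 0 < c.Dy) {κ : ℝ} (hκ : 0 ≤ κ) (hstep : ∀ k, γ k = γ (k + 1) + κ)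
    (hγ : 0 < γ K) (hγM : 60 * m * c.Mx ^ 2 ≤ γ K) (ht1 : 4 * (c.Lf + 1 + c.sigDG) ≤ t)
    {Λ : ℝ} (ht2 : 8 * (c.Lyx + c.Lxx) * Λ ≤ t) (hs1 : 14 * c.Lyx ≤ s) (hs2 : 7 * c.Lyy ≤ s)
    (ω : Ω) {l : Vec m} (hl : ∀ i, 0 ≤ l i) (hlΛ : ∑ i, l i ≤ Λ) {yh : Fin m → Vec q}
    (hyh : ∀ i, yh i ∈ P.Y i) :
    ∑ k ∈ Finset.range K, (P.f (x (k + 1) ω) - P.f xs + ∑ i, l i * P.g i (x (k + 1) ω) (yh i))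
      ≤ gapConst c ‖xs - x0‖ Λ t s κ γ K + gapNoise P D O c ξ x y lam xs y0 Λ t s κ (γ K) K ω := by
  have hn := h.nonneg
  have hs := h.s_pos
  have ht : 0 < t := by linarith [hn.Lf, hn.sigDG]
  have hγ0 : 0 < γ 0 := hγ.trans_le
    ((antitone_nat_of_succ_le fun k => by rw [hstep k]; linarith : Antitone γ) (Nat.zero_le K))
  have hL0 : 0 ≤ ∑ i, l i := Finset.sum_nonneg fun i _ => hl i
  have hΛ0 := hL0.trans hlΛ
  have ht2' : 8 * (c.Lyx + c.Lxx) * (∑ i, l i) ≤ t :=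
    (mul_le_mul_of_nonneg_left hlΛ (by linarith [hn.Lyx, hn.Lxx])).trans ht2
  have key := (h.path ω).gap_sum hn h.smooth h.grad hxs hl hyh h.conv.diam_Y ht1 ht2' hs hs1 hs2 hκ
    hstep hγ hγM
  refine key.trans ?_
  have hlnorm : ‖l‖ ^ 2 ≤ Λ ^ 2 := by
    refine pow_le_pow_left₀ (norm_nonneg _) ((norm_le_sum_abs l).trans ?_) 2
    simpa only [abs_of_nonneg (hl _)] using hlΛ
  have b1 := mul_le_mul_of_nonneg_left hlnorm (by linarith : 0 ≤ γ 0 / 2)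
  have b2 := mul_le_mul_of_nonneg_left hlΛ (by positivity : 0 ≤ s / 2 * c.Dy ^ 2)
  have b3 : (c.Hf + (∑ i, l i) * c.Hx) ^ 2 / t ≤ (c.Hf + Λ * c.Hx) ^ 2 / t := by
    refine div_le_div_of_nonneg_right (pow_le_pow_left₀ ?_ ?_ 2) ht.le
    · have := mul_nonneg hL0 hn.Hx
      linarith [hn.Hf]
    · linarith [mul_le_mul_of_nonneg_right hlΛ hn.Hx]
  have b3' := mul_le_mul_of_nonneg_left b3 (by positivity : 0 ≤ (K : ℝ) * 2)
  have b4 := mul_le_mul_of_nonneg_right hlΛ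
    (by positivity : 0 ≤ ((K : ℝ) + 1) * (7 / 2 * (c.Hy ^ 2 / s)))
  have b5 : ∑ k ∈ Finset.range K,
        (inner ℝ (noiseL P D O ξ x y k ω) (lam k ω - l) + ‖noiseL P D O ξ x y k ω‖ ^ 2 / γ K)
      ≤ (∑ k ∈ Finset.range K,
          (inner ℝ (noiseL P D O ξ x y k ω) (lam k ω) + ‖noiseL P D O ξ x y k ω‖ ^ 2 / γ K))
        + ‖∑ k ∈ Finset.range K, noiseL P D O ξ x y k ω‖ ^ 2 / γ K + γ K / 4 * Λ ^ 2 := by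
    have e1 := real_inner_le_of_pos hγ (∑ k ∈ Finset.range K, noiseL P D O ξ x y k ω) (-l)
    have e2 := mul_le_mul_of_nonneg_left hlnorm (by linarith : 0 ≤ γ K / 4)
    rw [norm_neg, inner_neg_right, sum_inner] at e1
    simp only [inner_sub_right, Finset.sum_add_distrib, Finset.sum_sub_distrib]
    linarith
  -- From ‖lam‖² ≤ 2 ‖l - lam‖² + 2 Λ², multiplied by κ / 15, which is affordable since 2 / 15 ≤ 1 /
  -- 2. The fraction κ / 15 is what the x-noise needs.
  have b6 : - (κ / 2) * ∑ k ∈ Finset.range K, ‖l - lam (k + 1) ω‖ ^ 2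
      ≤ - (κ / 15) * ∑ k ∈ Finset.range K, ‖lam (k + 1) ω‖ ^ 2 + 2 * κ / 15 * K * Λ ^ 2 := by
    have e1 : ∀ k ∈ Finset.range K, ‖lam (k + 1) ω‖ ^ 2 ≤ 2 * ‖l - lam (k + 1) ω‖ ^ 2 + 2 * Λ ^ 2 :=
      fun k _ => by
        have e2 := norm_sub_le l (l - lam (k + 1) ω)
        rw [sub_sub_cancel] at e2
        have e3 := pow_le_pow_left₀ (norm_nonneg _) e2 2
        nlinarith [sq_nonneg (‖l‖ - ‖l - lam (k + 1) ω‖)]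
    have e4 := Finset.sum_le_sum e1
    rw [Finset.sum_add_distrib, ← Finset.mul_sum, Finset.sum_const, Finset.card_range,
      nsmul_eq_mul] at e4
    have e5 := mul_le_mul_of_nonneg_left e4 (by positivity : 0 ≤ κ / 15)
    have e6 : 0 ≤ κ * ∑ k ∈ Finset.range K, ‖l - lam (k + 1) ω‖ ^ 2 :=
      mul_nonneg hκ (Finset.sum_nonneg fun _ _ => by positivity)
    linarith
  have b7 : ∑ i, l i * ∑ k ∈ Finset.range K,
      (inner ℝ (noiseY D O ξ x y i k ω) (y k ω i - yh i) + ‖noiseY D O ξ x y i k ω‖ ^ 2 / s)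
      ≤ Λ * (∑ i, errY D O ξ x y y0 c.Dy s K i ω) + s * c.Dy ^ 2 / 2 * Λ := by
    have e1 : ∀ i ∈ Finset.univ, l i * ∑ k ∈ Finset.range K,
        (inner ℝ (noiseY D O ξ x y i k ω) (y k ω i - yh i) + ‖noiseY D O ξ x y i k ω‖ ^ 2 / s)
        ≤ Λ * errY D O ξ x y y0 c.Dy s K i ω + l i * (s * c.Dy ^ 2 / 2) := fun i hi => by
      have e2 := mul_le_mul_of_nonneg_left (h.sum_noiseY_le hD i ω (hyh i)) (hl i)
      -- Replacing l i by Λ is legitimate because `errY` is a sum of squares.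
      have e3 := mul_le_mul_of_nonneg_right
        ((Finset.single_le_sum (fun j _ => hl j) hi).trans hlΛ)
        (errY_nonneg (D := D) (O := O) (ξ := ξ) (x := x) (y := y) (y0 := y0) (K := K) (d := c.Dy)
          hs i ω)
      linarith
    refine (Finset.sum_le_sum e1).trans ?_
    rw [Finset.sum_add_distrib, ← Finset.mul_sum, ← Finset.sum_mul]
    have e4 := mul_le_mul_of_nonneg_right hlΛ (by positivity : 0 ≤ s * c.Dy ^ 2 / 2)
    linarith
  have e8 : ∑ k ∈ Finset.range K, errX D O ξ x y lam xs t (κ / 15) k ω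
      = ∑ k ∈ Finset.range K,
          (inner ℝ (noiseF D O ξ x k ω + ∑ i, noiseZ D O ξ x y lam i k ω) (xs - x k ω)
            + 2 * (‖noiseF D O ξ x k ω‖ ^ 2 / t)
            + 4 * (‖∑ i, noiseZ D O ξ x y lam i k ω‖ ^ 2 / t))
        - κ / 15 * ∑ k ∈ Finset.range K, ‖lam (k + 1) ω‖ ^ 2 := by
    rw [Finset.mul_sum, ← Finset.sum_sub_distrib]; rfl
  simp only [gapConst, gapNoise, errL, e8, h.run.x_zero ω]
  linarith

theorem SampledRun.integral_gapNoise [IsProbabilityMeasure μ] [IsProbabilityMeasure ν]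
    (h : SampledRun μ ν P D O c t s γ K x0 y0 ξ x y lam) (xs : Vec p) (hD : 0 < c.Dy) {κ r Λ : ℝ}
    (hΛ : 0 ≤ Λ) (hr : 0 < r) (h1 : 4 * m * c.sigDG ^ 2 / t ≤ κ / 15)
    (h2 : 12 * m * c.sigDG ^ 2 / r ≤ c.sigDG / 2) :
    Integrable (gapNoise P D O c ξ x y lam xs y0 Λ t s κ r K) μ ∧
      ∫ ω, gapNoise P D O c ξ x y lam xs y0 Λ t s κ r K ω ∂μ
        ≤ K * (2 * (c.sigF ^ 2 / t) + 12 * m * c.sigG ^ 2 / r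
          + Λ * (m * (15 * c.sigDG ^ 2 / s))) := by
  have hX : ∀ k ∈ Finset.range K, Integrable (errX D O ξ x y lam xs t (κ / 15) k) μ ∧
      ∫ ω, errX D O ξ x y lam xs t (κ / 15) k ω ∂μ ≤ 2 * (c.sigF ^ 2 / t) := fun k hk =>
    h.integral_errX h1 (Finset.mem_range.1 hk)
  have hL := h.integral_errL hr h2
  have hY := h.integral_errY hD
  have iX := integrable_finsetSum _ fun k hk => (hX k hk).1
  have iY := (integrable_finsetSum Finset.univ fun i _ => (hY i).1).const_mul Λ
  have iXL : Integrable (fun ω => (∑ k ∈ Finset.range K, errX D O ξ x y lam xs t (κ / 15) k ω)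
    + errL P D O ξ x y lam r (c.sigDG / 2) K ω) μ := iX.add hL.1
  refine ⟨iXL.add iY, ?_⟩
  simp only [gapNoise]
  rw [integral_add iXL iY, integral_add iX hL.1, integral_const_mul,
    integral_finsetSum _ fun k hk => (hX k hk).1, integral_finsetSum _ fun i _ => (hY i).1]
  have b1 := Finset.sum_le_sum fun k hk => (hX k hk).2
  have b2 := Finset.sum_le_sum fun i (_ : i ∈ Finset.univ) => (hY i).2
  have b3 := mul_le_mul_of_nonneg_left b2 hΛ
  simp only [Finset.sum_const, Finset.card_range, Finset.card_univ, Fintype.card_fin,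
    nsmul_eq_mul] at b1 b3
  linarith [hL.2]

end Gap

/-! ### The averaged point: convexity, violation, integrability -/

section Output

variable {p q m : ℕ} {Ω Ξ : Type*} [mΩ : MeasurableSpace Ω] [mΞ : MeasurableSpace Ξ]
  {μ : Measure Ω} {ν : Measure Ξ} {P : Problem p q m} {D : Gradients p q m}
  {O : Oracle p q m Ξ} {c : Consts} {t s : ℝ} {γ : ℕ → ℝ} {K : ℕ} {x0 : Vec p}
  {y0 : Fin m → Vec q} {ξ : ℕ → Fin 6 → Ω → Ξ} {x : ℕ → Ω → Vec p} {y : ℕ → Ω → Fin m → Vec q}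
  {lam : ℕ → Ω → Vec m}

theorem exists_eq_gStar (hP : P.ConvexCompact c.Dy) {i : Fin m} (hne : (P.Y i).Nonempty)
    {u : Vec p} (hu : u ∈ P.X) :
    ∃ v ∈ P.Y i, P.g i u v = P.gStar i u ∧ ∀ w ∈ P.Y i, P.g i u w ≤ P.g i u v := by
  have hb : Bornology.IsBounded (P.Y i) :=
    Metric.isBounded_iff.2 ⟨c.Dy, fun v hv w hw => by
      rw [dist_eq_norm]; exact hP.diam_Y i v hv w hw⟩
  have hcomp := Metric.isCompact_of_isClosed_isBounded (hP.closed_Y i) hb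
  have hcont : ContinuousOn (fun v => P.g i u v) (P.Y i) :=
    (hP.continuous_g i).comp (f := fun v => (u, v)) (by fun_prop) fun v hv => ⟨hu, hv⟩
  obtain ⟨v, hv, h1, h2⟩ := hcomp.exists_sSup_image_eq_and_ge hne hcont
  exact ⟨v, hv, h1.symm, h2⟩

theorem gStar_le_add (hP : P.ConvexCompact c.Dy) (hsm : SmoothLipschitz P D c) {i : Fin m}
    (hne : (P.Y i).Nonempty) {u u' : Vec p} (hu : u ∈ P.X) (hu' : u' ∈ P.X) :
    P.gStar i u ≤ P.gStar i u' + c.Mx * ‖u - u'‖ := by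
  obtain ⟨v, hv, h1, -⟩ := exists_eq_gStar hP hne hu
  obtain ⟨v', -, h1', h2'⟩ := exists_eq_gStar hP hne hu'
  have h3 := (abs_le.1 (abs_g_sub_le hsm hu hu' hv)).2
  rw [← h1, ← h1']
  linarith [h2' v hv]

theorem continuousOn_violation (hP : P.ConvexCompact c.Dy) (hsm : SmoothLipschitz P D c)
    (hM : 0 ≤ c.Mx) (hne : ∀ i, (P.Y i).Nonempty) : ContinuousOn P.violation P.X := by
  refine ContinuousOn.norm (continuousOn_pi.2 fun i => ContinuousOn.sup ?_ continuousOn_const)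
  refine LipschitzOnWith.continuousOn (K := ⟨c.Mx, hM⟩)
    (LipschitzOnWith.of_dist_le_mul fun u hu u' hu' => ?_)
  rw [Real.dist_eq, dist_eq_norm, abs_le]
  have h1 := gStar_le_add hP hsm (hne i) hu hu'
  have h2 := gStar_le_add hP hsm (hne i) hu' hu
  rw [norm_sub_rev] at h2
  change -(c.Mx * ‖u - u'‖) ≤ _ ∧ _ ≤ c.Mx * ‖u - u'‖
  constructor <;> linarith

theorem violation_le (hP : P.ConvexCompact c.Dy) (hsm : SmoothLipschitz P D c)
    (hM : 0 ≤ c.Mx) (hne : ∀ i, (P.Y i).Nonempty) {xs u : Vec p} (hxs : P.Feasible xs)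
    (hu : u ∈ P.X) : P.violation u ≤ c.Mx * ‖u - xs‖ := by
  have h0 : 0 ≤ c.Mx * ‖u - xs‖ := mul_nonneg hM (norm_nonneg _)
  refine (pi_norm_le_iff_of_nonneg h0).2 fun i => ?_
  rw [Real.norm_of_nonneg (le_max_right _ _)]
  refine max_le ?_ h0
  obtain ⟨v, hv, h1, -⟩ := exists_eq_gStar hP (hne i) hxs.1
  linarith [gStar_le_add hP hsm (hne i) hu hxs.1, hxs.2 i v hv]

/-- Continuity is available only on X, so the composition is taken through the subtype. -/
theorem measurable_comp_of_continuousOn {n : ℕ} {X : Set (Vec n)} {F : Vec n → ℝ}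
    (hF : ContinuousOn F X) {u : Ω → Vec n} (hu : Measurable u) (huX : ∀ ω, u ω ∈ X) :
    Measurable fun ω => F (u ω) :=
  (continuousOn_iff_continuous_domRestrict.1 hF).measurable.comp (hu.subtype_mk (h := huX))

theorem average_one (K : ℕ) (x : ℕ → Ω → Vec p) (ω : Ω) :
    average (fun _ => 1) K x ω = ∑ k ∈ Finset.range K, (K : ℝ)⁻¹ • x (k + 1) ω := by
  simp [average, Finset.smul_sum]

theorem sum_inv_range (hK : 0 < K) : ∑ _k ∈ Finset.range K, (K : ℝ)⁻¹ = 1 := by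
  have : (K : ℝ) ≠ 0 := by positivity
  simp [this]

theorem average_mem (hK : 0 < K) (hX : Convex ℝ P.X) {ω : Ω} (hx : ∀ k < K, x (k + 1) ω ∈ P.X) :
    average (fun _ => 1) K x ω ∈ P.X := by
  rw [average_one]
  exact hX.sum_mem (fun _ _ => by positivity) (sum_inv_range hK)
    fun k hk => hx k (Finset.mem_range.1 hk)

theorem map_average_le (hK : 0 < K) {F : Vec p → ℝ} (hF : ConvexOn ℝ P.X F) {ω : Ω}
    (hx : ∀ k < K, x (k + 1) ω ∈ P.X) :
    K * F (average (fun _ => 1) K x ω) ≤ ∑ k ∈ Finset.range K, F (x (k + 1) ω) := by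
  have hK' : (K : ℝ) ≠ 0 := by positivity
  have h := hF.map_sum_le (t := Finset.range K) (w := fun _ => (K : ℝ)⁻¹)
    (p := fun k => x (k + 1) ω) (fun _ _ => by positivity) (sum_inv_range hK)
    fun k hk => hx k (Finset.mem_range.1 hk)
  rw [← average_one] at h
  simp only [smul_eq_mul, ← Finset.mul_sum] at h
  have h2 := mul_le_mul_of_nonneg_left h (by positivity : 0 ≤ (K : ℝ))
  rwa [mul_inv_cancel_left₀ hK'] at h2

theorem gap_average_le (hK : 0 < K) (hP : P.ConvexCompact c.Dy) {ω : Ω}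
    (hx : ∀ k < K, x (k + 1) ω ∈ P.X) {l : Fin m → ℝ} (hl : ∀ i, 0 ≤ l i) {yh : Fin m → Vec q}
    (hyh : ∀ i, yh i ∈ P.Y i) (a : ℝ) :
    K * (P.f (average (fun _ => 1) K x ω) - a
        + ∑ i, l i * P.g i (average (fun _ => 1) K x ω) (yh i))
      ≤ ∑ k ∈ Finset.range K, (P.f (x (k + 1) ω) - a + ∑ i, l i * P.g i (x (k + 1) ω) (yh i)) := by
  have h1 := map_average_le hK hP.convex_f hx
  have h2 : K * ∑ i, l i * P.g i (average (fun _ => 1) K x ω) (yh i)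
      ≤ ∑ k ∈ Finset.range K, ∑ i, l i * P.g i (x (k + 1) ω) (yh i) := by
    rw [Finset.sum_comm, Finset.mul_sum]
    refine Finset.sum_le_sum fun i _ => ?_
    rw [← Finset.mul_sum, mul_left_comm]
    exact mul_le_mul_of_nonneg_left (map_average_le hK (hP.convex_g i _ (hyh i)) hx) (hl i)
  rw [Finset.sum_add_distrib, Finset.sum_sub_distrib, Finset.sum_const, Finset.card_range,
    nsmul_eq_mul]
  linarith

/-- A bound on all gap functions with multipliers of norm at most `∑ i, |ls i| + 1` is a bound on
the constraint violation. -/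
theorem violation_average_le (hK : 0 < K) (hP : P.ConvexCompact c.Dy)
    (hne : ∀ i, (P.Y i).Nonempty) {xs : Vec p} {ls : Fin m → ℝ} (hls : P.IsMultiplier xs ls)
    {ω : Ω} (hx : ∀ k < K, x (k + 1) ω ∈ P.X) {B : ℝ}
    (hB : ∀ (l : Vec m) (yh : Fin m → Vec q), (∀ i, 0 ≤ l i) → ∑ i, l i ≤ ∑ i, |ls i| + 1 →
      (∀ i, yh i ∈ P.Y i) → ∑ k ∈ Finset.range K,
        (P.f (x (k + 1) ω) - P.f xs + ∑ i, l i * P.g i (x (k + 1) ω) (yh i)) ≤ B) :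
    K * P.violation (average (fun _ => 1) K x ω) ≤ B := by
  have hK' : (0 : ℝ) < K := by positivity
  have hav := average_mem hK hP.convex_X hx
  -- The comparison points are maximisers at the average belonging to this ω, which turns g into
  -- `gStar`.
  choose yh hyh hyg _ using fun i => exists_eq_gStar hP (hne i) hav
  have hs : ∑ i, |ls i| = ∑ i, ls i :=
    Finset.sum_congr rfl fun i _ => abs_of_nonneg (hls.nonneg i)
  have hlag : 0 ≤ P.f (average (fun _ => 1) K x ω) - P.f xs
      + ∑ i, ls i * P.gStar i (average (fun _ => 1) K x ω) := by
    have h1 := hls.minimizes hav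
    simp only [Set.mem_ofPred_eq, hls.complementary, Finset.sum_const_zero, add_zero] at h1
    linarith
  have key : ∀ l : Fin m → ℝ, (∀ i, 0 ≤ l i) → ∑ i, l i ≤ ∑ i, |ls i| + 1 →
      K * (P.f (average (fun _ => 1) K x ω) - P.f xs
        + ∑ i, l i * P.gStar i (average (fun _ => 1) K x ω)) ≤ B := fun l hl hl1 => by
    have h1 := gap_average_le hK hP hx hl hyh (P.f xs)
    simp only [hyg] at h1
    exact h1.trans (hB (WithLp.toLp 2 l) yh hl hl1 hyh)
  -- Taking l = ls gives B ≥ 0, which settles the constraints whose positive part is zero.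
  have hB0 : 0 ≤ B := (mul_nonneg hK'.le hlag).trans (key ls hls.nonneg (by linarith))
  rw [mul_comm, ← le_div_iff₀ hK']
  refine (pi_norm_le_iff_of_nonneg (by positivity)).2 fun j => ?_
  rw [Real.norm_of_nonneg (le_max_right _ _)]
  refine max_le ?_ (by positivity)
  rw [le_div_iff₀ hK', mul_comm]
  -- Raising the j-th multiplier by one adds `gStar j` to a Lagrangian gap that is already
  -- nonnegative; the one in Λ makes room for it.
  have h2 := key (fun i => ls i + if i = j then 1 else 0)
    (fun i => add_nonneg (hls.nonneg i) (by split_ifs <;> norm_num))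
    (by rw [Finset.sum_add_distrib]; simp [hs])
  simp only [add_mul, Finset.sum_add_distrib, ite_mul, one_mul, zero_mul, Finset.sum_ite_eq',
    Finset.mem_univ, if_true] at h2
  nlinarith [mul_nonneg hK'.le hlag]

variable [IsProbabilityMeasure μ] [IsProbabilityMeasure ν]

theorem SampledRun.memLp_average (h : SampledRun μ ν P D O c t s γ K x0 y0 ξ x y lam) :
    Measurable (fun ω => average (fun _ => 1) K x ω) ∧
      MemLp (fun ω => average (fun _ => 1) K x ω) 2 μ := by
  simp only [average_one]
  refine ⟨Finset.measurable_sum _ fun k hk => ?_, memLp_finsetSum _ fun k hk => ?_⟩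
  · have hm : Measurable (x (k + 1)) :=
      (h.state (Finset.mem_range.1 hk)).x_meas.mono (hist_le h.iid _) le_rfl
    exact hm.const_smul (K : ℝ)⁻¹
  have hk' : MemLp (x (k + 1)) 2 μ := (h.state (Finset.mem_range.1 hk)).x_memLp
  exact hk'.const_smul (K : ℝ)⁻¹

/-- The subgradient inequality and the upper model at xs enclose the difference between functions of
at most quadratic growth, and the average is square-integrable. -/
theorem SampledRun.integrable_objective (h : SampledRun μ ν P D O c t s γ K x0 y0 ξ x y lam)
    (hK : 0 < K) {xs : Vec p} (hxs : xs ∈ P.X) :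
    Integrable (fun ω => P.f (average (fun _ => 1) K x ω) - P.f xs) μ := by
  obtain ⟨hm, hL⟩ := h.memLp_average
  have hmem : ∀ ω, average (fun _ => 1) K x ω ∈ P.X := fun ω =>
    average_mem hK h.conv.convex_X fun k hk => h.x_mem (k := k + 1) hk ω
  have hd : MemLp (fun ω => average (fun _ => 1) K x ω - xs) 2 μ := hL.sub (memLp_const xs)
  have i1 : Integrable (fun ω => ‖average (fun _ => 1) K x ω - xs‖) μ :=
    (hd.integrable one_le_two).norm
  have i2 := integrable_norm_sq hd
  refine ((i1.const_mul (‖D.gradf xs‖ + c.Hf)).add (i2.const_mul (c.Lf / 2))).mono'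
    ((measurable_comp_of_continuousOn h.conv.continuous_f hm hmem).sub
      measurable_const).aestronglyMeasurable (Filter.Eventually.of_forall fun ω => ?_)
  have h1 := h.smooth.f_upper _ (hmem ω) _ hxs
  have h2 := h.grad.f _ (hmem ω) _ hxs
  have h3 := abs_le.1 (abs_real_inner_le_norm (D.gradf xs) (average (fun _ => 1) K x ω - xs))
  have h4 := mul_nonneg h.nonneg.Hf (norm_nonneg (average (fun _ => 1) K x ω - xs))
  have h5 := mul_nonneg h.nonneg.Lf (sq_nonneg ‖average (fun _ => 1) K x ω - xs‖)
  simp only [Pi.add_apply]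
  rw [Real.norm_eq_abs, abs_le]
  constructor <;> linarith

theorem SampledRun.integrable_violation (h : SampledRun μ ν P D O c t s γ K x0 y0 ξ x y lam)
    (hK : 0 < K) {xs : Vec p} (hxs : P.Feasible xs) :
    Integrable (fun ω => P.violation (average (fun _ => 1) K x ω)) μ := by
  obtain ⟨hm, hL⟩ := h.memLp_average
  have hmem : ∀ ω, average (fun _ => 1) K x ω ∈ P.X := fun ω =>
    average_mem hK h.conv.convex_X fun k hk => h.x_mem (k := k + 1) hk ω
  have hne : ∀ i, (P.Y i).Nonempty := fun i => ⟨y0 i, h.y0_mem i⟩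
  have hd : MemLp (fun ω => average (fun _ => 1) K x ω - xs) 2 μ := hL.sub (memLp_const xs)
  refine (((hd.integrable one_le_two).norm).const_mul c.Mx).mono'
    (measurable_comp_of_continuousOn (continuousOn_violation h.conv h.smooth h.nonneg.Mx hne)
      hm hmem).aestronglyMeasurable (Filter.Eventually.of_forall fun ω => ?_)
  have hv : 0 ≤ P.violation (average (fun _ => 1) K x ω) := norm_nonneg _
  rw [Real.norm_of_nonneg hv]
  exact violation_le h.conv h.smooth h.nonneg.Mx hne hxs (hmem ω)

end Output

/-! ### Arithmetic of the step sizes -/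

section Schedule

variable {c : Consts} {m K : ℕ} {a b R Λ : ℝ}

/-- Turns a variance over a step parameter into a standard deviation over √K: the parameters
dominate each standard deviation times √K. -/
theorem sq_div_le_div {X r t : ℝ} (hX : 0 ≤ X) (hr : 0 < r) (ht : 0 < t) (h : X * r ≤ t) :
    X ^ 2 / t ≤ X / r := by
  rw [div_le_div_iff₀ ht hr]
  nlinarith [mul_le_mul_of_nonneg_left h hX]

theorem gammaStep_eq_succ_add (k : ℕ) :
    gammaStep c m K k = gammaStep c m K (k + 1) + 60 * m * c.sigDG / √(K : ℝ) := by
  simp only [gammaStep]; push_cast; ring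

theorem gammaStep_last : gammaStep c m K K = 60 * m * c.Mx ^ 2 + 60 * m * c.sigDG * √(K : ℝ) := by
  rw [gammaStep, show (2 * (K : ℝ) - K) = K by ring, mul_div_assoc, Real.div_sqrt]

theorem gammaStep_zero :
    gammaStep c m K 0 = 60 * m * c.Mx ^ 2 + 120 * m * c.sigDG * √(K : ℝ) := by
  rw [gammaStep, Nat.cast_zero, sub_zero, mul_div_assoc, mul_div_assoc, Real.div_sqrt]; ring

/-- The analysis divides by the value at k = K, which no step uses. It is the mean of the value at 0
and 60 m Mx², hence positive. -/
theorem gammaStep_last_pos (hM : 0 ≤ 60 * m * c.Mx ^ 2) (h0 : 0 < gammaStep c m K 0) :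
    0 < gammaStep c m K K := by
  rw [gammaStep_zero] at h0
  rw [gammaStep_last]
  linarith

theorem noise_ratio_le (hc : c.Nonneg) (hsig : c.sigDG = 0 → c.sigG = 0) (hK : 0 < K)
    (hγ : 0 < gammaStep c m K K) :
    12 * m * c.sigG ^ 2 / gammaStep c m K K ≤ c.sigG ^ 2 / (2 * c.sigDG * √(K : ℝ)) := by
  have hr : 0 < √(K : ℝ) := Real.sqrt_pos.2 (by positivity)
  rcases hc.sigDG.eq_or_lt with h0 | h0
  -- Without gradient noise both sides are zero, the right one by the convention for division by
  -- zero.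
  · simp [hsig h0.symm]
  rw [div_le_div_iff₀ hγ (by positivity), gammaStep_last]
  have h1 : 0 ≤ c.sigG ^ 2 * (60 * m * c.Mx ^ 2) := by positivity
  have h2 : 0 ≤ m * c.sigG ^ 2 * c.sigDG * √(K : ℝ) := by positivity
  linarith

theorem sqrt_step_le (hR : √(c.Hx ^ 2 * Λ ^ 2 + c.Hf ^ 2 + c.sigDG ^ 2 * Λ + c.sigF ^ 2) ≤ b)
    {X : ℝ} (hX : X ^ 2 ≤ c.Hx ^ 2 * Λ ^ 2 + c.Hf ^ 2 + c.sigDG ^ 2 * Λ + c.sigF ^ 2) :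
    X * √(K : ℝ) ≤ tauStep a b K := by
  have h1 : X ≤ b := (Real.le_sqrt_of_sq_le hX).trans hR
  exact (mul_le_mul_of_nonneg_right h1 (Real.sqrt_nonneg _)).trans (le_max_right _ _)

theorem tauStep_le (ha : 0 ≤ a) (hb : 0 ≤ b) : tauStep a b K ≤ a + b * √(K : ℝ) :=
  max_le (by linarith [mul_nonneg hb (Real.sqrt_nonneg (K : ℝ))]) (by linarith)

theorem tau_term_le (ha : 0 ≤ a) (hb : 0 ≤ b) (hK : 0 < K) :
    tauStep a b K / 2 * R ^ 2 ≤ K * (a * R ^ 2 / (2 * K) + b * R ^ 2 / (2 * √(K : ℝ))) := by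
  have hK' : (0 : ℝ) < K := by positivity
  have hr : 0 < √(K : ℝ) := Real.sqrt_pos.2 hK'
  have h1 := mul_le_mul_of_nonneg_right (tauStep_le (K := K) ha hb) (sq_nonneg R)
  have h2 : K * (a * R ^ 2 / (2 * K) + b * R ^ 2 / (2 * √(K : ℝ)))
      = (a + b * √(K : ℝ)) * R ^ 2 / 2 := by
    have h3 : (K : ℝ) = √(K : ℝ) * √(K : ℝ) := (Real.mul_self_sqrt hK'.le).symm
    rw [mul_add]
    have e1 : K * (a * R ^ 2 / (2 * K)) = a * R ^ 2 / 2 := by field_simp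
    have e2 : K * (b * R ^ 2 / (2 * √(K : ℝ))) = b * √(K : ℝ) * R ^ 2 / 2 := by
      rw [show (K : ℝ) * (b * R ^ 2 / (2 * √(K : ℝ))) = (K / √(K : ℝ)) * (b * R ^ 2 / 2) by
        field_simp, Real.div_sqrt]
      ring
    rw [e1, e2]; ring
  rw [h2]
  linarith

/-- With multiplier bound zero only the x-terms and the value noise survive. The Λ that remains in
the hypothesis on b is the true one; the condition is stronger than needed here. -/
theorem gapConst_zero_le (hc : c.Nonneg) (ha : 0 ≤ a) (ht : 0 < tauStep a b K) (hK : 0 < K)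
    (hsig : c.sigDG = 0 → c.sigG = 0) (hγ : 0 < gammaStep c m K K) (hΛ : 0 ≤ Λ)
    (hb : √(c.Hx ^ 2 * Λ ^ 2 + c.Hf ^ 2 + c.sigDG ^ 2 * Λ + c.sigF ^ 2) ≤ b) {s κ : ℝ} :
    gapConst c R 0 (tauStep a b K) s κ (gammaStep c m K) K
      + K * (2 * (c.sigF ^ 2 / tauStep a b K) + 12 * m * c.sigG ^ 2 / gammaStep c m K K
        + 0 * (m * (15 * c.sigDG ^ 2 / s))) ≤ K * objBound c R a b K := by
  have hK' : (0 : ℝ) < K := by positivity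
  have hr : 0 < √(K : ℝ) := Real.sqrt_pos.2 hK'
  have hb0 : 0 ≤ b := (Real.sqrt_nonneg _).trans hb
  have n1 : 0 ≤ c.Hx ^ 2 * Λ ^ 2 := by positivity
  have n2 : 0 ≤ c.sigDG ^ 2 * Λ := by positivity
  have h1 := tau_term_le (R := R) ha hb0 hK
  have h2 := sq_div_le_div hc.Hf hr ht
    (sqrt_step_le hb (by linarith [sq_nonneg c.sigF]))
  have h3 := sq_div_le_div hc.sigF hr ht
    (sqrt_step_le hb (by linarith [sq_nonneg c.Hf]))
  have h4 := noise_ratio_le hc hsig hK hγ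
  have h5 : 0 ≤ c.Hf / √(K : ℝ) := div_nonneg hc.Hf hr.le
  have e : gapConst c R 0 (tauStep a b K) s κ (gammaStep c m K) K
      + K * (2 * (c.sigF ^ 2 / tauStep a b K) + 12 * m * c.sigG ^ 2 / gammaStep c m K K
        + 0 * (m * (15 * c.sigDG ^ 2 / s)))
      = tauStep a b K / 2 * R ^ 2 + K * (2 * (c.Hf ^ 2 / tauStep a b K)
        + 2 * (c.sigF ^ 2 / tauStep a b K) + 12 * m * c.sigG ^ 2 / gammaStep c m K K) := by
    simp only [gapConst]; ring
  have h6 : K * (2 * (c.Hf ^ 2 / tauStep a b K) + 2 * (c.sigF ^ 2 / tauStep a b K)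
        + 12 * m * c.sigG ^ 2 / gammaStep c m K K)
      ≤ K * (4 * (c.Hf / √(K : ℝ)) + 2 * (c.sigF / √(K : ℝ))
        + c.sigG ^ 2 / (2 * c.sigDG * √(K : ℝ))) :=
    mul_le_mul_of_nonneg_left (by linarith) hK'.le
  have e2 : K * objBound c R a b K
      = K * (a * R ^ 2 / (2 * K) + b * R ^ 2 / (2 * √(K : ℝ)))
        + K * (4 * (c.Hf / √(K : ℝ)) + 2 * (c.sigF / √(K : ℝ))
        + c.sigG ^ 2 / (2 * c.sigDG * √(K : ℝ))) := by
    simp only [objBound]; ring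
  rw [e, e2]
  linarith

theorem gapConst_le (hc : c.Nonneg) (hD : 0 < c.Dy) (ha : 0 ≤ a) (ht : 0 < tauStep a b K)
    (hs : 0 < sigmaStep c K) (hK : 0 < K)
    (hsig : c.sigDG = 0 → c.sigG = 0) (hγ : 0 < gammaStep c m K K) (hΛ : 1 ≤ Λ)
    (hb : √(c.Hx ^ 2 * Λ ^ 2 + c.Hf ^ 2 + c.sigDG ^ 2 * Λ + c.sigF ^ 2) ≤ b) :
    gapConst c R Λ (tauStep a b K) (sigmaStep c K) (60 * m * c.sigDG / √(K : ℝ))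
        (gammaStep c m K) K
      + K * (2 * (c.sigF ^ 2 / tauStep a b K) + 12 * m * c.sigG ^ 2 / gammaStep c m K K
        + Λ * (m * (15 * c.sigDG ^ 2 / sigmaStep c K))) ≤ K * conBound c m R Λ a b K := by
  have hK1 : (1 : ℝ) ≤ K := by exact_mod_cast hK
  have hK' : (0 : ℝ) < K := by positivity
  have hr : 0 < √(K : ℝ) := Real.sqrt_pos.2 hK'
  have hΛ0 : 0 ≤ Λ := by linarith
  have hb0 : 0 ≤ b := (Real.sqrt_nonneg _).trans hb
  have hKr : (K : ℝ) / √(K : ℝ) = √(K : ℝ) := Real.div_sqrt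
  have n1 : 0 ≤ c.Hx ^ 2 * Λ ^ 2 := by positivity
  have n2 : 0 ≤ c.sigDG ^ 2 * Λ := by positivity
  set T := tauStep a b K with hT
  set S := sigmaStep c K with hS
  set A := max (√56 * c.Lyy) (14 * c.Lyx) with hA
  set Q := √(c.Hy ^ 2 + c.sigDG ^ 2) with hQ
  set H := √(c.Hx ^ 2 * Λ ^ 2 + c.Hf ^ 2) with hH
  set G := √(c.sigF ^ 2 + c.sigDG ^ 2 * Λ ^ 2) with hG
  set w := c.sigG ^ 2 / (2 * c.sigDG * √(K : ℝ)) with hw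
  have hA0 : 0 ≤ A := le_max_of_le_right (by linarith [hc.Lyx])
  have hQ0 : 0 ≤ Q := Real.sqrt_nonneg _
  have hH0 : 0 ≤ H := Real.sqrt_nonneg _
  have hQ2 : Q ^ 2 = c.Hy ^ 2 + c.sigDG ^ 2 := Real.sq_sqrt (by positivity)
  have hH2 : H ^ 2 = c.Hx ^ 2 * Λ ^ 2 + c.Hf ^ 2 := Real.sq_sqrt (by positivity)
  have hHyQ : c.Hy ≤ Q := Real.le_sqrt_of_sq_le (by linarith [sq_nonneg c.sigDG])
  have hsQ : c.sigDG ≤ Q := Real.le_sqrt_of_sq_le (by linarith [sq_nonneg c.Hy])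
  have hFG : c.sigF ≤ G := Real.le_sqrt_of_sq_le (by
    have : 0 ≤ c.sigDG ^ 2 * Λ ^ 2 := by positivity
    linarith)
  have hSQ : Q / c.Dy * √(K : ℝ) ≤ S := le_max_right _ _
  have hQr : 0 ≤ Q / c.Dy * √(K : ℝ) := mul_nonneg (div_nonneg hQ0 hD.le) hr.le
  have hSle : S ≤ A + Q / c.Dy * √(K : ℝ) := max_le (by linarith) (by linarith)
  have step : ∀ X : ℝ, 0 ≤ X → X ≤ Q → X ^ 2 / S ≤ X * c.Dy / √(K : ℝ) := fun X hX hXQ => by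
    have h1 : X / c.Dy * √(K : ℝ) ≤ S := (mul_le_mul_of_nonneg_right
      (div_le_div_of_nonneg_right hXQ hD.le) hr.le).trans hSQ
    rw [div_le_div_iff₀ hs hr]
    have h2 : X * √(K : ℝ) ≤ S * c.Dy := by
      rw [div_mul_eq_mul_div, div_le_iff₀ hD] at h1; exact h1
    nlinarith [mul_le_mul_of_nonneg_left h2 hX]
  have t1 := tau_term_le (R := R) ha hb0 hK
  have t2 : 2 * ((c.Hf + Λ * c.Hx) ^ 2 / T) ≤ 4 * H / √(K : ℝ) := by
    have h1 : H ^ 2 / T ≤ H / √(K : ℝ) := sq_div_le_div hH0 hr ht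
      (sqrt_step_le hb (by rw [hH2]; linarith [sq_nonneg c.sigF]))
    have h2 : (c.Hf + Λ * c.Hx) ^ 2 / T ≤ 2 * H ^ 2 / T :=
      div_le_div_of_nonneg_right (by rw [hH2]; nlinarith [sq_nonneg (c.Hf - Λ * c.Hx)]) ht.le
    rw [mul_div_assoc] at h2 ⊢
    linarith
  have t3 : 2 * (c.sigF ^ 2 / T) ≤ 4 * G / √(K : ℝ) := by
    have h1 : c.sigF ^ 2 / T ≤ c.sigF / √(K : ℝ) := sq_div_le_div hc.sigF hr ht
      (sqrt_step_le hb (by linarith [sq_nonneg c.Hf]))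
    have h2 : c.sigF / √(K : ℝ) ≤ G / √(K : ℝ) := div_le_div_of_nonneg_right hFG hr.le
    have h3 : 0 ≤ G / √(K : ℝ) := by positivity
    rw [mul_div_assoc]
    linarith
  have t4 : 12 * m * c.sigG ^ 2 / gammaStep c m K K ≤ w := noise_ratio_le hc hsig hK hγ
  have t5 : Λ * (m * (15 * c.sigDG ^ 2 / S)) ≤ 15 * m * Λ * c.sigDG * c.Dy / √(K : ℝ) := by
    have h1 := mul_le_mul_of_nonneg_left (step c.sigDG hc.sigDG hsQ)
      (by positivity : 0 ≤ 15 * m * Λ)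
    calc Λ * (m * (15 * c.sigDG ^ 2 / S)) = 15 * m * Λ * (c.sigDG ^ 2 / S) := by ring
      _ ≤ _ := h1
      _ = _ := by ring
  have t6 : Λ * ((K + 1) * (7 / 2 * (c.Hy ^ 2 / S))) ≤ K * (7 * Q * c.Dy * Λ / √(K : ℝ)) := by
    have h1 : c.Hy ^ 2 / S ≤ Q * c.Dy / √(K : ℝ) := (step c.Hy hc.Hy hHyQ).trans
      (div_le_div_of_nonneg_right (mul_le_mul_of_nonneg_right hHyQ hD.le) hr.le)
    -- The boundary term makes K + 1 summands; K + 1 ≤ 2K turns 7 / 2 into 7, and the y-step size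
    -- supplies the eighth unit.
    have h2 : ((K : ℝ) + 1) * (7 / 2 * (c.Hy ^ 2 / S)) ≤ (2 * K) * (7 / 2 * (Q * c.Dy / √(K : ℝ))) :=
      mul_le_mul (by linarith) (by linarith) (by positivity) (by positivity)
    calc Λ * ((K + 1) * (7 / 2 * (c.Hy ^ 2 / S))) ≤ Λ * ((2 * K) * (7 / 2 * (Q * c.Dy / √(K : ℝ)))) :=
          mul_le_mul_of_nonneg_left h2 hΛ0
      _ = _ := by ring
  have t7 : S * c.Dy ^ 2 * Λ ≤ K * (A * c.Dy ^ 2 * Λ / K + Q * c.Dy * Λ / √(K : ℝ)) := by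
    have h1 := mul_le_mul_of_nonneg_right hSle (by positivity : 0 ≤ c.Dy ^ 2 * Λ)
    have h2 : K * (A * c.Dy ^ 2 * Λ / K + Q * c.Dy * Λ / √(K : ℝ))
        = A * c.Dy ^ 2 * Λ + K / √(K : ℝ) * (Q * c.Dy * Λ) := by field_simp
    have h3 : Q / c.Dy * √(K : ℝ) * (c.Dy ^ 2 * Λ) = √(K : ℝ) * (Q * c.Dy * Λ) := by field_simp
    rw [h2, hKr]
    linarith
  -- The contributions add up to 45 m Mx² Λ² and 83 m sigDG √K Λ², within the stated 60 and 120.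
  have t8 : gammaStep c m K 0 / 2 * Λ ^ 2
      + 2 * (60 * m * c.sigDG / √(K : ℝ)) / 15 * K * Λ ^ 2 + gammaStep c m K K / 4 * Λ ^ 2
      ≤ K * (60 * m * c.Mx ^ 2 * Λ ^ 2 / K + 120 * m * c.sigDG * Λ ^ 2 / √(K : ℝ)) := by
    have h2 : K * (60 * m * c.Mx ^ 2 * Λ ^ 2 / K + 120 * m * c.sigDG * Λ ^ 2 / √(K : ℝ))
        = 60 * m * c.Mx ^ 2 * Λ ^ 2 + K / √(K : ℝ) * (120 * m * c.sigDG * Λ ^ 2) := by field_simp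
    have h3 : 2 * (60 * m * c.sigDG / √(K : ℝ)) / 15 * K * Λ ^ 2
        = K / √(K : ℝ) * (8 * m * c.sigDG * Λ ^ 2) := by ring
    rw [h2, h3, hKr, gammaStep_zero, gammaStep_last]
    have h4 : 0 ≤ m * c.Mx ^ 2 * Λ ^ 2 := by positivity
    have h5 : 0 ≤ √(K : ℝ) * (m * c.sigDG * Λ ^ 2) :=
      mul_nonneg hr.le (mul_nonneg (mul_nonneg (Nat.cast_nonneg m) hc.sigDG) (sq_nonneg Λ))
    linarith
  -- This term of the bound is pure slack; only its sign matters.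
  have t9 : 0 ≤ √(10 * m) * c.sigDG * c.Dy * Λ / √(K : ℝ) :=
    div_nonneg (mul_nonneg (mul_nonneg (mul_nonneg (Real.sqrt_nonneg _) hc.sigDG) hD.le) hΛ0) hr.le
  have t10 := mul_le_mul_of_nonneg_left (add_le_add (add_le_add (add_le_add t2 t3) t4) t5) hK'.le
  have t11 := mul_nonneg hK'.le t9
  have e1 : 8 * Q * c.Dy * Λ / √(K : ℝ)
      = Q * c.Dy * Λ / √(K : ℝ) + 7 * Q * c.Dy * Λ / √(K : ℝ) := by ring
  simp only [gapConst, conBound, ← hA, ← hQ, ← hH, ← hG, ← hw, e1]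
  linarith

theorem scaled_div_le {X : ℝ} (hX : 0 ≤ X) (hK : 0 < K) : X / K ≤ X / √(K : ℝ) := by
  have hK1 : (1 : ℝ) ≤ K := by exact_mod_cast hK
  have hr : 0 < √(K : ℝ) := Real.sqrt_pos.2 (by linarith)
  refine div_le_div_of_nonneg_left hX hr ?_
  rw [Real.sqrt_le_left (by linarith)]
  nlinarith

/-- Terms in 1 / √K scale exactly, and those in 1 / K are majorised using √K ≤ K. So the bound at K
= 1 fixes the complexity constant. -/
theorem objBound_le (ha : 0 ≤ a) (hK : 0 < K) :
    objBound c R a b K ≤ objBound c R a b 1 / √(K : ℝ) := by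
  have h1 := scaled_div_le (K := K) (show 0 ≤ a * R ^ 2 / 2 by positivity) hK
  have e1 : a * R ^ 2 / (2 * K) = a * R ^ 2 / 2 / K := by rw [div_div]
  simp only [objBound, e1, Nat.cast_one, Real.sqrt_one, mul_one, div_one, add_div]
  simp only [div_div] at h1 ⊢
  linarith

theorem conBound_le (hc : c.Nonneg) (ha : 0 ≤ a) (hΛ : 0 ≤ Λ) (hK : 0 < K) :
    conBound c m R Λ a b K ≤ conBound c m R Λ a b 1 / √(K : ℝ) := by
  have h1 := scaled_div_le (K := K) (show 0 ≤ a * R ^ 2 / 2 by positivity) hK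
  have h2 := scaled_div_le (K := K) (show 0 ≤ 60 * m * c.Mx ^ 2 * Λ ^ 2 by positivity) hK
  have hA0 : 0 ≤ max (√56 * c.Lyy) (14 * c.Lyx) := le_max_of_le_right (by linarith [hc.Lyx])
  have h3 := scaled_div_le (K := K)
    (show 0 ≤ max (√56 * c.Lyy) (14 * c.Lyx) * c.Dy ^ 2 * Λ by positivity) hK
  have e1 : a * R ^ 2 / (2 * K) = a * R ^ 2 / 2 / K := by rw [div_div]
  simp only [conBound, e1, Nat.cast_one, Real.sqrt_one, mul_one, div_one, add_div]
  simp only [div_div] at h1 ⊢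
  linarith

theorem le_of_sq_div_sq_le {B M ε I : ℝ} (hε : 0 < ε) (hK : 0 < K) (hM : B ≤ M)
    (hI : I ≤ B / √(K : ℝ)) (h : M ^ 2 / ε ^ 2 ≤ K) : I ≤ ε := by
  have hr : 0 < √(K : ℝ) := Real.sqrt_pos.2 (by positivity)
  refine hI.trans ((div_le_iff₀ hr).2 (hM.trans ?_))
  rw [← div_pow] at h
  have h1 := Real.le_sqrt_of_sq_le h
  rw [div_le_iff₀ hε] at h1
  linarith

end Schedule

end SGSIP

/-! ### The convergence theorem -/

theorem theorem5 {p q m : ℕ} {Ω Ξ : Type*} [MeasurableSpace Ω] [MeasurableSpace Ξ]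
    (μ : Measure Ω) [IsProbabilityMeasure μ] (ν : Measure Ξ) [IsProbabilityMeasure ν]
    (P : SGSIP.Problem p q m) (D : SGSIP.Gradients p q m) (O : SGSIP.Oracle p q m Ξ)
    (c : SGSIP.Consts) (hc : c.Nonneg)
    (hconv : P.ConvexCompact c.Dy) (hgrad : D.IsSubgradient P)
    (hsmooth : SGSIP.SmoothLipschitz P D c) (horacle : O.IsStochasticOracle ν P D c)
    (hDy : 0 < c.Dy) (hsig : c.sigDG = 0 → c.sigG = 0)
    (xs : SGSIP.Vec p) (hxs : P.IsOptimal xs)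
    (ls : Fin m → ℝ) (hls : P.IsMultiplier xs ls)
    (Λ : ℝ) (hΛ : Λ = (∑ i, |ls i|) + 1)
    (a b : ℝ)
    (ha : max (4 * (c.Lf + 1 + c.sigDG)) (8 * (c.Lyx + c.Lxx) * Λ) ≤ a)
    (hb : √(c.Hx ^ 2 * Λ ^ 2 + c.Hf ^ 2 + c.sigDG ^ 2 * Λ + c.sigF ^ 2) ≤ b)
    (K : ℕ) (hK : 0 < K)
    (hσ : 0 < SGSIP.sigmaStep c K) (hγ : ∀ k < K, 0 < SGSIP.gammaStep c m K k)
    (x0 : SGSIP.Vec p) (hx0 : x0 ∈ P.X) (y0 : Fin m → SGSIP.Vec q) (hy0 : ∀ i, y0 i ∈ P.Y i)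
    (ξ : ℕ → Fin 6 → Ω → Ξ) (hξ : SGSIP.IsIIDSample ξ ν μ)
    (x : ℕ → Ω → SGSIP.Vec p) (y : ℕ → Ω → Fin m → SGSIP.Vec q) (lam : ℕ → Ω → SGSIP.Vec m)
    (hrun : SGSIP.IsRun P O (fun _ => 1) (fun _ => SGSIP.tauStep a b K)
      (fun _ => SGSIP.sigmaStep c K) (fun k => SGSIP.gammaStep c m K k) K x0 y0 0 ξ x y lam) :
    (Integrable (fun ω => P.f (SGSIP.average (fun _ => 1) K x ω) - P.f xs) μ ∧
      ∫ ω, (P.f (SGSIP.average (fun _ => 1) K x ω) - P.f xs) ∂μ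
        ≤ SGSIP.objBound c ‖xs - x0‖ a b K) ∧
    (Integrable (fun ω => P.violation (SGSIP.average (fun _ => 1) K x ω)) μ ∧
      ∫ ω, P.violation (SGSIP.average (fun _ => 1) K x ω) ∂μ
        ≤ SGSIP.conBound c m ‖xs - x0‖ Λ a b K) ∧
    (∀ ε : ℝ, 0 < ε →
      max (SGSIP.objBound c ‖xs - x0‖ a b 1) (SGSIP.conBound c m ‖xs - x0‖ Λ a b 1) ^ 2 / ε ^ 2
        ≤ K →
      ∫ ω, (P.f (SGSIP.average (fun _ => 1) K x ω) - P.f xs) ∂μ ≤ ε ∧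
      ∫ ω, P.violation (SGSIP.average (fun _ => 1) K x ω) ∂μ ≤ ε) := by
  have hr : 0 < √(K : ℝ) := Real.sqrt_pos.2 (by positivity)
  have hr1 : 1 ≤ √(K : ℝ) := Real.one_le_sqrt.2 (by exact_mod_cast hK)
  have hΛ1 : 1 ≤ Λ := by
    rw [hΛ]; linarith [Finset.sum_nonneg fun i (_ : i ∈ Finset.univ) => abs_nonneg (ls i)]
  have ha1 := (le_max_left _ _).trans ha
  have ha2 := (le_max_right _ _).trans ha
  have ha0 : 0 ≤ a := by linarith [hc.Lf, hc.sigDG]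
  have hat : a ≤ SGSIP.tauStep a b K := le_max_left _ _
  have ht : 0 < SGSIP.tauStep a b K := by linarith [hc.Lf, hc.sigDG]
  have h : SGSIP.SampledRun μ ν P D O c (SGSIP.tauStep a b K) (SGSIP.sigmaStep c K)
      (SGSIP.gammaStep c m K) K x0 y0 ξ x y lam :=
    ⟨hc, hconv, hgrad, hsmooth, horacle, hξ, hrun, hx0, hy0, by linarith [hc.sigDG], hσ, hγ⟩
  have hγK : 0 < SGSIP.gammaStep c m K K := SGSIP.gammaStep_last_pos (by positivity) (hγ 0 hK)
  have hγM : 60 * m * c.Mx ^ 2 ≤ SGSIP.gammaStep c m K K := by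
    have h0 := hc.sigDG
    rw [SGSIP.gammaStep_last, le_add_iff_nonneg_right]
    positivity
  have hκ : 0 ≤ 60 * m * c.sigDG / √(K : ℝ) := by
    have h0 := hc.sigDG
    positivity
  have hs1 : 14 * c.Lyx ≤ SGSIP.sigmaStep c K := (le_max_right _ _).trans (le_max_left _ _)
  have hs2 : 7 * c.Lyy ≤ SGSIP.sigmaStep c K := by
    have h1 : (7 : ℝ) ≤ √56 := Real.le_sqrt_of_sq_le (by norm_num)
    exact (mul_le_mul_of_nonneg_right h1 hc.Lyy).trans ((le_max_left _ _).trans (le_max_left _ _))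
  -- With Λ ≥ 1 the parameter t dominates sigDG √K, and 60 / 15 = 4: the decrease of γ exactly pays
  -- for the multiplier-weighted noise.
  have hn1 : 4 * m * c.sigDG ^ 2 / SGSIP.tauStep a b K ≤ 60 * m * c.sigDG / √(K : ℝ) / 15 := by
    have h1 : c.sigDG ^ 2 ≤ c.sigDG ^ 2 * Λ := le_mul_of_one_le_right (sq_nonneg _) hΛ1
    have h2 := SGSIP.sq_div_le_div hc.sigDG hr ht (SGSIP.sqrt_step_le hb
      (by linarith [mul_nonneg (sq_nonneg c.Hx) (sq_nonneg Λ), sq_nonneg c.Hf, sq_nonneg c.sigF]))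
    have h3 := mul_le_mul_of_nonneg_left h2 (by positivity : 0 ≤ 4 * (m : ℝ))
    rw [mul_div_assoc, mul_div_assoc (60 * (m : ℝ))]
    linarith
  -- The part 60 m sigDG √K of the last γ suffices, as √K ≥ 1.
  have hn2 : 12 * m * c.sigDG ^ 2 / SGSIP.gammaStep c m K K ≤ c.sigDG / 2 := by
    have h1 : 0 ≤ m * c.sigDG ^ 2 := by positivity
    have h2 := mul_le_mul_of_nonneg_left hr1 h1
    have h3 : 0 ≤ c.sigDG * (60 * m * c.Mx ^ 2) := mul_nonneg hc.sigDG (by positivity)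
    rw [div_le_div_iff₀ hγK two_pos, SGSIP.gammaStep_last]
    linarith
  have hK' : (0 : ℝ) < K := by positivity
  have hobj_int := h.integrable_objective hK hxs.1.1
  have hvio_int := h.integrable_violation hK hxs.1
  have hobj : ∫ ω, (P.f (SGSIP.average (fun _ => 1) K x ω) - P.f xs) ∂μ
      ≤ SGSIP.objBound c ‖xs - x0‖ a b K := by
    have hN := h.integral_gapNoise xs hDy le_rfl hγK hn1 hn2
    have hpt : ∀ ω, K * (P.f (SGSIP.average (fun _ => 1) K x ω) - P.f xs) ≤ _ := fun ω => by
      have h1 := SGSIP.gap_average_le hK hconv (fun k hk => hrun.x_mem k hk ω)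
        (l := fun _ => 0) (fun _ => le_rfl) hy0 (P.f xs)
      -- With l = 0 the bound on the multipliers may be taken to be 0, so no dual term enters; y0 is
      -- merely some admissible comparison point.
      have h2 := h.gap_le hxs.1 hDy hκ SGSIP.gammaStep_eq_succ_add hγK hγM (ha1.trans hat)
        (Λ := 0) (by linarith) hs1 hs2 ω (l := 0) (fun _ => le_rfl) (by simp) hy0
      simp only [zero_mul, Finset.sum_const_zero, add_zero, PiLp.zero_apply] at h1 h2
      exact h1.trans h2
    have h3 := integral_mono (hobj_int.const_mul (K : ℝ)) ((integrable_const _).add hN.1) hpt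
    rw [integral_const_mul] at h3
    simp only [Pi.add_apply] at h3
    rw [integral_add (integrable_const _) hN.1, integral_const, probReal_univ, one_smul] at h3
    have h4 := SGSIP.gapConst_zero_le (R := ‖xs - x0‖) (s := SGSIP.sigmaStep c K)
      (κ := 60 * m * c.sigDG / √(K : ℝ)) hc ha0 ht hK hsig hγK (by linarith) hb
    exact le_of_mul_le_mul_left (by linarith [hN.2]) hK'
  have hvio : ∫ ω, P.violation (SGSIP.average (fun _ => 1) K x ω) ∂μ
      ≤ SGSIP.conBound c m ‖xs - x0‖ Λ a b K := by
    have hN := h.integral_gapNoise xs hDy (zero_le_one.trans hΛ1) hγK hn1 hn2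
    have hpt : ∀ ω, K * P.violation (SGSIP.average (fun _ => 1) K x ω) ≤ _ := fun ω =>
      SGSIP.violation_average_le hK hconv (fun i => ⟨y0 i, hy0 i⟩) hls
        (fun k hk => hrun.x_mem k hk ω) fun l yh hl hl1 hyh =>
          h.gap_le hxs.1 hDy hκ SGSIP.gammaStep_eq_succ_add hγK hγM (ha1.trans hat)
            (Λ := Λ) (ha2.trans hat) hs1 hs2 ω hl (by rw [hΛ]; exact hl1) hyh
    have h3 := integral_mono (hvio_int.const_mul (K : ℝ)) ((integrable_const _).add hN.1) hpt
    rw [integral_const_mul] at h3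
    simp only [Pi.add_apply] at h3
    rw [integral_add (integrable_const _) hN.1, integral_const, probReal_univ, one_smul] at h3
    have h4 := SGSIP.gapConst_le (R := ‖xs - x0‖) hc hDy ha0 ht hσ hK hsig hγK hΛ1 hb
    exact le_of_mul_le_mul_left (by linarith [hN.2]) hK'
  exact ⟨⟨hobj_int, hobj⟩, ⟨hvio_int, hvio⟩, fun ε hε hKε =>
    ⟨SGSIP.le_of_sq_div_sq_le hε hK (le_max_left _ _) (hobj.trans (SGSIP.objBound_le ha0 hK)) hKε,
      SGSIP.le_of_sq_div_sq_le hε hK (le_max_right _ _)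
        (hvio.trans (SGSIP.conBound_le hc ha0 (by linarith) hK)) hKε⟩⟩
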